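/- **Setting.** A wireless network is a finite directed graph with nonempty link set $E$. Packets follow fixed paths of at least one and at most $D$ links, which may revisit nodes and links; put $m=\max\{|E|,D\}$. Interference is described by a matrix $W\in[0,1]^{E\times E}$ with $W_{e,e}=1$. A family of requests with $R(e)$ requests for each link $e$ has interference measure $\|W R\|_\infty$. On each link at most one packet is transmitted per time slot. *Static algorithm.* $\mathcal A(I,n)$ is a randomized scheduling algorithm. For any at most $n$ requests of interference measure at most $I$ it serves all of them within $f(m)\cdot I+g(m,n)$ time slots with probability at least $1-\frac1{2n^4}$. Here $g(m,\cdot)$ is nondecreasing on $[1,\infty)$ and $g(m,n)=o(n)$ as $n\to\infty$. *Stochastic injection.* There are finitely many generators, each injecting at most one packet per time slot. The law of a generator's injection is the same in all slots, and injections are independent over different generators and different slots. Let $F(e)$ be the expected number of transmissions over $e$ required by the packets injected in one slot (a path using $e$ several times counts with that multiplicity). The injection rate is at most $\lambda$ if every component of $W F$ is at most $\lambda$. Let $0<\varepsilon\le\frac12$ and $\lambda=(1-\varepsilon)/f(m)$. *Protocol.* Call a frame length $T\in\mathbb N$ admissible if $$T\ge \frac{100 f(m)}{\varepsilon^3}+\frac{48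 f(m)\ln m}{\varepsilon^2}\quad\text{and}\quad T\ge\frac{4f(m)}{\varepsilon^2}\,g\!\left(m,\tfrac{m}{f(m)}T\right),$$ and put $J=(1+\varepsilon)\lambda T$. Time is divided into frames of $T$ slots, and the system is empty at first. A packet waits until the beginning of the frame after its injection. In the normal phase of a frame, $\mathcal A(J,mJ)$ is run for $T'=f(m)J+g(m,mJ)$ slots on the next hops of all packets that have not failed so far; a packet whose hop is not made becomes failed. In the clean-up phase, which follows in the same frame, every link with a nonempty buffer of failed packets (those whose next hop is that link) selects, independently with probability $1/m$, the packet of this buffer whose failure is longest ago (with a fixed rule for ties), and $\mathcal A(1,mJ)$ is run for $f(m)+g(m,mJ)$ slots on the selected packets. Fractional phase lengths are rounded down to whole slots. All executions of $\mathcal A$ and all selections use fresh randomness, independent of each other and of the injections. Let the potential $\Phi(t)$ be the total number of remaining hops of all failed packets after $t$ time slots. **Theorem.** All sufficiently large $T$ are admissible. For each admissible $T$, both phases fit into a frame, that is, $T'+f(m)+g(m,mJ)\le T$. Moreover, for each stochastic injection of rate at most $\lambda$, the expected queue lengths are bounded at all times: there is a constant $C$ such that the expected number of undelivered packets after $t$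 time slots is at most $C$ for every $t\ge 0$. Furthermore, for all $t,k\ge 0$, $$\Pr[\Phi(t)\ge k]\le\left(1-\frac1{m^2J}\right)^k .$$ -/

import Mathlib

open MeasureTheory ProbabilityTheory Filter Asymptotics
open scoped Matrix

/-! ### Network, routes, interference -/

/-- A nonempty sequence of links that a packet still has to cross: the next link and those after. -/
structure Route (E : Type*) where
  next : E
  rest : List E

namespace Route

variable {E : Type*}

/-- All links of the route, in order. -/
def links (r : Route E) : List E := r.next :: r.rest

/-- The number of hops that remain. -/
def hops (r : Route E) : ℕ := r.rest.length + 1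

/-- What remains after crossing the next link; `none` means that the packet is delivered. -/
def advance (r : Route E) : Option (Route E) :=
  match r.rest with
  | [] => none
  | e :: l => some ⟨e, l⟩

end Route

/-- A wireless network: a directed graph with link set `E`, the bound `D` on path lengths, and the
interference matrix `W` (`W e e'` is the impact on `e` of a transmission on `e'`). -/
structure Network (V E : Type*) where
  src : E → V
  tgt : E → V
  D : ℕ
  W : Matrix E E ℝ
  W_nonneg : ∀ e e', 0 ≤ W e e'
  W_le_one : ∀ e e', W e e' ≤ 1
  W_diag : ∀ e, W e e = 1

namespace Network

variable {V E : Type*} [Fintype E] [DecidableEq E]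

/-- The network size `max {|E|, D}`. -/
def m (N : Network V E) : ℕ := max (Fintype.card E) N.D

/-- The paths packets may use: consecutive links fit together, and there are at most `D` links.
Nodes (and links) may be visited several times. -/
def Path (N : Network V E) : Type _ :=
  {r : Route E // r.links.IsChain (fun a b => N.tgt a = N.src b) ∧ r.links.length ≤ N.D}

/-- The interference measure `‖W R‖_∞` of a list of requests, where a request is a link and `R e`
is the number of requests for `e`. -/
noncomputable def interference (N : Network V E) (l : List E) : ℝ :=
  ‖N.W *ᵥ (fun e => (l.count e : ℝ))‖

end Network

/-! ### Static algorithms -/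

/-- A randomized static scheduling algorithm for requests on the links `E`. Executed as `𝒜(I, n)`
on a list `l` of requests with a random seed `z`, it makes the `i`-th request of the list succeed
in time slot `a` (counted from the start of the execution) if `run I n l z i = some a`, and not at
all if the value is `none`. Any model of collisions is allowed; it enters through which requests
succeed. On each link at most one packet is transmitted per time slot. -/
structure StaticAlgorithm (E : Type*) where
  Seed : Type*
  [measurableSpaceSeed : MeasurableSpace Seed]
  law : Measure Seed
  [isProbabilityMeasure_law : IsProbabilityMeasure law]
  run : ℝ → ℝ → List E → Seed → ℕ → Option ℕ
  measurableSet_run : ∀ I n l i o, MeasurableSet {z | run I n l z i = o}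
  capacity : ∀ I n l z (i j a : ℕ), i < j → j < l.length → l[i]? = l[j]? →
    run I n l z i = some a → run I n l z j ≠ some a

attribute [instance] StaticAlgorithm.measurableSpaceSeed
attribute [instance] StaticAlgorithm.isProbabilityMeasure_law

/-- Given at most `n` requests of interference measure at most `I`, the execution `𝒜(I, n)` serves
all of them within `f(m) I + g(m, n)` time slots with probability at least `1 - 1 / (2 n ^ 4)`. -/
def StaticAlgorithm.HasScheduleLength {V E : Type*} [Fintype E] [DecidableEq E]
    (A : StaticAlgorithm E) (N : Network V E) (f : ℕ → ℝ) (g : ℕ → ℝ → ℝ) : Prop :=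
  ∀ (I n : ℝ) (l : List E), (l.length : ℝ) ≤ n → N.interference l ≤ I →
    1 - 1 / (2 * n ^ 4) ≤
      A.law.real {z | ∀ i < l.length, ∃ a < ⌊f N.m * I + g N.m n⌋₊, A.run I n l z i = some a}

/-! ### Randomness: stochastic injection, coins and seeds -/

/-- The two phases of a time frame. -/
inductive Phase where
  | normal
  | cleanup

/-- The elementary sources of randomness: generator `g` in time slot `t`, the coin of link `e` in
time frame `k`, the static algorithm in one phase of time frame `k`. -/
inductive Source (G E : Type*) where
  | inject (t : ℕ) (g : G)
  | coin (k : ℕ) (e : E)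
  | seed (k : ℕ) (p : Phase)

/-- The σ-algebra generated by one source of randomness. -/
@[reducible] def Source.sigma {G E Ω P S : Type*} [MeasurableSpace S] (inj : ℕ → G → Ω → Option P)
    (coin : ℕ → E → Ω → Bool) (seed : ℕ → Phase → Ω → S) : Source G E → MeasurableSpace Ω
  | .inject t g => MeasurableSpace.comap (inj t g) ⊤
  | .coin k e => MeasurableSpace.comap (coin k e) ⊤
  | .seed k p => MeasurableSpace.comap (seed k p) inferInstance

/-- The random input of the protocol. `inj t g ω = some P` means that generator `g` injects in slot
`t` a packet to be routed along `P`, and `none` that it injects nothing, so that a generator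
injects at most one packet per slot. Injections have the same distribution in each slot, coins come
up with probability `1 / m`, each execution of the static algorithm uses a fresh seed, and
everything is independent over different slots, generators, links, frames and phases. -/
structure ProtocolInput {V E : Type*} [Fintype E] [DecidableEq E] (N : Network V E)
    (A : StaticAlgorithm E) (G : Type*) {Ω : Type*} [MeasurableSpace Ω] (μ : Measure Ω) where
  inj : ℕ → G → Ω → Option N.Path
  coin : ℕ → E → Ω → Bool
  seed : ℕ → Phase → Ω → A.Seed
  measurableSet_inj : ∀ t g p, MeasurableSet {ω | inj t g ω = p}
  measurable_coin : ∀ k e, Measurable (coin k e)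
  measurable_seed : ∀ k p, Measurable (seed k p)
  inj_identDistrib : ∀ t t' g p, μ {ω | inj t g ω = p} = μ {ω | inj t' g ω = p}
  coin_law : ∀ k e, μ.real {ω | coin k e ω = true} = 1 / (N.m : ℝ)
  seed_law : ∀ k p, μ.map (seed k p) = A.law
  indep : iIndep (Source.sigma inj coin seed) μ

namespace ProtocolInput

variable {V E : Type*} [Fintype E] [DecidableEq E] {N : Network V E} {A : StaticAlgorithm E}
  {G : Type*} [Fintype G] {Ω : Type*} [MeasurableSpace Ω] {μ : Measure Ω}

/-- `F e`: the expected number of transmissions over `e` needed by the packets injected in slot `t`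
(a path that crosses `e` several times counts that often). -/
noncomputable def load (X : ProtocolInput N A G μ) (t : ℕ) (e : E) : ℝ :=
  ∑ g : G, ∫ ω, (match X.inj t g ω with
    | none => 0
    | some P => (P.1.links.count e : ℝ)) ∂μ

/-- The injection rate is at most `lam`: each component of `W F` is bounded by `lam`. -/
def RateAtMost (X : ProtocolInput N A G μ) (lam : ℝ) : Prop :=
  ∀ t e, (N.W *ᵥ X.load t) e ≤ lam

/-- The packets injected in the `s` time slots from slot `t₀` on. -/
noncomputable def injected (X : ProtocolInput N A G μ) (t₀ s : ℕ) (ω : Ω) : List (Route E) :=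
  (List.range s).flatMap fun i =>
    (Finset.univ : Finset G).toList.filterMap fun g => (X.inj (t₀ + i) g ω).map Subtype.val

end ProtocolInput

/-! ### The frame-based protocol -/

/-- Packets in the network that are not waiting at their generator any more: those that have not
failed, and the failed ones, in the order of their failures. The buffer of failed packets of link
`e` consists of the failed packets whose next link is `e`. -/
structure NetState (E : Type*) where
  unfailed : List (Route E)
  failed : List (Route E)

namespace Protocol

variable {E : Type*} [DecidableEq E]

/-- Under the schedule `σ`, request `i` succeeds within the first `x` slots. -/
def servedBy (σ : ℕ → Option ℕ) (i x : ℕ) : Bool :=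
  match σ i with
  | none => false
  | some a => decide (a < x)

/-- The unfailed packets after `s` slots of a frame whose normal phase takes `L` slots and follows
the schedule `σ`. -/
def unfailedAfter (σ : ℕ → Option ℕ) (L s : ℕ) (l : List (Route E)) : List (Route E) :=
  l.zipIdx.filterMap fun x =>
    if servedBy σ x.2 (min s L) then x.1.advance else if s < L then some x.1 else none

/-- The packets that fail in a normal phase of `L` slots with schedule `σ`. -/
def failures (σ : ℕ → Option ℕ) (L : ℕ) (l : List (Route E)) : List (Route E) :=
  l.zipIdx.filterMap fun x => if servedBy σ x.2 L then none else some x.1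

/-- The links with a nonempty buffer of failed packets whose coin came up; they select a packet. -/
def selected (coin : E → Bool) (l : List (Route E)) : List E :=
  (l.map Route.next).dedup.filter (fun e => coin e)

/-- The failed packets after `x` slots of a clean-up phase that starts with the list `l` of failed
packets and runs the schedule `σ` for the requests `sel`: each link of `sel` transmits the packet
of its buffer whose failure is longest ago. -/
def failedAfter (sel : List E) (σ : ℕ → Option ℕ) (x : ℕ) (l : List (Route E)) :
    List (Route E) :=
  l.zipIdx.filterMap fun y =>
    if y.2 = (l.map Route.next).idxOf y.1.next ∧ y.1.next ∈ sel ∧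
        servedBy σ (sel.idxOf y.1.next) x then
      y.1.advance
    else some y.1

end Protocol

/-- The parameters of the protocol: the functions `f` and `g` of the static algorithm, `ε`, and the
frame length `T`. -/
structure FrameParams where
  f : ℕ → ℝ
  g : ℕ → ℝ → ℝ
  ε : ℝ
  T : ℕ

namespace FrameParams

/-- The injection rate `λ = (1 - ε) / f(m)`. -/
noncomputable def rate (p : FrameParams) (m : ℕ) : ℝ := (1 - p.ε) / p.f m

/-- `J = (1 + ε) λ T`. -/
noncomputable def J (p : FrameParams) (m : ℕ) : ℝ := (1 + p.ε) * p.rate m * p.T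

/-- The length `T' = f(m) J + g(m, m J)` of the normal phase. -/
noncomputable def normalLength (p : FrameParams) (m : ℕ) : ℝ :=
  p.f m * p.J m + p.g m (m * p.J m)

/-- The length `f(m) + g(m, m J)` of the execution in the clean-up phase. -/
noncomputable def cleanupLength (p : FrameParams) (m : ℕ) : ℝ :=
  p.f m * 1 + p.g m (m * p.J m)

/-- The conditions on the frame length. -/
def Admissible (p : FrameParams) (m : ℕ) : Prop :=
  100 * p.f m / p.ε ^ 3 + 48 * p.f m * Real.log m / p.ε ^ 2 ≤ p.T ∧
    4 * p.f m / p.ε ^ 2 * p.g m (m / p.f m * p.T) ≤ p.T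

end FrameParams

namespace ProtocolInput

variable {V E : Type*} [Fintype E] [DecidableEq E] {N : Network V E} {A : StaticAlgorithm E}
  {G : Type*} [Fintype G] {Ω : Type*} [MeasurableSpace Ω] {μ : Measure Ω}

/-- The state after `s` slots of frame `k`, if the frame starts in state `S`: first
`𝒜(J, m J)` runs on the next links of all unfailed packets, then `𝒜(1, m J)` runs on the selected
failed packets (including those that failed in this frame). -/
noncomputable def within (X : ProtocolInput N A G μ) (p : FrameParams) (k : ℕ) (ω : Ω)
    (S : NetState E) (s : ℕ) : NetState E :=
  let n : ℝ := N.m * p.J N.m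
  let L₁ := ⌊p.normalLength N.m⌋₊
  let L₂ := ⌊p.cleanupLength N.m⌋₊
  let σ₁ := A.run (p.J N.m) n (S.unfailed.map Route.next) (X.seed k .normal ω)
  let B := S.failed ++ Protocol.failures σ₁ L₁ S.unfailed
  let sel := Protocol.selected (fun e => X.coin k e ω) B
  let σ₂ := A.run 1 n sel (X.seed k .cleanup ω)
  { unfailed := Protocol.unfailedAfter σ₁ L₁ s S.unfailed
    failed := if s < L₁ then S.failed else Protocol.failedAfter sel σ₂ (min (s - L₁) L₂) B }

/-- The state at the beginning of frame `k`, which comprises the time slots `k T, …, k T + T - 1`.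
The system is empty at first, and a packet joins at the beginning of the frame after its
injection. -/
noncomputable def frameStart (X : ProtocolInput N A G μ) (p : FrameParams) :
    ℕ → Ω → NetState E
  | 0, _ => ⟨[], []⟩
  | k + 1, ω =>
    let S := X.within p k ω (X.frameStart p k ω) p.T
    ⟨S.unfailed ++ X.injected (k * p.T) p.T ω, S.failed⟩

/-- The state after the first `t` time slots. -/
noncomputable def stateAt (X : ProtocolInput N A G μ) (p : FrameParams) (t : ℕ) (ω : Ω) :
    NetState E :=
  X.within p (t / p.T) ω (X.frameStart p (t / p.T) ω) (t % p.T)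

/-- The number of undelivered packets after the first `t` time slots: packets waiting for the
next frame, unfailed packets and failed packets. -/
noncomputable def queueLength (X : ProtocolInput N A G μ) (p : FrameParams) (t : ℕ) (ω : Ω) : ℕ :=
  (X.injected (t / p.T * p.T) (t % p.T) ω).length + (X.stateAt p t ω).unfailed.length +
    (X.stateAt p t ω).failed.length

/-- The potential `Φ` after the first `t` time slots: the total number of remaining hops of all
failed packets. -/
noncomputable def potential (X : ProtocolInput N A G μ) (p : FrameParams) (t : ℕ) (ω : Ω) : ℕ :=
  ((X.stateAt p t ω).failed.map Route.hops).sum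

end ProtocolInput

/-!
The proof is a drift argument for an exponential Lyapunov function of the potential `Φ`.

Put `q = 1 - 1 / (m² J)` and `β = 1 / q`, and let `h(0) = 0` and `h(n) = β ^ n` for `n > 0`
(`lyapunov`). As `Φ ≥ k > 0` means `h(Φ) ≥ β ^ k`, Markov's inequality reduces the tail bound to
`E[h(Φ(t))] ≤ 1` (`ProtocolInput.Standing.lintegral_buffer_le_one`). The bound on the expected
queue length follows, because packets that have not failed leave the network within `m` frames.

*Frames without overload.* If the requests of a frame have interference measure at most `J`, then
there are at most `m J` of them, so the normal phase fails with probability at most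
`1 / (2 (m J)⁴)`, and even then `Φ` grows by at most `m² J` and `h` by a factor of at most about
`e`. If there are failed packets, then with probability at least `1 / (3 m)` the clean-up phase
serves exactly one selected packet, and `Φ` drops. Together this gives a relative drift of order
`1 / (m³ J)` (`ProtocolInput.lintegral_frame_le`). The coins and seeds of a frame are independent of
all injections, so the drift holds with an arbitrary weight that depends on the injections only.

*Overload.* The unfailed packets at the beginning of a frame are among those that would be present
if every packet made one hop per frame (`ProtocolInput.unfailed_sublist`). This virtual list is a
function of the injections in the last `m` frames, and its expected interference measure is at most
`λ T = J / (1 + ε)`. Time is therefore divided into blocks of `m` frames, and a block is overloaded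
if the virtual list of one of its frames has interference measure more than `J`. In an overloaded
block `Φ` grows at most by the number of hops of what was injected during the block and the block
before, since a packet fails only once (`ProtocolInput.hopSum_le_add_windowHops`). A Chernoff bound
for the joint exponential moment of these hops and of the load of a link shows that this
contribution is negligible (`ProtocolInput.lintegral_overload_le`, `overload_small`).

*Blocks.* Overloads of neighbouring blocks are dependent, and they also depend on the state, as both
are functions of the same injections. So the recursion over the blocks is unrolled with weights that
are functions of the injections (`ProtocolInput.Standing.lintegral_level_le_sum`). This leaves the
expectations of products of block weights. The weights of blocks that are not neighbours are
independent, so the products are split by parity with `2 a b ≤ a² + b²`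
(`ProtocolInput.Standing.lintegral_prod_blockWeight_le`), and the second moments of the weights give
a convergent geometric series.

That `f(m) ≥ 1` holds (`one_le_f`) is a consequence of the capacity of a single link.
-/

set_option linter.unusedSectionVars false

open scoped ENNReal

/-! ### Lists of routes -/

section Routes

variable {E : Type*}

/-- The total number of remaining hops of a list of routes. -/
def hopSum (l : List (Route E)) : ℕ := (l.map Route.hops).sum

@[simp] lemma hopSum_append (l l' : List (Route E)) : hopSum (l ++ l') = hopSum l + hopSum l' := by
  simp [hopSum]

lemma Route.hops_pos (r : Route E) : 0 < r.hops := Nat.succ_pos _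

lemma Route.length_links (r : Route E) : r.links.length = r.hops := rfl

lemma Route.advance_elim_hops (r : Route E) : r.advance.elim 0 Route.hops = r.hops - 1 := by
  rcases r with ⟨e, _ | ⟨a, l⟩⟩ <;> rfl

lemma Route.links_of_advance {r r' : Route E} (h : r.advance = some r') :
    r'.links = r.links.tail := by
  rcases r with ⟨e, _ | ⟨a, l⟩⟩
  · simp [Route.advance] at h
  · simp only [Route.advance, Option.some.injEq] at h
    subst h
    rfl

lemma sum_map_filterMap {α β M : Type*} [AddMonoid M] (F : α → Option β) (φ : β → M) (l : List α) :
    ((l.filterMap F).map φ).sum = (l.map fun x => (F x).elim 0 φ).sum := by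
  induction l with
  | nil => rfl
  | cons a l ih =>
    rw [List.filterMap_cons]
    cases h : F a <;> simp [ih, h]

lemma hopSum_eq_zipIdx (l : List (Route E)) :
    hopSum l = (l.zipIdx.map fun x => x.1.hops).sum := by
  conv_lhs => rw [hopSum, ← List.zipIdx_map_fst 0 l, List.map_map]
  rfl

lemma length_le_hopSum (l : List (Route E)) : l.length ≤ hopSum l := by
  induction l with
  | nil => simp
  | cons r l ih =>
    have := r.hops_pos
    simp only [hopSum, List.map_cons, List.sum_cons, List.length_cons] at ih ⊢
    omega

lemma List.Sublist.hopSum_le {l l' : List (Route E)} (h : l.Sublist l') : hopSum l ≤ hopSum l' :=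
  (h.map Route.hops).sum_le_sum (fun _ _ => Nat.zero_le _)

lemma hopSum_le_length_mul {l : List (Route E)} {M : ℕ} (h : ∀ r ∈ l, r.hops ≤ M) :
    hopSum l ≤ l.length * M := by
  have := List.sum_le_card_nsmul (l.map Route.hops) M (by simpa using h)
  simpa [hopSum] using this

lemma servedBy_eq_true {σ : ℕ → Option ℕ} {i x : ℕ} :
    Protocol.servedBy σ i x = true ↔ ∃ a < x, σ i = some a := by
  unfold Protocol.servedBy
  cases σ i <;> simp

lemma unfailedAfter_sublist (σ : ℕ → Option ℕ) (L s : ℕ) (h : L ≤ s) (l : List (Route E)) :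
    (Protocol.unfailedAfter σ L s l).Sublist (l.filterMap Route.advance) := by
  have key : ∀ (l : List (Route E)) (n : ℕ), ((l.zipIdx n).filterMap fun x =>
      if Protocol.servedBy σ x.2 (min s L) then x.1.advance else if s < L then some x.1
        else none).Sublist (l.filterMap Route.advance) := by
    intro l
    induction l with
    | nil => simp
    | cons r l ih =>
      intro n
      have h' : ¬ s < L := by omega
      rw [List.zipIdx_cons, List.filterMap_cons, List.filterMap_cons]
      simp only [h', if_false] at ih ⊢
      by_cases hs : Protocol.servedBy σ n (min s L) = true
      · simp only [hs, if_true]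
        cases r.advance with
        | none => exact ih _
        | some r' => exact (ih _).cons_cons r'
      · simp only [hs]
        cases r.advance with
        | none => exact ih _
        | some r' => exact (ih _).cons r'
  exact key l 0

lemma length_unfailedAfter_le (σ : ℕ → Option ℕ) (L s : ℕ) (l : List (Route E)) :
    (Protocol.unfailedAfter σ L s l).length ≤ l.length := by
  refine (List.length_filterMap_le _ _).trans ?_
  simp

/-- A packet that takes part in a normal phase either makes its hop or fails. -/
lemma hopSum_unfailedAfter_add_failures (σ : ℕ → Option ℕ) (L s : ℕ) (h : L ≤ s)
    (l : List (Route E)) :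
    hopSum (Protocol.unfailedAfter σ L s l) + hopSum (Protocol.failures σ L l) ≤ hopSum l := by
  rw [hopSum_eq_zipIdx l, hopSum, hopSum, Protocol.unfailedAfter, Protocol.failures,
    sum_map_filterMap, sum_map_filterMap, ← List.sum_map_add]
  refine List.sum_le_sum fun x _ => ?_
  have h' : ¬ s < L := by omega
  rw [min_eq_right h]
  by_cases hs : Protocol.servedBy σ x.2 L = true
  · simp [hs, Route.advance_elim_hops]
  · simp [hs, h']

lemma hopSum_failures_le (σ : ℕ → Option ℕ) (L : ℕ) (l : List (Route E)) :
    hopSum (Protocol.failures σ L l) ≤ hopSum l := by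
  have := hopSum_unfailedAfter_add_failures σ L L le_rfl l
  omega

lemma failures_eq_nil (σ : ℕ → Option ℕ) (L : ℕ) (l : List (Route E))
    (h : ∀ i < l.length, ∃ a < L, σ i = some a) : Protocol.failures σ L l = [] := by
  rw [Protocol.failures, List.filterMap_eq_nil_iff]
  rintro ⟨r, i⟩ hx
  have hi : i < l.length := by
    have := List.snd_lt_of_mem_zipIdx hx
    omega
  simp [servedBy_eq_true.mpr (h i hi)]

variable [DecidableEq E]

lemma hopSum_failedAfter_le (sel : List E) (σ : ℕ → Option ℕ) (x : ℕ) (l : List (Route E)) :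
    hopSum (Protocol.failedAfter sel σ x l) ≤ hopSum l := by
  rw [hopSum_eq_zipIdx l, hopSum, Protocol.failedAfter, sum_map_filterMap]
  refine List.sum_le_sum fun y _ => ?_
  split_ifs
  · simp [Route.advance_elim_hops]
  · simp

/-- If a selected link is served, then the packet it transmits makes a hop. -/
lemma hopSum_failedAfter_lt (sel : List E) (σ : ℕ → Option ℕ) (x : ℕ) (l : List (Route E)) (e : E)
    (hl : e ∈ l.map Route.next) (hsel : e ∈ sel)
    (hs : Protocol.servedBy σ (sel.idxOf e) x = true) :
    hopSum (Protocol.failedAfter sel σ x l) < hopSum l := by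
  rw [hopSum_eq_zipIdx l, hopSum, Protocol.failedAfter, sum_map_filterMap]
  have hi := List.idxOf_lt_length_of_mem hl
  have hi' : (l.map Route.next).idxOf e < l.length := by simpa using hi
  have hnext : (l[(l.map Route.next).idxOf e]).next = e := by
    rw [← List.getElem_map (f := Route.next) (h := hi)]
    exact List.getElem_idxOf hi
  refine List.sum_lt_sum _ _ (fun y _ => ?_) 
    ⟨(l[(l.map Route.next).idxOf e], (l.map Route.next).idxOf e), ?_, ?_⟩
  · split_ifs
    · simp [Route.advance_elim_hops]
    · simp
  · exact (List.mk_mem_zipIdx_iff_getElem?).2 (List.getElem?_eq_getElem hi')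
  · have := (l[(l.map Route.next).idxOf e]).hops_pos
    simp only [hnext, true_and, hsel, hs, if_true, Route.advance_elim_hops]
    omega

/-- If only the coin of `e` comes up, then at most the packet of `e` is selected. -/
lemma selected_eq_singleton (coin : E → Bool) (l : List (Route E)) (e : E)
    (hl : e ∈ l.map Route.next) (h : ∀ e', coin e' = decide (e' = e)) :
    Protocol.selected coin l = [e] := by
  have hn : ((l.map Route.next).dedup).Nodup := List.nodup_dedup _
  have : (fun e' => coin e') = (fun e' => e' == e) := by
    funext e'
    rw [h e']
    by_cases he : e' = e <;> simp [he]
  rw [Protocol.selected, this, List.filter_beq, hn.count, if_pos (List.mem_dedup.2 hl)]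
  rfl

end Routes

/-! ### Interference of lists of requests -/

namespace Network

variable {V E : Type*} [Fintype E] [DecidableEq E] (N : Network V E)

lemma one_le_m [Nonempty E] : 1 ≤ N.m := le_max_of_le_left Fintype.card_pos

lemma card_le_m : Fintype.card E ≤ N.m := le_max_left _ _

lemma hops_le_m (P : N.Path) : P.1.hops ≤ N.m := by
  have := P.2.2
  rw [Route.length_links] at this
  exact this.trans (le_max_right _ _)

lemma mulVec_count (l : List E) (e : E) :
    (N.W *ᵥ fun e' => (l.count e' : ℝ)) e = (l.map (N.W e)).sum := by
  rw [Finset.sum_list_map_count]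
  simp only [Matrix.mulVec, dotProduct, nsmul_eq_mul]
  rw [← Finset.sum_subset (Finset.subset_univ l.toFinset)]
  · exact Finset.sum_congr rfl fun _ _ => mul_comm _ _
  · intro x _ hx
    rw [List.mem_toFinset, ← List.count_eq_zero] at hx
    simp [hx]

lemma sum_map_W_nonneg (l : List E) (e : E) : 0 ≤ (l.map (N.W e)).sum :=
  List.sum_nonneg fun x hx => by
    obtain ⟨a, -, rfl⟩ := List.mem_map.1 hx
    exact N.W_nonneg _ _

lemma interference_le_iff {l : List E} {I : ℝ} (hI : 0 ≤ I) :
    N.interference l ≤ I ↔ ∀ e, (l.map (N.W e)).sum ≤ I := by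
  rw [interference, pi_norm_le_iff_of_nonneg hI]
  refine forall_congr' fun e => ?_
  rw [mulVec_count, Real.norm_of_nonneg (N.sum_map_W_nonneg l e)]

/-- As `W e e = 1`, the interference measure bounds the number of requests per link. -/
lemma length_le_of_interference {l : List E} {I : ℝ} (hI : 0 ≤ I) (h : N.interference l ≤ I) :
    (l.length : ℝ) ≤ N.m * I := by
  have h1 : (l.length : ℝ) = ∑ e : E, (l.count e : ℝ) := by
    rw [← Nat.cast_sum, List.sum_toFinset_count_eq_length l |>.symm]
    congr 1
    refine Finset.sum_subset (Finset.subset_univ _) fun x _ hx => ?_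
    rwa [List.mem_toFinset, ← List.count_eq_zero] at hx
  have h2 : ∀ e : E, (l.count e : ℝ) ≤ I := by
    intro e
    refine le_trans ?_ ((N.interference_le_iff hI).1 h e)
    rw [← mulVec_count]
    refine le_trans ?_ (Finset.single_le_sum (f := fun e' => N.W e e' * (l.count e' : ℝ))
      (fun e' _ => mul_nonneg (N.W_nonneg _ _) (Nat.cast_nonneg _)) (Finset.mem_univ e))
    simp [N.W_diag]
  rw [h1]
  calc ∑ e : E, (l.count e : ℝ) ≤ ∑ _e : E, I := Finset.sum_le_sum fun e _ => h2 e
    _ = Fintype.card E * I := by simp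
    _ ≤ N.m * I := by
      gcongr
      exact_mod_cast N.card_le_m

lemma interference_replicate_le (n : ℕ) (e : E) : N.interference (List.replicate n e) ≤ n := by
  rw [N.interference_le_iff (Nat.cast_nonneg n)]
  intro e'
  simpa using mul_le_mul_of_nonneg_left (N.W_le_one e' e) (Nat.cast_nonneg n)

lemma interference_le_of_sublist {l l' : List E} {I : ℝ} (hI : 0 ≤ I) (h : l.Sublist l')
    (hl : ∀ e, (l'.map (N.W e)).sum ≤ I) : N.interference l ≤ I := by
  rw [N.interference_le_iff hI]
  refine fun e => le_trans ?_ (hl e)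
  refine (h.map (N.W e)).sum_le_sum fun x hx => ?_
  obtain ⟨a, -, rfl⟩ := List.mem_map.1 hx
  exact N.W_nonneg _ _

end Network

/-! ### Numerical estimates -/

section Numerics

/-- The ratio `1 - 1 / (m² J)` of the geometric tail. -/
noncomputable def tailRatio (M : ℕ) (J : ℝ) : ℝ := 1 - 1 / ((M : ℝ) ^ 2 * J)

/-- The base `β` of the exponential Lyapunov function, the inverse of the ratio of the tail. -/
noncomputable def growth (M : ℕ) (J : ℝ) : ℝ := (tailRatio M J)⁻¹

/-- The failure probability `1 / (2 n⁴)` of the static algorithm for `n = m J`. -/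
noncomputable def failProb (M : ℕ) (J : ℝ) : ℝ := 1 / (2 * ((M : ℝ) * J) ^ 4)

/-- The relative decrease of the Lyapunov function that each clean-up phase guarantees. -/
noncomputable def drift (M : ℕ) (J : ℝ) : ℝ := 1 / (3 * (M : ℝ) ^ 3 * J)

variable {M : ℕ} {J : ℝ}

lemma le_sq_mul (hM : 1 ≤ M) (hJ : 600 ≤ J) : 600 * (M : ℝ) ≤ (M : ℝ) ^ 2 * J := by
  have h1 : (1 : ℝ) ≤ M := by exact_mod_cast hM
  nlinarith [mul_nonneg (sub_nonneg.2 h1) (by linarith : (0 : ℝ) ≤ M),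
    mul_nonneg (sq_nonneg (M : ℝ)) (sub_nonneg.2 hJ)]

lemma sq_mul_ge (hM : 1 ≤ M) (hJ : 600 ≤ J) : 600 ≤ (M : ℝ) ^ 2 * J := by
  have h1 : (1 : ℝ) ≤ M := by exact_mod_cast hM
  linarith [le_sq_mul hM hJ]

lemma tailRatio_pos (hM : 1 ≤ M) (hJ : 600 ≤ J) : 0 < tailRatio M J := by
  have h := sq_mul_ge hM hJ
  rw [tailRatio, sub_pos, div_lt_one (by linarith)]
  linarith

lemma tailRatio_lt_one (hM : 1 ≤ M) (hJ : 600 ≤ J) : tailRatio M J < 1 := by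
  have h := sq_mul_ge hM hJ
  have : 0 < 1 / ((M : ℝ) ^ 2 * J) := by positivity
  rw [tailRatio]
  linarith

lemma one_le_growth (hM : 1 ≤ M) (hJ : 600 ≤ J) : 1 ≤ growth M J :=
  (one_le_inv₀ (tailRatio_pos hM hJ)).2 (tailRatio_lt_one hM hJ).le

lemma growth_pow_le_exp (hM : 1 ≤ M) (hJ : 600 ≤ J) (n : ℕ) :
    growth M J ^ n ≤ Real.exp (n / ((M : ℝ) ^ 2 * J - 1)) := by
  have h := sq_mul_ge hM hJ
  set a := (M : ℝ) ^ 2 * J with ha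
  have h1 : growth M J = 1 / (a - 1) + 1 := by
    rw [growth, tailRatio, ← ha]
    have : a ≠ 0 := by linarith
    have : a - 1 ≠ 0 := by linarith
    field_simp
    ring
  have h2 : growth M J ≤ Real.exp (1 / (a - 1)) := by
    rw [h1]
    exact Real.add_one_le_exp _
  calc growth M J ^ n ≤ Real.exp (1 / (a - 1)) ^ n :=
        pow_le_pow_left₀ (by linarith [one_le_growth hM hJ]) h2 n
    _ = Real.exp (n / (a - 1)) := by
        rw [← Real.exp_nat_mul]
        congr 1
        ring

lemma growth_pow_le_three (hM : 1 ≤ M) (hJ : 600 ≤ J) (n : ℕ) (hn : (n : ℝ) ≤ (M : ℝ) ^ 2 * J) :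
    growth M J ^ n ≤ 3 := by
  have h := sq_mul_ge hM hJ
  refine (growth_pow_le_exp hM hJ n).trans ?_
  set a := (M : ℝ) ^ 2 * J with ha
  have h1 : (n : ℝ) / (a - 1) ≤ 1 + 1 / 599 := by
    rw [div_le_iff₀ (by linarith)]
    linarith
  have h2 : Real.exp (1 / 599) ≤ 599 / 598 := by
    have := Real.add_one_le_exp (-(1 / 599 : ℝ))
    rw [Real.exp_neg] at this
    have hp := Real.exp_pos (1 / 599 : ℝ)
    have h3 : (598 / 599 : ℝ) ≤ (Real.exp (1 / 599))⁻¹ := by linarith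
    rw [le_inv_comm₀ (by norm_num) hp] at h3
    refine h3.trans (by norm_num)
  calc Real.exp (n / (a - 1)) ≤ Real.exp (1 + 1 / 599) := Real.exp_le_exp.2 h1
    _ = Real.exp 1 * Real.exp (1 / 599) := Real.exp_add _ _
    _ ≤ 2.7182818286 * (599 / 598) := by
        have := Real.exp_one_lt_d9
        gcongr
    _ ≤ 3 := by norm_num

lemma growth_pow_two_mul_le (hM : 1 ≤ M) (hJ : 600 ≤ J) (n : ℕ) (hn : n ≤ M) :
    growth M J ^ (2 * n) ≤ 1 + 3 / ((M : ℝ) ^ 2 * J) * n := by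
  have h := sq_mul_ge hM hJ
  have h' := le_sq_mul hM hJ
  refine (growth_pow_le_exp hM hJ _).trans ?_
  set a := (M : ℝ) ^ 2 * J with ha
  have h1 : (1 : ℝ) ≤ M := by exact_mod_cast hM
  have hn' : (n : ℝ) ≤ M := by exact_mod_cast hn
  set x : ℝ := ((2 * n : ℕ) : ℝ) / (a - 1) with hx
  have hx0 : 0 ≤ x := by
    have : 0 < a - 1 := by linarith
    positivity
  have hx1 : x ≤ 1 / 100 := by
    rw [hx, div_le_iff₀ (by linarith)]
    push_cast
    linarith
  have hx2 : 1.2 * x ≤ 3 / a * n := by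
    rw [hx, ← mul_div_assoc, div_mul_eq_mul_div, div_le_div_iff₀ (by linarith) (by linarith)]
    push_cast
    nlinarith [(Nat.cast_nonneg n : (0 : ℝ) ≤ n)]
  have h2 : Real.exp x ≤ 1 / (1 - x) := by
    have := Real.add_one_le_exp (-x)
    rw [Real.exp_neg] at this
    have h3 : (1 - x : ℝ) ≤ (Real.exp x)⁻¹ := by linarith
    rw [le_inv_comm₀ (by linarith) (Real.exp_pos x)] at h3
    simpa using h3
  refine h2.trans ?_
  rw [div_le_iff₀ (by linarith)]
  nlinarith

lemma failProb_pos (hM : 1 ≤ M) (hJ : 600 ≤ J) : 0 < failProb M J := by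
  have h1 : (1 : ℝ) ≤ M := by exact_mod_cast hM
  have : 0 < (M : ℝ) * J := by positivity
  rw [failProb]
  positivity

lemma drift_pos (hM : 1 ≤ M) (hJ : 600 ≤ J) : 0 < drift M J := by
  have h1 : (1 : ℝ) ≤ M := by exact_mod_cast hM
  rw [drift]
  positivity

lemma drift_mul_le (hM : 1 ≤ M) (hJ : 600 ≤ J) : drift M J * M ≤ 1 / 100 := by
  have h1 : (1 : ℝ) ≤ M := by exact_mod_cast hM
  rw [drift, div_mul_eq_mul_div, div_le_div_iff₀ (by positivity) (by norm_num)]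
  have : (M : ℝ) ^ 1 ≤ M ^ 3 := pow_le_pow_right₀ h1 (by norm_num)
  nlinarith

lemma failProb_mul_le (hM : 1 ≤ M) (hJ : 600 ≤ J) : 3 * failProb M J * M ≤ drift M J / 80 := by
  have h1 : (1 : ℝ) ≤ M := by exact_mod_cast hM
  have hJ3 : (600 : ℝ) ^ 3 ≤ J ^ 3 := pow_le_pow_left₀ (by norm_num) hJ 3
  rw [failProb, drift, mul_one_div, div_mul_eq_mul_div, div_div, div_le_div_iff₀ (by positivity)
    (by positivity)]
  have h2 : (M : ℝ) ^ 4 * J * 360 ≤ (M : ℝ) ^ 4 * J * J ^ 3 := by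
    gcongr
    linarith
  nlinarith

lemma failProb_le (hM : 1 ≤ M) (hJ : 600 ≤ J) : failProb M J ≤ 1 / 100 := by
  have h1 : (1 : ℝ) ≤ M := by exact_mod_cast hM
  have h2 := failProb_mul_le hM hJ
  have h3 := drift_mul_le hM hJ
  have h4 := failProb_pos hM hJ
  have h5 := drift_pos hM hJ
  nlinarith

lemma failProb_le_drift (hM : 1 ≤ M) (hJ : 600 ≤ J) : 3 * failProb M J ≤ drift M J / 2 := by
  have h1 : (1 : ℝ) ≤ M := by exact_mod_cast hM
  have h2 := failProb_mul_le hM hJ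
  have h4 := failProb_pos hM hJ
  have h5 := drift_pos hM hJ
  nlinarith

/-- The probability that one given coin comes up and `c - 1` others do not. -/
lemma one_div_exp_le (hM : 1 ≤ M) {c : ℕ} (hc : c ≤ M) :
    0.36 ≤ (1 - 1 / (M : ℝ)) ^ (c - 1) := by
  have h1 : (1 : ℝ) ≤ M := by exact_mod_cast hM
  have h0 : 0 ≤ 1 - 1 / (M : ℝ) := by
    rw [sub_nonneg, div_le_one (by linarith)]
    exact h1
  have h0' : 1 - 1 / (M : ℝ) ≤ 1 := by
    have : 0 < 1 / (M : ℝ) := by positivity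
    linarith
  refine le_trans ?_ (pow_le_pow_of_le_one h0 h0' (Nat.sub_le_sub_right hc 1))
  obtain ⟨k, rfl⟩ : ∃ k, M = k + 1 := ⟨M - 1, by omega⟩
  rcases Nat.eq_zero_or_pos k with rfl | hk
  · norm_num
  have hk' : (0 : ℝ) < k := by exact_mod_cast hk
  have h2 : 1 - 1 / ((k + 1 : ℕ) : ℝ) = (1 / (k : ℝ) + 1)⁻¹ := by
    push_cast
    field_simp
    ring
  rw [h2, inv_pow, Nat.add_sub_cancel]
  have h3 : (1 / (k : ℝ) + 1) ^ k ≤ Real.exp 1 := by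
    calc (1 / (k : ℝ) + 1) ^ k ≤ Real.exp (1 / k) ^ k :=
          pow_le_pow_left₀ (by positivity) (Real.add_one_le_exp _) k
      _ = Real.exp 1 := by
          rw [← Real.exp_nat_mul]
          congr 1
          field_simp
  rw [le_inv_comm₀ (by norm_num) (by positivity)]
  refine h3.trans (Real.exp_one_lt_d9.le.trans (by norm_num))

lemma cleanup_prob_ge (hM : 1 ≤ M) (hJ : 600 ≤ J) {c : ℕ} (hc : c ≤ M) :
    1 / (3 * (M : ℝ)) ≤ 1 / M * (1 - 1 / (M : ℝ)) ^ (c - 1) * (1 - failProb M J) := by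
  have h1 : (1 : ℝ) ≤ M := by exact_mod_cast hM
  have h2 := one_div_exp_le hM hc
  have h3 := failProb_le hM hJ
  have h4 : (1 / 3 : ℝ) ≤ (1 - 1 / (M : ℝ)) ^ (c - 1) * (1 - failProb M J) := by nlinarith
  calc 1 / (3 * (M : ℝ)) = 1 / M * (1 / 3) := by field_simp
    _ ≤ 1 / M * ((1 - 1 / (M : ℝ)) ^ (c - 1) * (1 - failProb M J)) := by gcongr
    _ = _ := by ring

/-- Decay of the Lyapunov function over a block of `m` frames. -/
noncomputable def decay (M : ℕ) (J : ℝ) : ℝ := (1 - drift M J / 2) ^ M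

/-- The bound on the root mean square of what a block of `m` frames adds to the Lyapunov
function. -/
noncomputable def addend (M : ℕ) (J : ℝ) : ℝ := drift M J * M / 40

/-- The bound on the mean square of the factor by which a block of `m` frames changes the Lyapunov
function. -/
noncomputable def contraction (M : ℕ) (J : ℝ) : ℝ := 1 - drift M J * M / 4

lemma decay_nonneg (hM : 1 ≤ M) (hJ : 600 ≤ J) : 0 ≤ decay M J := by
  have h1 : (1 : ℝ) ≤ M := by exact_mod_cast hM
  have := drift_mul_le hM hJ
  have := drift_pos hM hJ
  refine pow_nonneg ?_ _
  nlinarith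

lemma decay_le_one (hM : 1 ≤ M) (hJ : 600 ≤ J) : decay M J ≤ 1 := by
  have h1 : (1 : ℝ) ≤ M := by exact_mod_cast hM
  have := drift_mul_le hM hJ
  have := drift_pos hM hJ
  refine pow_le_one₀ ?_ ?_ <;> nlinarith

lemma decay_sq_add_le (hM : 1 ≤ M) (hJ : 600 ≤ J) {κ : ℝ} (hκ : κ ≤ (drift M J * M / 80) ^ 2) :
    decay M J ^ 2 + κ ≤ contraction M J := by
  have h1 : (1 : ℝ) ≤ M := by exact_mod_cast hM
  have h2 := drift_mul_le hM hJ
  have h3 := drift_pos hM hJ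
  have h4 := decay_nonneg hM hJ
  have h5 := decay_le_one hM hJ
  rw [contraction]
  set s := drift M J * M with hs
  have hs0 : 0 < s := by positivity
  have h6 : decay M J ≤ 1 - s / 3 := by
    have h7 : decay M J ≤ Real.exp (-(s / 2)) := by
      calc decay M J ≤ Real.exp (-(drift M J / 2)) ^ M := by
            refine pow_le_pow_left₀ (by nlinarith) ?_ M
            linarith [Real.add_one_le_exp (-(drift M J / 2))]
        _ = Real.exp (-(s / 2)) := by
            rw [← Real.exp_nat_mul]
            congr 1
            rw [hs]
            ring
    have h8 : Real.exp (-(s / 2)) ≤ (1 + s / 2)⁻¹ := by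
      rw [Real.exp_neg]
      exact inv_anti₀ (by positivity) (by linarith [Real.add_one_le_exp (s / 2)])
    refine (h7.trans h8).trans ?_
    rw [inv_le_iff_one_le_mul₀ (by positivity)]
    nlinarith
  nlinarith

lemma addend_sq_ge (hM : 1 ≤ M) (hJ : 600 ≤ J) {κ : ℝ} (hκ : κ ≤ (drift M J * M / 80) ^ 2) :
    (M * (3 * failProb M J)) ^ 2 + κ ≤ addend M J ^ 2 := by
  have h1 : (1 : ℝ) ≤ M := by exact_mod_cast hM
  have h2 := failProb_mul_le hM hJ
  have h3 := drift_pos hM hJ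
  have h4 := failProb_pos hM hJ
  have h5 : M * (3 * failProb M J) ≤ drift M J * M / 80 := by nlinarith
  have h6 : (M * (3 * failProb M J)) ^ 2 ≤ (drift M J * M / 80) ^ 2 :=
    pow_le_pow_left₀ (by positivity) h5 2
  rw [addend]
  nlinarith [sq_nonneg (drift M J * M)]

/-- The overload probability is negligible compared with the drift: `x` is `ε² λ T`. -/
lemma overload_small (hM : 1 ≤ M) {ε x : ℝ} (hε : 0 < ε) (hε' : ε ≤ 1 / 2)
    (hx : 50 / ε + 24 * Real.log M ≤ x) (hJ : J = (1 + ε) * x / ε ^ 2) (hJ' : 600 ≤ J) :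
    (M : ℝ) ^ 2 * (Real.exp 6 * Real.exp (-(2 / 5 * x))) ≤ (drift M J * M / 80) ^ 2 := by
  have h1 : (1 : ℝ) ≤ M := by exact_mod_cast hM
  have hL : 0 ≤ Real.log M := Real.log_nonneg h1
  have hu : 2 ≤ 1 / ε := by
    rw [le_div_iff₀ hε]
    linarith
  have hx' : 100 ≤ x := by
    have : 50 / ε = 50 * (1 / ε) := by ring
    linarith
  have key : 240 * M ^ 3 * J * Real.exp (3 - x / 5) ≤ 1 := by
    have hM3 : (M : ℝ) ^ 3 ≤ Real.exp (x / 8 - 25 / 4 * (1 / ε)) := by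
      have : (M : ℝ) ^ 3 = Real.exp (3 * Real.log M) := by
        rw [mul_comm, Real.exp_mul, Real.exp_log (by linarith)]
        norm_cast
      rw [this]
      refine Real.exp_le_exp.2 ?_
      have : 50 / ε = 50 * (1 / ε) := by ring
      linarith
    have hu2 : (1 / ε) ^ 2 ≤ 2 * Real.exp (1 / ε) := by
      have := Real.quadratic_le_exp_of_nonneg (by linarith : 0 ≤ 1 / ε)
      nlinarith
    have hx2 : x ≤ 20 * Real.exp (x / 20) := by
      have := Real.add_one_le_exp (x / 20)
      linarith
    have hJ2 : J ≤ 3 / 2 * ((20 * Real.exp (x / 20)) * (2 * Real.exp (1 / ε))) := by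
      have : J = (1 + ε) * (x * (1 / ε) ^ 2) := by
        rw [hJ]
        field_simp
      rw [this]
      have hεε : 1 + ε ≤ 3 / 2 := by linarith
      gcongr
    have he : (14400 : ℝ) ≤ Real.exp 10 := by
      have h := Real.exp_one_gt_d9
      have : Real.exp 10 = Real.exp 1 ^ 10 := by
        rw [← Real.exp_nat_mul]
        norm_num
      rw [this]
      calc (14400 : ℝ) ≤ 2.7182818283 ^ 10 := by norm_num
        _ ≤ _ := pow_le_pow_left₀ (by norm_num) h.le 10
    calc 240 * M ^ 3 * J * Real.exp (3 - x / 5)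
        ≤ 240 * Real.exp (x / 8 - 25 / 4 * (1 / ε)) *
          (3 / 2 * ((20 * Real.exp (x / 20)) * (2 * Real.exp (1 / ε)))) * Real.exp (3 - x / 5) := by
            gcongr
      _ = 14400 * Real.exp ((x / 8 - 25 / 4 * (1 / ε)) + x / 20 + 1 / ε + (3 - x / 5)) := by
            rw [Real.exp_add, Real.exp_add, Real.exp_add]
            ring
      _ ≤ 14400 * Real.exp (-10) := by
            gcongr
            linarith
      _ ≤ 1 := by
            rw [Real.exp_neg, ← div_eq_mul_inv, div_le_one (by positivity)]
            exact he
  have h2 : M * Real.exp (3 - x / 5) ≤ drift M J * M / 80 := by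
    have hM0 : (0 : ℝ) < M := by linarith
    rw [drift, div_mul_eq_mul_div, one_mul, div_div, le_div_iff₀ (by positivity)]
    calc (M : ℝ) * Real.exp (3 - x / 5) * (3 * (M : ℝ) ^ 3 * J * 80)
        = M * (240 * M ^ 3 * J * Real.exp (3 - x / 5)) := by ring
      _ ≤ (M : ℝ) * 1 := by gcongr
      _ = (M : ℝ) := mul_one _
  calc (M : ℝ) ^ 2 * (Real.exp 6 * Real.exp (-(2 / 5 * x)))
      = (M * Real.exp (3 - x / 5)) ^ 2 := by
        rw [mul_pow, ← Real.exp_add, ← Real.exp_nat_mul]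
        congr 2
        push_cast
        ring
    _ ≤ _ := pow_le_pow_left₀ (by positivity) h2 2

/-- The exponent in the Chernoff bound. -/
lemma chernoff_exponent {ε y : ℝ} (hε : 0 < ε) (hε' : ε ≤ 1 / 2) (hy : 0 ≤ y) :
    ε * y - (1 + ε) * y * Real.log (1 + ε) ≤ -(2 / 5 * (ε ^ 2 * y)) := by
  have h := Real.le_log_one_add_of_nonneg hε.le
  have h1 : ε + 2 / 5 * ε ^ 2 ≤ (1 + ε) * (2 * ε / (ε + 2)) := by
    rw [← mul_div_assoc, le_div_iff₀ (by linarith)]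
    nlinarith [mul_nonneg (mul_nonneg hε.le hε.le) (sub_nonneg.2 hε')]
  have h2 : (1 + ε) * (2 * ε / (ε + 2)) ≤ (1 + ε) * Real.log (1 + ε) := by gcongr
  nlinarith

end Numerics

/-! ### Frame parameters -/

section Params

variable {V E : Type*} [Fintype E] [DecidableEq E] [Nonempty E] {N : Network V E}
  {A : StaticAlgorithm E} {f : ℕ → ℝ} {g : ℕ → ℝ → ℝ}

/-- On a single link at most one request is served per slot, so `n` requests for that link need
at least `n` slots. -/
lemma nat_le_schedule (hA : A.HasScheduleLength N f g) (n : ℕ) (hn : 1 ≤ n) :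
    (n : ℝ) ≤ f N.m * n + g N.m n := by
  obtain ⟨e⟩ := ‹Nonempty E›
  set B := ⌊f N.m * n + g N.m n⌋₊ with hB
  have hn' : (1 : ℝ) ≤ n := by exact_mod_cast hn
  have h := hA n n (List.replicate n e) (by simp) (N.interference_replicate_le n e)
  have h4 : (1 : ℝ) ≤ (n : ℝ) ^ 4 := one_le_pow₀ hn'
  have hpos : 0 < 1 - 1 / (2 * (n : ℝ) ^ 4) := by
    rw [sub_pos, div_lt_one (by linarith)]
    linarith
  have hne : {z | ∀ i < (List.replicate n e).length, ∃ a < B,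
      A.run n n (List.replicate n e) z i = some a}.Nonempty := by
    by_contra hcon
    rw [Set.not_nonempty_iff_eq_empty] at hcon
    rw [← hB, hcon, measureReal_empty] at h
    linarith
  obtain ⟨z, hz⟩ := hne
  simp only [Set.mem_ofPred_eq, List.length_replicate] at hz
  choose a ha hrun using hz
  have hcard : n ≤ B := by
    have hinj : Function.Injective (fun i : Fin n => (⟨a i i.2, ha i i.2⟩ : Fin B)) := by
      intro i j hij
      have hij' : a i i.2 = a j j.2 := by simpa using hij
      have key : ∀ i j : Fin n, i < j → a i i.2 ≠ a j j.2 := by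
        intro i j hlt heq
        refine A.capacity n n (List.replicate n e) z i j (a i i.2) hlt (by simp)
          (by simp) (hrun i i.2) ?_
        rw [heq]
        exact hrun j j.2
      rcases lt_trichotomy i j with hlt | heq | hgt
      · exact absurd hij' (key i j hlt)
      · exact heq
      · exact absurd hij'.symm (key j i hgt)
    simpa using Fintype.card_le_of_injective _ hinj
  by_contra hcon
  push Not at hcon
  have hB' : B < n := by
    rcases lt_or_ge (f N.m * n + g N.m n) 0 with hneg | hnn
    · rw [hB, Nat.floor_of_nonpos hneg.le]
      omega
    · rw [hB, Nat.floor_lt hnn]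
      exact hcon
  omega

lemma one_le_f (hg : g N.m =o[atTop] (fun n : ℝ => n)) (hA : A.HasScheduleLength N f g) :
    1 ≤ f N.m := by
  refine le_of_forall_pos_le_add fun c hc => ?_
  have h1 : ∀ᶠ n : ℕ in atTop, ‖g N.m n‖ ≤ c * ‖(n : ℝ)‖ :=
    tendsto_natCast_atTop_atTop.eventually (hg.bound hc)
  obtain ⟨n, hn, hn1⟩ := (h1.and (eventually_ge_atTop 1)).exists
  have h2 := nat_le_schedule hA n hn1
  have hn' : (1 : ℝ) ≤ n := by exact_mod_cast hn1
  rw [Real.norm_of_nonneg (by linarith : (0 : ℝ) ≤ n)] at hn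
  have h3 := (abs_le.1 hn).2
  have h4 : 1 * (n : ℝ) ≤ (f N.m + c) * n := by linarith
  exact le_of_mul_le_mul_right h4 (by linarith)

lemma eventually_admissible (hg : g N.m =o[atTop] (fun n : ℝ => n)) (hf : 1 ≤ f N.m) {ε : ℝ}
    (hε : 0 < ε) : ∀ᶠ T : ℕ in atTop, (FrameParams.mk f g ε T).Admissible N.m := by
  have hm : (1 : ℝ) ≤ N.m := by exact_mod_cast N.one_le_m
  have hfirst : ∀ᶠ T : ℕ in atTop,
      100 * f N.m / ε ^ 3 + 48 * f N.m * Real.log N.m / ε ^ 2 ≤ (T : ℝ) :=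
    tendsto_natCast_atTop_atTop.eventually_ge_atTop _
  have hlim : Tendsto (fun T : ℕ => (N.m : ℝ) / f N.m * T) atTop atTop :=
    tendsto_natCast_atTop_atTop.const_mul_atTop (by positivity)
  have hc : 0 < ε ^ 2 / (4 * N.m) := by positivity
  filter_upwards [hfirst, hlim.eventually (hg.bound hc)] with T hT1 hT
  refine ⟨hT1, ?_⟩
  rw [Real.norm_of_nonneg (by positivity : 0 ≤ (N.m : ℝ) / f N.m * T)] at hT
  have h2 := (abs_le.1 hT).2
  calc 4 * f N.m / ε ^ 2 * g N.m ((N.m : ℝ) / f N.m * (T : ℝ))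
      ≤ 4 * f N.m / ε ^ 2 * (ε ^ 2 / (4 * N.m) * (N.m / f N.m * T)) := by gcongr
    _ = (T : ℝ) := by
        have : f N.m ≠ 0 := by linarith
        field_simp

variable {p : FrameParams}

lemma J_eq : p.J N.m = (1 - p.ε ^ 2) * (p.T / p.f N.m) := by
  rw [FrameParams.J, FrameParams.rate]
  ring

lemma div_f_ge (hf : 1 ≤ p.f N.m) (hp : p.Admissible N.m) :
    100 / p.ε ^ 3 + 48 * Real.log N.m / p.ε ^ 2 ≤ p.T / p.f N.m := by
  rw [le_div_iff₀ (by linarith)]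
  refine le_trans (le_of_eq ?_) hp.1
  ring

lemma T_div_f_ge (hf : 1 ≤ p.f N.m) (hε : 0 < p.ε) (hp : p.Admissible N.m) :
    100 / p.ε ^ 3 ≤ p.T / p.f N.m := by
  have hm : (1 : ℝ) ≤ N.m := by exact_mod_cast N.one_le_m
  have h := div_f_ge hf hp
  have : 0 ≤ 48 * Real.log N.m / p.ε ^ 2 := by
    have := Real.log_nonneg hm
    positivity
  linarith

lemma J_ge (hf : 1 ≤ p.f N.m) (hε : 0 < p.ε) (hε' : p.ε ≤ 1 / 2) (hp : p.Admissible N.m) :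
    600 ≤ p.J N.m := by
  have h := T_div_f_ge hf hε hp
  have h1 : (800 : ℝ) ≤ 100 / p.ε ^ 3 := by
    rw [le_div_iff₀ (by positivity)]
    have : p.ε ^ 3 ≤ (1 / 2) ^ 3 := pow_le_pow_left₀ hε.le hε' 3
    linarith
  have h2 : p.ε ^ 2 ≤ (1 / 2) ^ 2 := pow_le_pow_left₀ hε.le hε' 2
  rw [J_eq]
  nlinarith

lemma T_pos (hf : 1 ≤ p.f N.m) (hε : 0 < p.ε) (hp : p.Admissible N.m) : 0 < p.T := by
  have h := T_div_f_ge hf hε hp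
  have h1 : 0 < 100 / p.ε ^ 3 := by positivity
  by_contra hcon
  have : p.T = 0 := by omega
  rw [this] at h
  simp at h
  linarith

/-- Both phases fit into a frame. -/
lemma phases_fit (hg : MonotoneOn (p.g N.m) (Set.Ici 1)) (hf : 1 ≤ p.f N.m) (hε : 0 < p.ε)
    (hε' : p.ε ≤ 1 / 2) (hp : p.Admissible N.m) :
    p.normalLength N.m + p.cleanupLength N.m ≤ p.T := by
  have hm : (1 : ℝ) ≤ N.m := by exact_mod_cast N.one_le_m
  have hJ := J_ge hf hε hε' hp
  have hf0 : 0 < p.f N.m := by linarith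
  set Q := (p.T : ℝ) / p.f N.m with hQ
  have hQT : p.f N.m * Q = p.T := by
    rw [hQ]
    field_simp
  have hJQ : p.J N.m = (1 - p.ε ^ 2) * Q := J_eq
  have hQ0 : 0 ≤ Q := by positivity
  have hmono : p.g N.m (N.m * p.J N.m) ≤ p.g N.m (N.m / p.f N.m * p.T) := by
    have h1 : N.m * p.J N.m ≤ N.m / p.f N.m * p.T := by
      have : (N.m : ℝ) / p.f N.m * p.T = N.m * Q := by
        rw [hQ]
        ring
      rw [this, hJQ]
      gcongr
      nlinarith [sq_nonneg p.ε]
    have h2 : (1 : ℝ) ≤ N.m * p.J N.m := by nlinarith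
    exact hg h2 (h2.trans h1) h1
  have h3 : 4 * p.f N.m * p.g N.m (N.m / p.f N.m * p.T) ≤ p.ε ^ 2 * p.T := by
    have := hp.2
    rw [div_mul_eq_mul_div, div_le_iff₀ (by positivity)] at this
    linarith
  have h4 : 4 * p.g N.m (N.m / p.f N.m * p.T) ≤ p.ε ^ 2 * Q := by
    have : p.f N.m * (4 * p.g N.m (N.m / p.f N.m * p.T)) ≤ p.f N.m * (p.ε ^ 2 * Q) := by
      calc _ = 4 * p.f N.m * p.g N.m (N.m / p.f N.m * p.T) := by ring
        _ ≤ p.ε ^ 2 * p.T := h3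
        _ = _ := by
          rw [← hQT]
          ring
    exact le_of_mul_le_mul_left this hf0
  have h5 : 100 / p.ε ≤ p.ε ^ 2 * Q := by
    have h := T_div_f_ge hf hε hp
    calc 100 / p.ε = p.ε ^ 2 * (100 / p.ε ^ 3) := by field_simp
      _ ≤ _ := by gcongr
  have h6 : 100 ≤ 100 / p.ε := by
    rw [le_div_iff₀ hε]
    linarith
  rw [FrameParams.normalLength, FrameParams.cleanupLength, hJQ] at *
  have h7 : p.ε ^ 2 * Q ≤ p.f N.m * (p.ε ^ 2 * Q) := by nlinarith
  nlinarith

end Params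

/-! ### Functions with measurable fibers -/

section FiberMeas

variable {Ω α β γ : Type*} {m m' : MeasurableSpace Ω}

/-- All fibers of `f` are measurable; for countably many values this is measurability with respect
to the discrete σ-algebra. -/
def FiberMeas (m : MeasurableSpace Ω) (f : Ω → α) : Prop :=
  ∀ a, MeasurableSet[m] {ω | f ω = a}

namespace FiberMeas

lemma mono {f : Ω → α} (hf : FiberMeas m f) (h : m ≤ m') : FiberMeas m' f := fun a => h _ (hf a)

lemma const (a : α) : FiberMeas m (fun _ : Ω => a) := fun b => by
  by_cases h : a = b <;> simp [h]

lemma measurableSet [Countable α] {f : Ω → α} (hf : FiberMeas m f) (P : α → Prop) :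
    MeasurableSet[m] {ω | P (f ω)} := by
  have : {ω | P (f ω)} = ⋃ a ∈ {a | P a}, {ω | f ω = a} := by
    ext ω
    simp
  rw [this]
  exact MeasurableSet.biUnion (Set.to_countable _) fun a _ => hf a

lemma comp [Countable α] {f : Ω → α} (hf : FiberMeas m f) (F : α → β) :
    FiberMeas m (fun ω => F (f ω)) := fun b => hf.measurableSet fun a => F a = b

/-- Substituting a function with countably many values for a parameter. -/
lemma subst [Countable α] {S : Ω → α} (hS : FiberMeas m S) {F : α → Ω → β}
    (hF : ∀ a, FiberMeas m (F a)) : FiberMeas m (fun ω => F (S ω) ω) := fun b => by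
  have : {ω | F (S ω) ω = b} = ⋃ a, {ω | S ω = a} ∩ {ω | F a ω = b} := by
    ext ω
    simp
  rw [this]
  exact MeasurableSet.iUnion fun a => (hS a).inter (hF a b)

lemma map₂ [Countable α] [Countable β] {f : Ω → α} {g : Ω → β} (hf : FiberMeas m f)
    (hg : FiberMeas m g) (F : α → β → γ) : FiberMeas m (fun ω => F (f ω) (g ω)) :=
  hf.subst fun a => hg.comp (F a)

lemma filterMap [Countable β] (l : List α) {F : Ω → α → Option β}
    (hF : ∀ x, FiberMeas m (fun ω => F ω x)) : FiberMeas m (fun ω => l.filterMap (F ω)) := by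
  induction l with
  | nil => exact const []
  | cons a l ih =>
    have : (fun ω => (a :: l).filterMap (F ω)) =
        fun ω => (fun (o : Option β) l' => o.elim l' fun b => b :: l') (F ω a)
          (l.filterMap (F ω)) := by
      funext ω
      rw [List.filterMap_cons]
      cases F ω a <;> rfl
    rw [this]
    exact (hF a).map₂ ih fun (o : Option β) l' => o.elim l' fun b => b :: l'

lemma pi {ι : Type*} [Countable ι] {f : ι → Ω → α} (hf : ∀ i, FiberMeas m (f i)) :
    FiberMeas m (fun ω i => f i ω) := fun a => by
  have : {ω | (fun i => f i ω) = a} = ⋂ i, {ω | f i ω = a i} := by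
    ext ω
    simp [funext_iff]
  rw [this]
  exact MeasurableSet.iInter fun i => hf i (a i)

lemma measurable [Countable α] [MeasurableSpace β] {f : Ω → α} (hf : FiberMeas m f) (F : α → β) :
    Measurable[m] (fun ω => F (f ω)) := fun s _ => hf.measurableSet fun a => F a ∈ s

end FiberMeas

/-- A state that is independent of the randomness in `F` may be treated as a constant when `F` is
integrated. -/
lemma lintegral_freeze_le {m₁ m₂ mΩ : MeasurableSpace Ω} {μ : Measure Ω} (h₁ : m₁ ≤ mΩ)
    (h₂ : m₂ ≤ mΩ) (hI : Indep m₁ m₂ μ) [Countable α] {S : Ω → α} (hS : FiberMeas m₁ S)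
    {w : Ω → ℝ≥0∞} (hw : Measurable[m₁] w) {F : α → Ω → ℝ≥0∞} (hF : ∀ a, Measurable[m₂] (F a))
    {B : α → ℝ≥0∞} (hB : ∀ a, ∫⁻ ω, F a ω ∂μ ≤ B a) :
    ∫⁻ ω, w ω * F (S ω) ω ∂μ ≤ ∫⁻ ω, w ω * B (S ω) ∂μ := by
  have hset : ∀ a, MeasurableSet[m₁] {ω | S ω = a} := hS
  have hwa : ∀ a, Measurable[m₁] ({ω | S ω = a}.indicator w) := fun a => hw.indicator (hset a)
  have split : ∀ H : α → Ω → ℝ≥0∞, (fun ω => w ω * H (S ω) ω) =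
      fun ω => ∑' a, {ω | S ω = a}.indicator w ω * H a ω := by
    intro H
    funext ω
    rw [tsum_eq_single (S ω)]
    · simp
    · intro a ha
      rw [Set.indicator_of_notMem, zero_mul]
      simpa using ha.symm
  rw [split F, split fun a _ => B a, lintegral_tsum, lintegral_tsum]
  · refine ENNReal.tsum_le_tsum fun a => ?_
    rw [lintegral_mul_eq_lintegral_mul_lintegral_of_independent_measurableSpace h₁ h₂ hI (hwa a)
      (hF a), lintegral_mul_const _ ((hwa a).mono h₁ le_rfl)]
    gcongr
    exact hB a
  · exact fun a => (((hwa a).mono h₁ le_rfl).mul_const _).aemeasurable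
  · exact fun a => (((hwa a).mono h₁ le_rfl).mul ((hF a).mono h₂ le_rfl)).aemeasurable

end FiberMeas

/-! ### Measurability of the protocol -/

section Countable

instance Route.instCountable {E : Type*} [Countable E] : Countable (Route E) :=
  Function.Injective.countable (f := fun r : Route E => (r.next, r.rest)) fun r₁ r₂ h => by
    rcases r₁ with ⟨a, b⟩
    rcases r₂ with ⟨a', b'⟩
    simpa using h

instance NetState.instCountable {E : Type*} [Countable E] : Countable (NetState E) :=
  Function.Injective.countable (f := fun r : NetState E => (r.unfailed, r.failed)) fun r₁ r₂ h => by
    rcases r₁ with ⟨a, b⟩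
    rcases r₂ with ⟨a', b'⟩
    simpa using h

instance Network.Path.instCountable {V E : Type*} [Fintype E] (N : Network V E) :
    Countable N.Path :=
  inferInstanceAs (Countable (Subtype _))

end Countable

section ProtocolFibers

variable {E Ω : Type*} [DecidableEq E] [Countable E] {m : MeasurableSpace Ω}
  {σ : Ω → ℕ → Option ℕ}

lemma fiberMeas_servedBy (hσ : ∀ i, FiberMeas m (fun ω => σ ω i)) (i x : ℕ) :
    FiberMeas m (fun ω => Protocol.servedBy (σ ω) i x) :=
  (hσ i).comp fun o => match o with
    | none => false
    | some a => decide (a < x)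

lemma fiberMeas_unfailedAfter (hσ : ∀ i, FiberMeas m (fun ω => σ ω i)) (L s : ℕ)
    (l : List (Route E)) : FiberMeas m (fun ω => Protocol.unfailedAfter (σ ω) L s l) :=
  FiberMeas.filterMap _ fun x => (fiberMeas_servedBy hσ x.2 (min s L)).comp fun b : Bool =>
    if b then x.1.advance else if s < L then some x.1 else none

lemma fiberMeas_failures (hσ : ∀ i, FiberMeas m (fun ω => σ ω i)) (L : ℕ)
    (l : List (Route E)) : FiberMeas m (fun ω => Protocol.failures (σ ω) L l) :=
  FiberMeas.filterMap _ fun x => (fiberMeas_servedBy hσ x.2 L).comp fun b : Bool =>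
    if b then none else some x.1

lemma fiberMeas_failedAfter (hσ : ∀ i, FiberMeas m (fun ω => σ ω i)) (sel : List E) (x : ℕ)
    (l : List (Route E)) : FiberMeas m (fun ω => Protocol.failedAfter sel (σ ω) x l) :=
  FiberMeas.filterMap _ fun y => (fiberMeas_servedBy hσ (sel.idxOf y.1.next) x).comp
    fun b : Bool => if y.2 = (l.map Route.next).idxOf y.1.next ∧ y.1.next ∈ sel ∧ b then
      y.1.advance else some y.1

end ProtocolFibers

namespace ProtocolInput

variable {V E : Type*} [Fintype E] [DecidableEq E] {N : Network V E} {A : StaticAlgorithm E}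
  {G : Type*} [Fintype G] {Ω : Type*} [mΩ : MeasurableSpace Ω] {μ : Measure Ω}
  (X : ProtocolInput N A G μ)

/-- The σ-algebra generated by a set of sources of randomness. -/
@[reducible] def sigmaOf (S : Set (Source G E)) : MeasurableSpace Ω :=
  ⨆ s ∈ S, Source.sigma X.inj X.coin X.seed s

lemma sigma_le (s : Source G E) : Source.sigma X.inj X.coin X.seed s ≤ mΩ := by
  cases s with
  | inject t g =>
    rintro _ ⟨s, -, rfl⟩
    exact FiberMeas.measurableSet (f := X.inj t g) (X.measurableSet_inj t g) (· ∈ s)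
  | coin k e => exact (X.measurable_coin k e).comap_le
  | seed k p => exact (X.measurable_seed k p).comap_le

lemma sigmaOf_le (S : Set (Source G E)) : X.sigmaOf S ≤ mΩ := iSup₂_le fun s _ => X.sigma_le s

lemma sigma_le_sigmaOf {S : Set (Source G E)} {s : Source G E} (hs : s ∈ S) :
    Source.sigma X.inj X.coin X.seed s ≤ X.sigmaOf S :=
  le_iSup₂_of_le s hs le_rfl

lemma sigmaOf_mono {S S' : Set (Source G E)} (h : S ⊆ S') : X.sigmaOf S ≤ X.sigmaOf S' :=
  biSup_mono h

lemma indep_sigmaOf {S S' : Set (Source G E)} (h : Disjoint S S') :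
    Indep (X.sigmaOf S) (X.sigmaOf S') μ :=
  indep_iSup_of_disjoint X.sigma_le X.indep h

lemma fiberMeas_inj {S : Set (Source G E)} {t : ℕ} {g : G} (h : Source.inject t g ∈ S) :
    FiberMeas (X.sigmaOf S) (X.inj t g) := fun a =>
  X.sigma_le_sigmaOf h _ ⟨{a}, trivial, rfl⟩

lemma fiberMeas_coin {S : Set (Source G E)} {k : ℕ} {e : E} (h : Source.coin k e ∈ S) :
    FiberMeas (X.sigmaOf S) (X.coin k e) := fun a =>
  X.sigma_le_sigmaOf h _ ⟨{a}, trivial, rfl⟩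

lemma measurable_seed_sigmaOf {S : Set (Source G E)} {k : ℕ} {ph : Phase}
    (h : Source.seed k ph ∈ S) : Measurable[X.sigmaOf S] (X.seed k ph) := fun s hs =>
  X.sigma_le_sigmaOf h _ ⟨s, hs, rfl⟩

lemma fiberMeas_run {S : Set (Source G E)} {k : ℕ} {ph : Phase} (h : Source.seed k ph ∈ S)
    (I n : ℝ) (l : List E) (i : ℕ) :
    FiberMeas (X.sigmaOf S) (fun ω => A.run I n l (X.seed k ph ω) i) := fun o =>
  X.measurable_seed_sigmaOf h (A.measurableSet_run I n l i o)

/-- The injections in the slots of `S`. -/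
def injections (S : Set ℕ) : Set (Source G E) := {s | ∃ t ∈ S, ∃ g, s = Source.inject t g}

/-- All injections, and the coins and seeds of the frames before frame `k`. -/
def past (k : ℕ) : Set (Source G E) := fun s =>
  match s with
  | .inject _ _ => True
  | .coin k' _ => k' < k
  | .seed k' _ => k' < k

/-- The coins and the seed of the clean-up phase of frame `k`. -/
def cleanupSources (k : ℕ) : Set (Source G E) := fun s =>
  match s with
  | .inject _ _ => False
  | .coin k' _ => k' = k
  | .seed _ .normal => False
  | .seed k' .cleanup => k' = k

lemma injections_subset_past (S : Set ℕ) (k : ℕ) :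
    (injections S : Set (Source G E)) ⊆ past k := by
  rintro _ ⟨t, -, g, rfl⟩
  exact trivial

lemma past_mono {k k' : ℕ} (h : k ≤ k') : (past k : Set (Source G E)) ⊆ past k' := by
  rintro (_ | ⟨j, _⟩ | ⟨j, _⟩) hs
  · trivial
  · exact lt_of_lt_of_le (show j < k from hs) h
  · exact lt_of_lt_of_le (show j < k from hs) h

lemma cleanupSources_subset (k : ℕ) : (cleanupSources k : Set (Source G E)) ⊆ past (k + 1) := by
  rintro (_ | ⟨j, _⟩ | ⟨j, _ | _⟩) hs
  · trivial
  · exact Nat.lt_succ_of_le (le_of_eq (show j = k from hs))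
  · exact hs.elim
  · exact Nat.lt_succ_of_le (le_of_eq (show j = k from hs))

lemma disjoint_past_cleanupSources (k : ℕ) :
    Disjoint (insert (Source.seed k Phase.normal) (past k : Set (Source G E)))
      (cleanupSources k) := by
  rw [Set.disjoint_left]
  rintro s (rfl | hs) h's
  · exact h's
  · rcases s with _ | ⟨j, _⟩ | ⟨j, _ | _⟩
    · exact h's
    · exact absurd (show j = k from h's) (ne_of_lt (show j < k from hs))
    · exact h's
    · exact absurd (show j = k from h's) (ne_of_lt (show j < k from hs))

lemma disjoint_past_seed (k : ℕ) :
    Disjoint (past k : Set (Source G E)) {Source.seed k Phase.normal} := by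
  rw [Set.disjoint_singleton_right]
  exact lt_irrefl k

variable (p : FrameParams)

/-- The failed packets at the beginning of the clean-up phase of frame `k`, if the frame starts in
state `S`. -/
noncomputable def bufferFrom (k : ℕ) (ω : Ω) (S : NetState E) : List (Route E) :=
  S.failed ++ Protocol.failures (A.run (p.J N.m) (N.m * p.J N.m) (S.unfailed.map Route.next)
    (X.seed k .normal ω)) ⌊p.normalLength N.m⌋₊ S.unfailed

/-- The failed packets after `x` slots of the clean-up phase of frame `k`, if this phase starts
with the failed packets `B`. -/
noncomputable def cleanupFrom (k : ℕ) (ω : Ω) (B : List (Route E)) (x : ℕ) : List (Route E) :=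
  Protocol.failedAfter (Protocol.selected (fun e => X.coin k e ω) B)
    (A.run 1 (N.m * p.J N.m) (Protocol.selected (fun e => X.coin k e ω) B) (X.seed k .cleanup ω))
    x B

/-- The failed packets at the beginning of the clean-up phase of frame `k`. -/
noncomputable def buffer (k : ℕ) (ω : Ω) : List (Route E) :=
  X.bufferFrom p k ω (X.frameStart p k ω)

lemma within_failed (k : ℕ) (ω : Ω) (S : NetState E) (s : ℕ) :
    (X.within p k ω S s).failed = if s < ⌊p.normalLength N.m⌋₊ then S.failed else
      X.cleanupFrom p k ω (X.bufferFrom p k ω S)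
        (min (s - ⌊p.normalLength N.m⌋₊) ⌊p.cleanupLength N.m⌋₊) := rfl

lemma within_unfailed (k : ℕ) (ω : Ω) (S : NetState E) (s : ℕ) :
    (X.within p k ω S s).unfailed =
      Protocol.unfailedAfter (A.run (p.J N.m) (N.m * p.J N.m) (S.unfailed.map Route.next)
        (X.seed k .normal ω)) ⌊p.normalLength N.m⌋₊ s S.unfailed := rfl

lemma fiberMeas_bufferFrom (k : ℕ) (S : NetState E) {𝒮 : Set (Source G E)}
    (h : Source.seed k Phase.normal ∈ 𝒮) :
    FiberMeas (X.sigmaOf 𝒮) (fun ω => X.bufferFrom p k ω S) :=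
  (fiberMeas_failures (fun i => X.fiberMeas_run h _ _ _ i) _ S.unfailed).comp (S.failed ++ ·)

lemma fiberMeas_cleanupFrom (k : ℕ) (B : List (Route E)) (x : ℕ) {𝒮 : Set (Source G E)}
    (h : cleanupSources k ⊆ 𝒮) :
    FiberMeas (X.sigmaOf 𝒮) (fun ω => X.cleanupFrom p k ω B x) := by
  have hsel : FiberMeas (X.sigmaOf 𝒮)
      (fun ω => Protocol.selected (fun e => X.coin k e ω) B) :=
    (FiberMeas.pi fun e => X.fiberMeas_coin (k := k) (e := e) (h rfl)).comp
      fun c => Protocol.selected c B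
  have hseed : Source.seed k Phase.cleanup ∈ 𝒮 := h (show k = k from rfl)
  exact hsel.subst (F := fun sel ω => Protocol.failedAfter sel
    (A.run 1 (N.m * p.J N.m) sel (X.seed k .cleanup ω)) x B) fun sel =>
      fiberMeas_failedAfter (fun i => X.fiberMeas_run hseed _ _ _ i) _ _ _

lemma fiberMeas_within (k : ℕ) (S : NetState E) (s : ℕ) :
    FiberMeas (X.sigmaOf (past (k + 1))) (fun ω => X.within p k ω S s) := by
  have hseed : Source.seed k Phase.normal ∈ (past (k + 1) : Set (Source G E)) :=
    Nat.lt_succ_self k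
  have h1 : FiberMeas (X.sigmaOf (past (k + 1))) (fun ω => (X.within p k ω S s).unfailed) :=
    fiberMeas_unfailedAfter (fun i => X.fiberMeas_run hseed _ _ _ i) _ _ _
  have h2 : FiberMeas (X.sigmaOf (past (k + 1))) (fun ω => (X.within p k ω S s).failed) := by
    simp only [within_failed]
    split_ifs
    · exact FiberMeas.const _
    · exact (X.fiberMeas_bufferFrom p k S hseed).subst fun B =>
        X.fiberMeas_cleanupFrom p k B _ (cleanupSources_subset k)
  exact h1.map₂ h2 NetState.mk

lemma fiberMeas_injected {𝒮 : Set (Source G E)} (t₀ s : ℕ)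
    (h : ∀ i < s, ∀ g, Source.inject (t₀ + i) g ∈ 𝒮) :
    FiberMeas (X.sigmaOf 𝒮) (X.injected t₀ s) := by
  induction s with
  | zero => exact FiberMeas.const []
  | succ s ih =>
    have : X.injected t₀ (s + 1) = fun ω => X.injected t₀ s ω ++
        (Finset.univ : Finset G).toList.filterMap fun g =>
          (X.inj (t₀ + s) g ω).map Subtype.val := by
      funext ω
      simp [injected, List.range_succ]
    rw [this]
    refine (ih fun i hi => h i (hi.trans (Nat.lt_succ_self s))).map₂ ?_ (· ++ ·)
    exact FiberMeas.filterMap _ fun g =>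
      (X.fiberMeas_inj (h s (Nat.lt_succ_self s) g)).comp (Option.map Subtype.val)

lemma fiberMeas_frameStart (k : ℕ) : FiberMeas (X.sigmaOf (past k)) (X.frameStart p k) := by
  induction k with
  | zero => exact FiberMeas.const _
  | succ k ih =>
    have h1 : FiberMeas (X.sigmaOf (past (k + 1)))
        (fun ω => X.within p k ω (X.frameStart p k ω) p.T) :=
      (ih.mono (X.sigmaOf_mono (past_mono (Nat.le_succ k)))).subst
        fun S => X.fiberMeas_within p k S p.T
    have h2 : FiberMeas (X.sigmaOf (past (k + 1))) (X.injected (k * p.T) p.T) :=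
      X.fiberMeas_injected _ _ fun _ _ _ => trivial
    exact h1.map₂ h2 fun (S : NetState E) l => NetState.mk (S.unfailed ++ l) S.failed

lemma fiberMeas_stateAt (t : ℕ) : FiberMeas mΩ (X.stateAt p t) := by
  refine FiberMeas.mono ?_ (X.sigmaOf_le (past (t / p.T + 1)))
  exact ((X.fiberMeas_frameStart p _).mono (X.sigmaOf_mono (past_mono (Nat.le_succ _)))).subst
    fun S => X.fiberMeas_within p _ S _

lemma fiberMeas_buffer (k : ℕ) :
    FiberMeas (X.sigmaOf (insert (Source.seed k Phase.normal) (past k))) (X.buffer p k) :=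
  ((X.fiberMeas_frameStart p k).mono (X.sigmaOf_mono (Set.subset_insert _ _))).subst
    fun S => X.fiberMeas_bufferFrom p k S (Set.mem_insert _ _)

lemma fiberMeas_queueLength (t : ℕ) : FiberMeas mΩ (X.queueLength p t) := by
  have h1 : FiberMeas mΩ (X.injected (t / p.T * p.T) (t % p.T)) :=
    (X.fiberMeas_injected (𝒮 := Set.univ) _ _ fun _ _ _ => trivial).mono (X.sigmaOf_le _)
  exact h1.map₂ (X.fiberMeas_stateAt p t)
    fun l S => l.length + S.unfailed.length + S.failed.length

end ProtocolInput

/-! ### The Lyapunov function -/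

section Lyapunov

/-- The exponential Lyapunov function of the potential: `0` at `0`, and `β ^ n` at `n > 0`. -/
noncomputable def lyapunov (β : ℝ) (n : ℕ) : ℝ≥0∞ := if n = 0 then 0 else ENNReal.ofReal (β ^ n)

variable {β : ℝ}

@[simp] lemma lyapunov_zero : lyapunov β 0 = 0 := if_pos rfl

lemma lyapunov_mono (hβ : 1 ≤ β) {n n' : ℕ} (h : n ≤ n') : lyapunov β n ≤ lyapunov β n' := by
  unfold lyapunov
  split_ifs with h1 h2
  · rfl
  · exact zero_le
  · omega
  · exact ENNReal.ofReal_le_ofReal (pow_le_pow_right₀ hβ h)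

lemma lyapunov_le_ofReal (n : ℕ) : lyapunov β n ≤ ENNReal.ofReal (β ^ n) := by
  unfold lyapunov
  split_ifs
  · exact zero_le
  · rfl

lemma lyapunov_add_le (hβ : 1 ≤ β) (n a : ℕ) :
    lyapunov β (n + a) ≤ ENNReal.ofReal (β ^ a) * (lyapunov β n + 1) := by
  rcases Nat.eq_zero_or_pos n with rfl | hn
  · simpa using lyapunov_le_ofReal a
  · have h1 : lyapunov β n = ENNReal.ofReal (β ^ n) := if_neg hn.ne'
    have h2 : lyapunov β (n + a) = ENNReal.ofReal (β ^ a) * lyapunov β n := by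
      rw [h1, ← ENNReal.ofReal_mul (by positivity), ← pow_add, lyapunov, if_neg (by omega),
        add_comm]
    rw [h2]
    gcongr
    exact le_self_add

lemma lyapunov_of_lt (hβ : 1 ≤ β) {n n' : ℕ} (h : n' < n) :
    lyapunov β n' ≤ ENNReal.ofReal β⁻¹ * lyapunov β n := by
  have hβ0 : 0 < β := by linarith
  have h1 : lyapunov β n = ENNReal.ofReal (β ^ n) := if_neg (by omega)
  refine (lyapunov_le_ofReal n').trans ?_
  rw [h1, ← ENNReal.ofReal_mul (by positivity)]
  refine ENNReal.ofReal_le_ofReal ?_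
  obtain ⟨k, rfl⟩ : ∃ k, n = k + 1 := ⟨n - 1, by omega⟩
  have h2 : β⁻¹ * β ^ (k + 1) = β ^ k := by
    rw [pow_succ]
    field_simp
  rw [h2]
  exact pow_le_pow_right₀ hβ (by omega)

end Lyapunov

/-! ### One frame of the protocol -/

namespace ProtocolInput

variable {V E : Type*} [Fintype E] [DecidableEq E] {N : Network V E} {A : StaticAlgorithm E}
  {G : Type*} [Fintype G] {Ω : Type*} [mΩ : MeasurableSpace Ω] {μ : Measure Ω}
  (X : ProtocolInput N A G μ) (p : FrameParams)

lemma frameStart_succ_failed (k : ℕ) (ω : Ω)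
    (hfit : ⌊p.normalLength N.m⌋₊ + ⌊p.cleanupLength N.m⌋₊ ≤ p.T) :
    (X.frameStart p (k + 1) ω).failed =
      X.cleanupFrom p k ω (X.buffer p k ω) ⌊p.cleanupLength N.m⌋₊ := by
  change (X.within p k ω (X.frameStart p k ω) p.T).failed = _
  rw [within_failed, if_neg (by omega), min_eq_right (by omega)]
  rfl

lemma frameStart_succ_unfailed (k : ℕ) (ω : Ω) :
    (X.frameStart p (k + 1) ω).unfailed =
      (X.within p k ω (X.frameStart p k ω) p.T).unfailed ++ X.injected (k * p.T) p.T ω := rfl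

lemma hopSum_cleanupFrom_le (k : ℕ) (ω : Ω) (B : List (Route E)) (x : ℕ) :
    hopSum (X.cleanupFrom p k ω B x) ≤ hopSum B := hopSum_failedAfter_le _ _ _ _

lemma hopSum_within_failed_le (k : ℕ) (ω : Ω) (s : ℕ) :
    hopSum (X.within p k ω (X.frameStart p k ω) s).failed ≤ hopSum (X.buffer p k ω) := by
  rw [within_failed]
  split_ifs
  · rw [buffer, bufferFrom, hopSum_append]
    exact Nat.le_add_right _ _
  · exact X.hopSum_cleanupFrom_le p k ω _ _

variable [Nonempty E] [IsProbabilityMeasure μ]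

lemma measureReal_seed_ge {f : ℕ → ℝ} {g : ℕ → ℝ → ℝ} (hA : A.HasScheduleLength N f g) (k : ℕ)
    (ph : Phase) {I n : ℝ} {l : List E} (hl : (l.length : ℝ) ≤ n) (hI : N.interference l ≤ I) :
    MeasurableSet {z | ∀ i < l.length, ∃ a < ⌊f N.m * I + g N.m n⌋₊, A.run I n l z i = some a} ∧
    1 - 1 / (2 * n ^ 4) ≤ μ.real {ω | ∀ i < l.length, ∃ a < ⌊f N.m * I + g N.m n⌋₊,
      A.run I n l (X.seed k ph ω) i = some a} := by
  have hmeas : MeasurableSet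
      {z | ∀ i < l.length, ∃ a < ⌊f N.m * I + g N.m n⌋₊, A.run I n l z i = some a} := by
    have : {z | ∀ i < l.length, ∃ a < ⌊f N.m * I + g N.m n⌋₊, A.run I n l z i = some a} =
        ⋂ i, ⋂ (_ : i < l.length), ⋃ a, ⋃ (_ : a < ⌊f N.m * I + g N.m n⌋₊),
          {z | A.run I n l z i = some a} := by
      ext z
      simp
    rw [this]
    exact MeasurableSet.iInter fun i => MeasurableSet.iInter fun _ => MeasurableSet.iUnion
      fun a => MeasurableSet.iUnion fun _ => A.measurableSet_run _ _ _ _ _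
  refine ⟨hmeas, ?_⟩
  have h := hA I n l hl hI
  rw [← X.seed_law k ph, measureReal_def, Measure.map_apply (X.measurable_seed k ph) hmeas] at h
  exact h

/-- The event that the coin of `e` is the only one that comes up in frame `k`, and that the run of
the static algorithm for a single request on `e` is successful. -/
def cleanupEvent (k : ℕ) (e : E) : Set Ω :=
  {ω | (∀ e', X.coin k e' ω = decide (e' = e)) ∧ ∃ a < ⌊p.cleanupLength N.m⌋₊,
    A.run 1 (N.m * p.J N.m) [e] (X.seed k .cleanup ω) 0 = some a}

lemma measurableSet_cleanupEvent (k : ℕ) (e : E) :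
    MeasurableSet[X.sigmaOf (cleanupSources k)] (X.cleanupEvent p k e) := by
  have h1 : MeasurableSet[X.sigmaOf (cleanupSources k)]
      {ω | ∀ e', X.coin k e' ω = decide (e' = e)} := by
    have := (FiberMeas.pi fun e' => X.fiberMeas_coin (S := cleanupSources k) (k := k) (e := e')
      rfl) (fun e' => decide (e' = e))
    simpa only [funext_iff] using this
  have h2 := (X.fiberMeas_run (S := cleanupSources k) (k := k) (ph := .cleanup) rfl
    1 (N.m * p.J N.m) [e] 0).measurableSet fun o => ∃ a < ⌊p.cleanupLength N.m⌋₊, o = some a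
  exact MeasurableSet.inter h1 h2

lemma cleanupEvent_ge (hA : A.HasScheduleLength N p.f p.g) (hJ : 600 ≤ p.J N.m) (k : ℕ) (e : E) :
    1 / (3 * (N.m : ℝ)) ≤ μ.real (X.cleanupEvent p k e) := by
  have hm : (1 : ℝ) ≤ N.m := by exact_mod_cast N.one_le_m
  let src : Option E → Source G E := fun o => o.elim (.seed k .cleanup) (.coin k)
  have hsrc : Function.Injective src := by
    rintro (_ | a) (_ | b) h
    · rfl
    · simp [src] at h
    · simp [src] at h
    · simpa [src] using h
  let ev : Option E → Set Ω := fun o => o.elim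
    {ω | ∀ i < [e].length, ∃ a < ⌊p.f N.m * 1 + p.g N.m (N.m * p.J N.m)⌋₊,
      A.run 1 (N.m * p.J N.m) [e] (X.seed k .cleanup ω) i = some a}
    (fun e' => {ω | X.coin k e' ω = decide (e' = e)})
  have hseed := X.measureReal_seed_ge hA k .cleanup (I := 1) (n := N.m * p.J N.m) (l := [e])
    (by simp; nlinarith) (by simpa using N.interference_replicate_le 1 e)
  have hev : X.cleanupEvent p k e = ⋂ o, ev o := by
    ext ω
    simp only [Set.mem_iInter, Option.forall, ev, Option.elim, cleanupEvent,
      FrameParams.cleanupLength]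
    simp only [Set.mem_ofPred_eq, List.length_singleton, Nat.lt_one_iff, forall_eq]
    exact and_comm
  have hmeas : ∀ o, MeasurableSet[(Source.sigma X.inj X.coin X.seed ∘ src) o] (ev o) := by
    rintro (_ | e')
    · exact ⟨_, hseed.1, rfl⟩
    · exact ⟨{decide (e' = e)}, trivial, rfl⟩
  have hprod : μ.real (X.cleanupEvent p k e) = ∏ o, μ.real (ev o) := by
    rw [hev, measureReal_def, (X.indep.precomp hsrc).meas_iInter hmeas, ENNReal.toReal_prod]
    rfl
  have htrue : μ.real (ev (some e)) = 1 / N.m := by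
    rw [← X.coin_law k e]
    simp [ev]
  have hfalse : ∀ e' ≠ e, μ.real (ev (some e')) = 1 - 1 / N.m := by
    intro e' he'
    have h1 : ev (some e') = {ω | X.coin k e' ω = true}ᶜ := by
      ext ω
      simp [ev, he']
    rw [h1, probReal_compl_eq_one_sub, X.coin_law]
    exact X.measurable_coin k e' (measurableSet_singleton true)
  have hcoins : ∏ e', μ.real (ev (some e')) =
      1 / N.m * (1 - 1 / (N.m : ℝ)) ^ (Fintype.card E - 1) := by
    rw [← Finset.mul_prod_erase _ _ (Finset.mem_univ e), htrue,
      Finset.prod_congr rfl fun e' he' => hfalse e' (Finset.ne_of_mem_erase he'),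
      Finset.prod_const, Finset.card_erase_of_mem (Finset.mem_univ e), Finset.card_univ]
  refine (cleanup_prob_ge N.one_le_m hJ N.card_le_m).trans ?_
  rw [hprod, Fintype.prod_option, hcoins, mul_comm (μ.real (ev none))]
  refine mul_le_mul_of_nonneg_left hseed.2 ?_
  have : 1 / (N.m : ℝ) ≤ 1 := by
    rw [div_le_one (by linarith)]
    exact hm
  have h0 : 0 ≤ 1 - 1 / (N.m : ℝ) := by linarith
  positivity

/-- On average, a clean-up phase decreases the Lyapunov function by the factor `1 - drift`. -/
lemma lintegral_cleanup_le (hA : A.HasScheduleLength N p.f p.g) (hJ : 600 ≤ p.J N.m) (k : ℕ)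
    (B : List (Route E)) :
    ∫⁻ ω, lyapunov (growth N.m (p.J N.m))
        (hopSum (X.cleanupFrom p k ω B ⌊p.cleanupLength N.m⌋₊)) ∂μ ≤
      ENNReal.ofReal (1 - drift N.m (p.J N.m)) *
        lyapunov (growth N.m (p.J N.m)) (hopSum B) := by
  have hm : (1 : ℝ) ≤ N.m := by exact_mod_cast N.one_le_m
  set β := growth N.m (p.J N.m) with hβdef
  have hβ : 1 ≤ β := one_le_growth N.one_le_m hJ
  set h := lyapunov β (hopSum B) with hh
  rcases B with _ | ⟨r, B'⟩
  · have : ∀ ω, hopSum (X.cleanupFrom p k ω [] ⌊p.cleanupLength N.m⌋₊) = 0 := fun ω =>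
      Nat.le_zero.1 (X.hopSum_cleanupFrom_le p k ω [] _)
    simp [this]
  set B := r :: B'
  have hmem : r.next ∈ B.map Route.next := by simp [B]
  set D := X.cleanupEvent p k r.next with hD
  have hDm : MeasurableSet D := X.sigmaOf_le _ _ (X.measurableSet_cleanupEvent p k r.next)
  set P := μ.real D with hP
  have hPge : 1 / (3 * (N.m : ℝ)) ≤ P := X.cleanupEvent_ge p hA hJ k r.next
  have hP1 : P ≤ 1 := measureReal_le_one
  have hq := tailRatio_pos N.one_le_m hJ
  have hq1 := tailRatio_lt_one N.one_le_m hJ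
  have hpt : ∀ ω, lyapunov β (hopSum (X.cleanupFrom p k ω B ⌊p.cleanupLength N.m⌋₊)) ≤
      D.indicator (fun _ => ENNReal.ofReal β⁻¹ * h) ω + Dᶜ.indicator (fun _ => h) ω := by
    intro ω
    by_cases hω : ω ∈ D
    · rw [Set.indicator_of_mem hω, Set.indicator_of_notMem (by simpa using hω), add_zero]
      refine lyapunov_of_lt hβ ?_
      have hsel := selected_eq_singleton (fun e => X.coin k e ω) B r.next hmem hω.1
      rw [cleanupFrom, hsel]
      refine hopSum_failedAfter_lt _ _ _ _ r.next hmem (by simp) ?_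
      rw [servedBy_eq_true]
      simpa using hω.2
    · rw [Set.indicator_of_notMem hω, Set.indicator_of_mem (by simpa using hω), zero_add]
      exact lyapunov_mono hβ (X.hopSum_cleanupFrom_le p k ω B _)
  refine (lintegral_mono hpt).trans ?_
  rw [lintegral_add_left (measurable_const.indicator hDm), lintegral_indicator_const hDm,
    lintegral_indicator_const hDm.compl, ← ofReal_measureReal, ← ofReal_measureReal,
    probReal_compl_eq_one_sub hDm, ← hP]
  have hβq : β⁻¹ = tailRatio N.m (p.J N.m) := by rw [hβdef, growth, inv_inv]
  rw [mul_right_comm, mul_comm h, ← add_mul, hβq, ← ENNReal.ofReal_mul hq.le,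
    ← ENNReal.ofReal_add (mul_nonneg hq.le measureReal_nonneg) (by linarith)]
  refine mul_le_mul_left (ENNReal.ofReal_le_ofReal ?_) h
  have hdr : drift N.m (p.J N.m) = (1 - tailRatio N.m (p.J N.m)) * (1 / (3 * (N.m : ℝ))) := by
    rw [drift, tailRatio]
    field_simp
    ring
  have : (1 - tailRatio N.m (p.J N.m)) * (1 / (3 * (N.m : ℝ))) ≤
      (1 - tailRatio N.m (p.J N.m)) * P := mul_le_mul_of_nonneg_left hPge (by linarith)
  rw [hdr]
  linarith

/-- The requests of the unfailed packets have interference measure at most `J`, and no packet has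
more than `m` hops left. -/
def NotOverloaded (N : Network V E) (J : ℝ) (S : NetState E) : Prop :=
  N.interference (S.unfailed.map Route.next) ≤ J ∧ ∀ r ∈ S.unfailed, r.hops ≤ N.m

/-- In a frame without overload, packets fail only with the small failure probability of the static
algorithm, and then the potential grows by at most `m² J`. -/
lemma lintegral_bufferFrom_le (hA : A.HasScheduleLength N p.f p.g) (hJ : 600 ≤ p.J N.m) (k : ℕ)
    (S : NetState E) (hS : NotOverloaded N (p.J N.m) S) :
    ∫⁻ ω, lyapunov (growth N.m (p.J N.m)) (hopSum (X.bufferFrom p k ω S)) ∂μ ≤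
      lyapunov (growth N.m (p.J N.m)) (hopSum S.failed) +
        ENNReal.ofReal (3 * failProb N.m (p.J N.m)) *
          (lyapunov (growth N.m (p.J N.m)) (hopSum S.failed) + 1) := by
  have hm : (1 : ℝ) ≤ N.m := by exact_mod_cast N.one_le_m
  set β := growth N.m (p.J N.m) with hβdef
  have hβ : 1 ≤ β := one_le_growth N.one_le_m hJ
  have hlen := N.length_le_of_interference (by linarith) hS.1
  have hseed := X.measureReal_seed_ge hA k .normal hlen hS.1
  set D := {ω | ∀ i < (S.unfailed.map Route.next).length,
    ∃ a < ⌊p.f N.m * p.J N.m + p.g N.m (N.m * p.J N.m)⌋₊,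
      A.run (p.J N.m) (N.m * p.J N.m) (S.unfailed.map Route.next) (X.seed k .normal ω) i = some a}
    with hD
  have hDm : MeasurableSet D := X.measurable_seed k .normal hseed.1
  have hDc : μ Dᶜ ≤ ENNReal.ofReal (failProb N.m (p.J N.m)) := by
    rw [← ofReal_measureReal, probReal_compl_eq_one_sub hDm]
    refine ENNReal.ofReal_le_ofReal ?_
    rw [failProb]
    linarith [hseed.2]
  have hhop : (hopSum S.unfailed : ℝ) ≤ (N.m : ℝ) ^ 2 * p.J N.m := by
    have h1 : (hopSum S.unfailed : ℝ) ≤ S.unfailed.length * N.m := by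
      exact_mod_cast hopSum_le_length_mul hS.2
    rw [List.length_map] at hlen
    calc (hopSum S.unfailed : ℝ) ≤ S.unfailed.length * N.m := h1
      _ ≤ (N.m * p.J N.m) * N.m := by gcongr
      _ = _ := by ring
  set h := lyapunov β (hopSum S.failed) with hh
  have hpt : ∀ ω, lyapunov β (hopSum (X.bufferFrom p k ω S)) ≤
      h + Dᶜ.indicator (fun _ => ENNReal.ofReal 3 * (h + 1)) ω := by
    intro ω
    by_cases hω : ω ∈ D
    · have hnil := failures_eq_nil (A.run (p.J N.m) (N.m * p.J N.m) (S.unfailed.map Route.next)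
        (X.seed k .normal ω)) ⌊p.normalLength N.m⌋₊ S.unfailed 
        (by simpa [hD, FrameParams.normalLength] using hω)
      rw [bufferFrom, hnil, List.append_nil]
      exact le_self_add
    · rw [Set.indicator_of_mem (by simpa using hω)]
      refine le_trans ?_ le_add_self
      have h1 : hopSum (X.bufferFrom p k ω S) ≤ hopSum S.failed + hopSum S.unfailed := by
        rw [bufferFrom, hopSum_append]
        exact Nat.add_le_add_left (hopSum_failures_le _ _ _) _
      refine (lyapunov_mono hβ h1).trans ((lyapunov_add_le hβ _ _).trans ?_)
      gcongr
      exact growth_pow_le_three N.one_le_m hJ _ hhop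
  refine (lintegral_mono hpt).trans ?_
  rw [lintegral_add_left measurable_const, lintegral_const, measure_univ, mul_one,
    lintegral_indicator_const hDm.compl, mul_right_comm]
  gcongr
  rw [ENNReal.ofReal_mul (by norm_num)]
  gcongr

variable {w : Ω → ℝ≥0∞}

/-- The normal phase of a frame without overload. The weight `w` is a function of the injections
that vanishes if there is an overload. -/
lemma lintegral_buffer_le (hA : A.HasScheduleLength N p.f p.g) (hJ : 600 ≤ p.J N.m) (k : ℕ)
    (hw : Measurable[X.sigmaOf (injections Set.univ)] w)
    (hgood : ∀ ω, w ω ≠ 0 → NotOverloaded N (p.J N.m) (X.frameStart p k ω)) :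
    ∫⁻ ω, w ω * lyapunov (growth N.m (p.J N.m)) (hopSum (X.buffer p k ω)) ∂μ ≤
      ENNReal.ofReal (1 + 3 * failProb N.m (p.J N.m)) *
        ∫⁻ ω, w ω * lyapunov (growth N.m (p.J N.m)) (hopSum (X.frameStart p k ω).failed) ∂μ +
      ENNReal.ofReal (3 * failProb N.m (p.J N.m)) * ∫⁻ ω, w ω ∂μ := by
  classical
  have hp := failProb_pos N.one_le_m hJ
  set β := growth N.m (p.J N.m) with hβdef
  set c := ENNReal.ofReal (3 * failProb N.m (p.J N.m)) with hc
  set F : NetState E → Ω → ℝ≥0∞ := fun S ω => if NotOverloaded N (p.J N.m) S then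
    lyapunov β (hopSum (X.bufferFrom p k ω S)) else 0 with hF
  set Bd : NetState E → ℝ≥0∞ := fun S =>
    lyapunov β (hopSum S.failed) + c * (lyapunov β (hopSum S.failed) + 1) with hBd
  have hwp : Measurable[X.sigmaOf (past k)] w :=
    hw.mono (X.sigmaOf_mono (injections_subset_past _ _)) le_rfl
  have h1 : ∫⁻ ω, w ω * F (X.frameStart p k ω) ω ∂μ ≤ ∫⁻ ω, w ω * Bd (X.frameStart p k ω) ∂μ := by
    refine lintegral_freeze_le (X.sigmaOf_le _) (X.sigmaOf_le _)
      (X.indep_sigmaOf (disjoint_past_seed k)) (X.fiberMeas_frameStart p k) hwp ?_ ?_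
    · intro S
      simp only [hF]
      split_ifs
      · exact (X.fiberMeas_bufferFrom p k S (Set.mem_singleton _)).measurable
          fun B => lyapunov β (hopSum B)
      · exact measurable_const
    · intro S
      simp only [hF]
      split_ifs with hS
      · exact X.lintegral_bufferFrom_le p hA hJ k S hS
      · simp
  have h2 : ∀ ω, w ω * lyapunov β (hopSum (X.buffer p k ω)) = w ω * F (X.frameStart p k ω) ω := by
    intro ω
    by_cases h0 : w ω = 0
    · simp [h0]
    · simp only [hF, if_pos (hgood ω h0)]
      rfl
  have hwm : Measurable w := hw.mono (X.sigmaOf_le _) le_rfl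
  have hlm : Measurable fun ω => lyapunov β (hopSum (X.frameStart p k ω).failed) :=
    ((X.fiberMeas_frameStart p k).mono (X.sigmaOf_le _)).measurable
      fun S => lyapunov β (hopSum S.failed)
  have hwl : Measurable fun ω => w ω * lyapunov β (hopSum (X.frameStart p k ω).failed) :=
    hwm.mul hlm
  have h3 : ∀ ω, w ω * Bd (X.frameStart p k ω) =
      (1 + c) * (w ω * lyapunov β (hopSum (X.frameStart p k ω).failed)) + c * w ω := by
    intro ω
    simp only [hBd]
    ring
  have h4 : ENNReal.ofReal (1 + 3 * failProb N.m (p.J N.m)) = 1 + c := by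
    rw [ENNReal.ofReal_add zero_le_one (by positivity), ENNReal.ofReal_one]
  calc _ = ∫⁻ ω, w ω * F (X.frameStart p k ω) ω ∂μ := lintegral_congr h2
    _ ≤ _ := h1
    _ = _ := by
      rw [lintegral_congr h3, lintegral_add_left (hwl.const_mul _), lintegral_const_mul _ hwl,
        lintegral_const_mul _ hwm, h4]

/-- The drift of the Lyapunov function in a frame without overload. -/
lemma lintegral_frame_le (hA : A.HasScheduleLength N p.f p.g) (hJ : 600 ≤ p.J N.m)
    (hfit : ⌊p.normalLength N.m⌋₊ + ⌊p.cleanupLength N.m⌋₊ ≤ p.T) (k : ℕ)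
    (hw : Measurable[X.sigmaOf (injections Set.univ)] w)
    (hgood : ∀ ω, w ω ≠ 0 → NotOverloaded N (p.J N.m) (X.frameStart p k ω)) :
    ∫⁻ ω, w ω * lyapunov (growth N.m (p.J N.m)) (hopSum (X.frameStart p (k + 1) ω).failed) ∂μ ≤
      ENNReal.ofReal (1 - drift N.m (p.J N.m) / 2) *
        ∫⁻ ω, w ω * lyapunov (growth N.m (p.J N.m)) (hopSum (X.frameStart p k ω).failed) ∂μ +
      ENNReal.ofReal (3 * failProb N.m (p.J N.m)) * ∫⁻ ω, w ω ∂μ := by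
  have hm : (1 : ℝ) ≤ N.m := by exact_mod_cast N.one_le_m
  have hp := failProb_pos N.one_le_m hJ
  have hd := drift_pos N.one_le_m hJ
  have hpd := failProb_le_drift N.one_le_m hJ
  have hdm := drift_mul_le N.one_le_m hJ
  have hd1 : drift N.m (p.J N.m) ≤ 1 := by nlinarith
  set β := growth N.m (p.J N.m) with hβdef
  have hwp : Measurable[X.sigmaOf (insert (Source.seed k Phase.normal) (past k))] w :=
    hw.mono (X.sigmaOf_mono ((injections_subset_past _ k).trans (Set.subset_insert _ _))) le_rfl
  have hwm : Measurable w := hw.mono (X.sigmaOf_le _) le_rfl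
  have hlm : Measurable fun ω => lyapunov β (hopSum (X.buffer p k ω)) :=
    ((X.fiberMeas_buffer p k).mono (X.sigmaOf_le _)).measurable fun B => lyapunov β (hopSum B)
  have h1 : ∫⁻ ω, w ω * lyapunov β (hopSum (X.frameStart p (k + 1) ω).failed) ∂μ ≤
      ENNReal.ofReal (1 - drift N.m (p.J N.m)) *
        ∫⁻ ω, w ω * lyapunov β (hopSum (X.buffer p k ω)) ∂μ := by
    have h2 := lintegral_freeze_le (X.sigmaOf_le _) (X.sigmaOf_le _)
      (X.indep_sigmaOf (disjoint_past_cleanupSources k)) (X.fiberMeas_buffer p k) hwp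
      (F := fun B ω => lyapunov β (hopSum (X.cleanupFrom p k ω B ⌊p.cleanupLength N.m⌋₊)))
      (B := fun B => ENNReal.ofReal (1 - drift N.m (p.J N.m)) * lyapunov β (hopSum B))
      (fun B => (X.fiberMeas_cleanupFrom p k B _ subset_rfl).measurable
        fun B => lyapunov β (hopSum B))
      (fun B => X.lintegral_cleanup_le p hA hJ k B)
    simp only [X.frameStart_succ_failed p k _ hfit]
    refine h2.trans (le_of_eq ?_)
    have hwl : Measurable fun ω => w ω * lyapunov β (hopSum (X.buffer p k ω)) := hwm.mul hlm
    rw [← lintegral_const_mul _ hwl]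
    refine lintegral_congr fun ω => ?_
    ring
  refine h1.trans ((mul_le_mul_right (X.lintegral_buffer_le p hA hJ k hw hgood) _).trans ?_)
  rw [mul_add, ← mul_assoc, ← mul_assoc, ← ENNReal.ofReal_mul (by linarith),
    ← ENNReal.ofReal_mul (by linarith)]
  refine add_le_add (mul_le_mul_left (ENNReal.ofReal_le_ofReal ?_) _)
    (mul_le_mul_left (ENNReal.ofReal_le_ofReal ?_) _) <;> nlinarith

end ProtocolInput

/-! ### The injected packets that may still be unfailed -/

lemma sum_Ico_mul {M : Type*} [AddCommMonoid M] (F : ℕ → M) (T : ℕ) {a c : ℕ} (h : a ≤ c) :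
    ∑ j ∈ Finset.Ico a c, ∑ i ∈ Finset.range T, F (j * T + i) =
      ∑ t ∈ Finset.Ico (a * T) (c * T), F t := by
  induction c, h using Nat.le_induction with
  | base => simp
  | succ c hc ih =>
    rw [Finset.sum_Ico_succ_top hc, ih, ← Finset.sum_Ico_consecutive F
      (Nat.mul_le_mul_right T hc) (Nat.mul_le_mul_right T (Nat.le_succ c)), Nat.succ_mul]
    congr 1
    rw [Finset.sum_Ico_eq_sum_range, Nat.add_sub_cancel_left]

lemma lintegral_finset_biUnion_le {α ι : Type*} [MeasurableSpace α] {μ : Measure α}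
    (s : Finset ι) (t : ι → Set α) (f : α → ℝ≥0∞) :
    ∫⁻ a in ⋃ i ∈ s, t i, f a ∂μ ≤ ∑ i ∈ s, ∫⁻ a in t i, f a ∂μ := by
  classical
  induction s using Finset.induction_on with
  | empty => simp
  | insert i s hi ih =>
    rw [Finset.set_biUnion_insert, Finset.sum_insert hi]
    exact (lintegral_union_le _ _ _).trans (add_le_add le_rfl ih)

namespace ProtocolInput

variable {V E : Type*} [Fintype E] [DecidableEq E] {N : Network V E} {A : StaticAlgorithm E}
  {G : Type*} [Fintype G] {Ω : Type*} [mΩ : MeasurableSpace Ω] {μ : Measure Ω}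
  (X : ProtocolInput N A G μ) (p : FrameParams)

/-- The packets that would be in the network at the beginning of frame `k` if every packet made one
hop in each frame. It is a function of the injections alone. -/
noncomputable def virtualPackets : ℕ → Ω → List (Route E)
  | 0, _ => []
  | k + 1, ω => (virtualPackets k ω).filterMap Route.advance ++ X.injected (k * p.T) p.T ω

lemma unfailed_sublist (hfit : ⌊p.normalLength N.m⌋₊ ≤ p.T) (k : ℕ) (ω : Ω) :
    (X.frameStart p k ω).unfailed.Sublist (X.virtualPackets p k ω) := by
  induction k with
  | zero => exact List.Sublist.refl _
  | succ k ih =>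
    rw [frameStart_succ_unfailed, within_unfailed, virtualPackets]
    exact ((unfailedAfter_sublist _ _ _ hfit _).trans (ih.filterMap _)).append
      (List.Sublist.refl _)

lemma sum_map_injected {M : Type*} [AddCommMonoid M] (φ : Route E → M) (t₀ s : ℕ) (ω : Ω) :
    ((X.injected t₀ s ω).map φ).sum =
      ∑ i ∈ Finset.range s, ∑ g, (X.inj (t₀ + i) g ω).elim 0 fun P => φ P.1 := by
  induction s with
  | zero => rfl
  | succ s ih =>
    have : X.injected t₀ (s + 1) ω = X.injected t₀ s ω ++
        (Finset.univ : Finset G).toList.filterMap fun g =>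
          (X.inj (t₀ + s) g ω).map Subtype.val := by
      simp [injected, List.range_succ]
    rw [this, List.map_append, List.sum_append, ih, Finset.sum_range_succ, sum_map_filterMap,
      ← Finset.sum_map_toList (Finset.univ : Finset G)]
    congr 2
    refine List.map_congr_left fun g _ => ?_
    cases X.inj (t₀ + s) g ω <;> rfl

/-- A packet injected in frame `j` is present at the beginning of frame `k` after `k - 1 - j` hops;
`φ i` is a statistic of a route after `i` hops. -/
lemma sum_map_virtualPackets {M : Type*} [AddCommMonoid M] (φ : ℕ → Route E → M)
    (hφ : ∀ i r, r.advance.elim 0 (φ i) = φ (i + 1) r) (k : ℕ) (ω : Ω) (i : ℕ) :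
    ((X.virtualPackets p k ω).map (φ i)).sum =
      ∑ j ∈ Finset.range k, ((X.injected (j * p.T) p.T ω).map (φ (k - 1 - j + i))).sum := by
  induction k generalizing i with
  | zero => rfl
  | succ k ih =>
    rw [virtualPackets, List.map_append, List.sum_append, sum_map_filterMap,
      Finset.sum_range_succ]
    simp only [hφ]
    rw [ih (i + 1)]
    congr 1
    · refine Finset.sum_congr rfl fun j hj => ?_
      rw [Finset.mem_range] at hj
      congr 3
      omega
    · congr 3
      omega

/-- The number of hops of an injected packet. -/
def hopsOf (o : Option N.Path) : ℕ := o.elim 0 fun P => P.1.hops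

/-- The impact on `e` of hop number `i` of an injected packet. -/
def impactOf (i : ℕ) (e : E) (o : Option N.Path) : ℝ :=
  o.elim 0 fun P => (P.1.links[i]?).elim 0 (N.W e)

lemma hopsOf_le (o : Option N.Path) : hopsOf o ≤ N.m := by
  cases o with
  | none => exact Nat.zero_le _
  | some P => exact N.hops_le_m P

lemma impactOf_nonneg (i : ℕ) (e : E) (o : Option N.Path) : 0 ≤ impactOf i e o := by
  cases o with
  | none => exact le_rfl
  | some P =>
    rw [impactOf]
    cases h : P.1.links[i]? <;> simp [h, N.W_nonneg]

lemma impactOf_le_one (i : ℕ) (e : E) (o : Option N.Path) : impactOf i e o ≤ 1 := by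
  cases o with
  | none => exact zero_le_one
  | some P =>
    rw [impactOf]
    cases h : P.1.links[i]? <;> simp [h, N.W_le_one]

lemma impactOf_eq_zero {i : ℕ} (hi : N.m ≤ i) (e : E) (o : Option N.Path) :
    impactOf i e o = 0 := by
  cases o with
  | none => rfl
  | some P =>
    have h : P.1.links[i]? = none := by
      rw [List.getElem?_eq_none_iff]
      exact (N.hops_le_m P).trans hi
    rw [impactOf, Option.elim, h]
    rfl

/-- The number of transmissions over `e` that an injected packet needs. -/
def countOf (e : E) (o : Option N.Path) : ℝ :=
  match o with
  | none => 0
  | some P => (P.1.links.count e : ℝ)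

lemma sum_countOf (o : Option N.Path) : ∑ e, countOf e o = hopsOf o := by
  cases o with
  | none => simp [countOf, hopsOf]
  | some P =>
    simp only [countOf, hopsOf, Option.elim]
    rw [← Route.length_links, ← List.sum_toFinset_count_eq_length, ← Nat.cast_sum]
    congr 1
    refine (Finset.sum_subset (Finset.subset_univ _) fun x _ hx => ?_).symm
    rwa [List.mem_toFinset, ← List.count_eq_zero] at hx

lemma sum_list_getElem? {α : Type*} (φ : α → ℝ) (hφ : ∀ a, 0 ≤ φ a) (l : List α) (k : ℕ) :
    ∑ i ∈ Finset.range k, (l[i]?).elim 0 φ ≤ (l.map φ).sum := by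
  induction l generalizing k with
  | nil => simp
  | cons a l ih =>
    cases k with
    | zero =>
      simp only [Finset.range_zero, Finset.sum_empty]
      exact List.sum_nonneg (by simpa using ⟨hφ a, fun x _ => hφ x⟩)
    | succ k =>
      rw [Finset.sum_range_succ']
      simp only [List.getElem?_cons_succ, List.getElem?_cons_zero, Option.elim_some,
        List.map_cons, List.sum_cons]
      linarith [ih k]

lemma sum_impactOf_le (e : E) (o : Option N.Path) (k : ℕ) :
    ∑ i ∈ Finset.range k, impactOf i e o ≤ ∑ e', N.W e e' * countOf e' o := by
  cases o with
  | none => simp [impactOf, countOf]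
  | some P =>
    simp only [impactOf, countOf, Option.elim]
    refine (sum_list_getElem? (N.W e) (N.W_nonneg e) P.1.links k).trans (le_of_eq ?_)
    rw [← N.mulVec_count]
    rfl

/-- The slots whose injections can influence the frames `b m, …, b m + m - 1`. -/
def window (N : Network V E) (p : FrameParams) (b : ℕ) : Finset ℕ :=
  Finset.Ico ((b - 1) * N.m * p.T) ((b + 1) * N.m * p.T)

/-- The total number of hops of the packets injected in the window of block `b`. -/
noncomputable def windowHops (b : ℕ) (ω : Ω) : ℕ :=
  ∑ t ∈ window N p b, ∑ g, hopsOf (X.inj t g ω)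

/-- The component for link `e` of the interference measure of the virtual packets of frame `k`. -/
noncomputable def virtualLoad (k : ℕ) (e : E) (ω : Ω) : ℝ :=
  ((X.virtualPackets p k ω).map fun r => N.W e r.next).sum

/-- The impact on link `e` in frame `k` of what is injected in slot `t`. -/
noncomputable def slotImpact (N : Network V E) (p : FrameParams) (k : ℕ) (e : E) (t : ℕ)
    (o : Option N.Path) : ℝ :=
  if t < k * p.T then impactOf (k - 1 - t / p.T) e o else 0

lemma slotImpact_nonneg (k : ℕ) (e : E) (t : ℕ) (o : Option N.Path) :
    0 ≤ slotImpact N p k e t o := by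
  unfold slotImpact
  split_ifs
  · exact impactOf_nonneg _ _ _
  · exact le_rfl

lemma slotImpact_le_one (k : ℕ) (e : E) (t : ℕ) (o : Option N.Path) :
    slotImpact N p k e t o ≤ 1 := by
  unfold slotImpact
  split_ifs
  · exact impactOf_le_one _ _ _
  · exact zero_le_one

lemma hopSum_injected (j : ℕ) (ω : Ω) : hopSum (X.injected (j * p.T) p.T ω) =
    ∑ i ∈ Finset.range p.T, ∑ g, hopsOf (X.inj (j * p.T + i) g ω) :=
  X.sum_map_injected Route.hops _ _ _

lemma hopSum_virtualPackets_le (k : ℕ) (ω : Ω) : hopSum (X.virtualPackets p k ω) ≤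
    ∑ j ∈ Finset.Ico (k - N.m) k, hopSum (X.injected (j * p.T) p.T ω) := by
  have h := X.sum_map_virtualPackets p (fun i r => r.hops - i) (fun i r => by
    rcases r with ⟨e, _ | ⟨a, l⟩⟩
    · simp [Route.advance, Route.hops]
    · simp [Route.advance, Route.hops]) k ω 0
  have h0 : hopSum (X.virtualPackets p k ω) =
      ((X.virtualPackets p k ω).map fun r => r.hops - 0).sum := rfl
  rw [h0, h, ← Finset.sum_range_add_sum_Ico _ (Nat.sub_le k N.m), Finset.sum_eq_zero, zero_add]
  · refine Finset.sum_le_sum fun j _ => List.sum_le_sum fun r _ => Nat.sub_le _ _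
  · intro j hj
    rw [Finset.mem_range] at hj
    rw [X.sum_map_injected]
    refine Finset.sum_eq_zero fun i _ => Finset.sum_eq_zero fun g _ => ?_
    cases X.inj (j * p.T + i) g ω with
    | none => rfl
    | some P =>
      have := N.hops_le_m P
      simp only [Option.elim]
      omega

lemma sum_hopSum_injected (a c : ℕ) (h : a ≤ c) (ω : Ω) :
    ∑ j ∈ Finset.Ico a c, hopSum (X.injected (j * p.T) p.T ω) =
      ∑ t ∈ Finset.Ico (a * p.T) (c * p.T), ∑ g, hopsOf (X.inj t g ω) := by
  simp only [hopSum_injected]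
  exact sum_Ico_mul (fun t => ∑ g, hopsOf (X.inj t g ω)) p.T h

/-- Only injections in the window of block `b` matter for the load in the frames of block `b`. -/
lemma virtualLoad_eq (hT : 0 < p.T) {b k : ℕ} (hk : k < (b + 1) * N.m) (hk' : b * N.m ≤ k) (e : E)
    (ω : Ω) : X.virtualLoad p k e ω =
      ∑ t ∈ window N p b, ∑ g, slotImpact N p k e t (X.inj t g ω) := by
  have h := X.sum_map_virtualPackets p (fun i r => (r.links[i]?).elim 0 (N.W e)) (fun i r => by
    rcases r with ⟨e, _ | ⟨a, l⟩⟩ <;> simp [Route.advance, Route.links]) k ω 0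
  have h0 : X.virtualLoad p k e ω =
      ((X.virtualPackets p k ω).map fun r => (r.links[0]?).elim 0 (N.W e)).sum := rfl
  rw [h0, h]
  have h1 : ∀ j ∈ Finset.range k, ((X.injected (j * p.T) p.T ω).map
      fun r => (r.links[k - 1 - j + 0]?).elim 0 (N.W e)).sum =
      ∑ i ∈ Finset.range p.T, ∑ g, slotImpact N p k e (j * p.T + i)
        (X.inj (j * p.T + i) g ω) := by
    intro j hj
    rw [Finset.mem_range] at hj
    rw [X.sum_map_injected]
    refine Finset.sum_congr rfl fun i hi => Finset.sum_congr rfl fun g _ => ?_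
    rw [Finset.mem_range] at hi
    have h2 : j * p.T + i < k * p.T := by
      calc j * p.T + i < (j + 1) * p.T := by
            rw [Nat.succ_mul]
            omega
        _ ≤ k * p.T := Nat.mul_le_mul_right _ hj
    have h3 : (j * p.T + i) / p.T = j := by
      rw [mul_comm, Nat.mul_add_div hT, Nat.div_eq_of_lt hi, add_zero]
    rw [slotImpact, if_pos h2, h3]
    rfl
  rw [Finset.sum_congr rfl h1, Finset.range_eq_Ico,
    sum_Ico_mul (fun t => ∑ g, slotImpact N p k e t (X.inj t g ω)) p.T (Nat.zero_le k), zero_mul]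
  have hzero : ∀ t, t ∉ window N p b → slotImpact N p k e t = fun _ => 0 := by
    intro t ht
    funext o
    rw [slotImpact]
    split_ifs with h2
    · refine impactOf_eq_zero ?_ e o
      have h3 : t < (b + 1) * N.m * p.T := h2.trans_le (Nat.mul_le_mul_right _ hk.le)
      have h4 : t < (b - 1) * N.m * p.T := by
        by_contra hcon
        exact ht (Finset.mem_Ico.2 ⟨not_lt.1 hcon, h3⟩)
      have h5 : t / p.T < (b - 1) * N.m := Nat.div_lt_of_lt_mul (by rwa [mul_comm])
      cases b with
      | zero => simp at h5
      | succ b =>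
        rw [Nat.succ_mul] at hk'
        rw [Nat.add_sub_cancel] at h5
        omega
    · rfl
  have hsub : window N p b ∩ Finset.Ico 0 (k * p.T) ⊆ window N p b := Finset.inter_subset_left
  rw [← Finset.sum_subset hsub, ← Finset.sum_subset Finset.inter_subset_right]
  · intro t ht ht'
    have : t ∉ window N p b := fun h => ht' (Finset.mem_inter.2 ⟨h, ht⟩)
    simp [hzero t this]
  · intro t ht ht'
    have : ¬ t < k * p.T := fun h =>
      ht' (Finset.mem_inter.2 ⟨ht, Finset.mem_Ico.2 ⟨Nat.zero_le _, h⟩⟩)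
    simp [slotImpact, this]

/-- Block `b` is overloaded if in one of its frames the virtual packets have interference measure
more than `J`. -/
def Overload (b : ℕ) : Set Ω :=
  {ω | ∃ k ∈ Finset.Ico (b * N.m) ((b + 1) * N.m), ∃ e, p.J N.m < X.virtualLoad p k e ω}

lemma virtualPackets_hops_le (k : ℕ) (ω : Ω) : ∀ r ∈ X.virtualPackets p k ω, r.hops ≤ N.m := by
  induction k with
  | zero => simp [virtualPackets]
  | succ k ih =>
    intro r hr
    rw [virtualPackets, List.mem_append, List.mem_filterMap] at hr
    rcases hr with ⟨r', hr', h⟩ | hr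
    · have h1 := congrArg List.length (Route.links_of_advance h)
      rw [List.length_tail, Route.length_links, Route.length_links] at h1
      have := ih r' hr'
      omega
    · simp only [injected, List.mem_flatMap, List.mem_filterMap] at hr
      obtain ⟨i, -, g, -, h⟩ := hr
      obtain ⟨P, -, rfl⟩ := Option.map_eq_some_iff.1 h
      exact N.hops_le_m P

lemma notOverloaded_of_notMem (hfit : ⌊p.normalLength N.m⌋₊ ≤ p.T) (hJ : 0 ≤ p.J N.m) {b k : ℕ}
    (hk : k ∈ Finset.Ico (b * N.m) ((b + 1) * N.m)) {ω : Ω} (hω : ω ∉ X.Overload p b) :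
    NotOverloaded N (p.J N.m) (X.frameStart p k ω) := by
  have hsub := X.unfailed_sublist p hfit k ω
  refine ⟨N.interference_le_of_sublist hJ (hsub.map Route.next) fun e => ?_, fun r hr =>
    X.virtualPackets_hops_le p k ω r (hsub.subset hr)⟩
  rw [List.map_map]
  by_contra hcon
  exact hω ⟨k, hk, e, not_le.1 hcon⟩

/-- The potential plus all hops of unfailed packets grows by injections only. -/
lemma potential_add_unfailed_le
    (hfit : ⌊p.normalLength N.m⌋₊ + ⌊p.cleanupLength N.m⌋₊ ≤ p.T) (k₀ : ℕ) (ω : Ω) {k : ℕ}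
    (hk : k₀ ≤ k) :
    hopSum (X.frameStart p k ω).failed + hopSum (X.frameStart p k ω).unfailed ≤
      hopSum (X.frameStart p k₀ ω).failed + hopSum (X.frameStart p k₀ ω).unfailed +
        ∑ j ∈ Finset.Ico k₀ k, hopSum (X.injected (j * p.T) p.T ω) := by
  induction k, hk using Nat.le_induction with
  | base => simp
  | succ k hk ih =>
    rw [Finset.sum_Ico_succ_top hk, X.frameStart_succ_failed p k ω hfit,
      frameStart_succ_unfailed, hopSum_append]
    have h1 := X.hopSum_cleanupFrom_le p k ω (X.buffer p k ω) ⌊p.cleanupLength N.m⌋₊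
    have h2 : hopSum (X.buffer p k ω) + hopSum (X.within p k ω (X.frameStart p k ω) p.T).unfailed ≤
        hopSum (X.frameStart p k ω).failed + hopSum (X.frameStart p k ω).unfailed := by
      rw [buffer, bufferFrom, hopSum_append, within_unfailed]
      have := hopSum_unfailedAfter_add_failures (A.run (p.J N.m) (N.m * p.J N.m)
        ((X.frameStart p k ω).unfailed.map Route.next) (X.seed k .normal ω))
        ⌊p.normalLength N.m⌋₊ p.T (by omega) (X.frameStart p k ω).unfailed
      omega
    omega

/-- Whatever happens in a block, the potential grows at most by the hops of the packets injected in
the window of the block. -/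
lemma hopSum_le_add_windowHops
    (hfit : ⌊p.normalLength N.m⌋₊ + ⌊p.cleanupLength N.m⌋₊ ≤ p.T) {b k : ℕ}
    (hk : b * N.m ≤ k) (hk' : k ≤ (b + 1) * N.m) (ω : Ω) :
    hopSum (X.frameStart p k ω).failed + hopSum (X.frameStart p k ω).unfailed ≤
      hopSum (X.frameStart p (b * N.m) ω).failed + X.windowHops p b ω := by
  have h1 := X.potential_add_unfailed_le p hfit (b * N.m) ω hk
  have h2 := (X.unfailed_sublist p (by omega) (b * N.m) ω).hopSum_le
  have h3 := X.hopSum_virtualPackets_le p (b * N.m) ω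
  have hb : b * N.m - N.m = (b - 1) * N.m := by rw [Nat.sub_mul, one_mul]
  rw [hb] at h3
  have hle : (b - 1) * N.m ≤ b * N.m := Nat.mul_le_mul_right _ (Nat.sub_le _ _)
  have h4 : ∑ j ∈ Finset.Ico ((b - 1) * N.m) (b * N.m), hopSum (X.injected (j * p.T) p.T ω) +
      ∑ j ∈ Finset.Ico (b * N.m) k, hopSum (X.injected (j * p.T) p.T ω) ≤
      X.windowHops p b ω := by
    rw [Finset.sum_Ico_consecutive _ hle hk, sum_hopSum_injected _ _ _ _ (hle.trans hk),
      windowHops]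
    refine Finset.sum_le_sum_of_subset ?_
    exact Finset.Ico_subset_Ico le_rfl (Nat.mul_le_mul_right _ hk')
  omega

lemma hopSum_buffer_le_add_windowHops
    (hfit : ⌊p.normalLength N.m⌋₊ + ⌊p.cleanupLength N.m⌋₊ ≤ p.T) {b k : ℕ}
    (hk : b * N.m ≤ k) (hk' : k ≤ (b + 1) * N.m) (ω : Ω) :
    hopSum (X.buffer p k ω) ≤
      hopSum (X.frameStart p (b * N.m) ω).failed + X.windowHops p b ω := by
  refine le_trans ?_ (X.hopSum_le_add_windowHops p hfit hk hk' ω)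
  rw [buffer, bufferFrom, hopSum_append]
  exact Nat.add_le_add_left (hopSum_failures_le _ _ _) _

/-! ### Measurability with respect to injections -/

lemma fiberMeas_inj_window {b t : ℕ} (ht : t ∈ window N p b) (g : G) :
    FiberMeas (X.sigmaOf (injections (window N p b))) (X.inj t g) :=
  X.fiberMeas_inj ⟨t, ht, g, rfl⟩

lemma measurable_sum_inj {M : Type*} [AddCommMonoid M] [MeasurableSpace M] [MeasurableAdd₂ M]
    (b : ℕ) (F : ℕ → Option N.Path → M) :
    Measurable[X.sigmaOf (injections (window N p b))]
      (fun ω => ∑ t ∈ window N p b, ∑ g, F t (X.inj t g ω)) := by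
  refine Finset.measurable_fun_sum _ fun t ht => Finset.measurable_fun_sum _ fun g _ => ?_
  exact (X.fiberMeas_inj_window p ht g).measurable (F t)

lemma measurable_windowHops (b : ℕ) :
    Measurable[X.sigmaOf (injections (window N p b))] (X.windowHops p b) :=
  X.measurable_sum_inj p b fun _ => hopsOf

lemma measurableSet_overload (hT : 0 < p.T) (b : ℕ) :
    MeasurableSet[X.sigmaOf (injections (window N p b))] (X.Overload p b) := by
  have : X.Overload p b = ⋃ k ∈ Finset.Ico (b * N.m) ((b + 1) * N.m), ⋃ e,
      {ω | p.J N.m < X.virtualLoad p k e ω} := by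
    ext ω
    simp [Overload]
  rw [this]
  refine Finset.measurableSet_biUnion _ fun k hk => MeasurableSet.iUnion fun e => ?_
  rw [Finset.mem_Ico] at hk
  have h1 : X.virtualLoad p k e = fun ω =>
      ∑ t ∈ window N p b, ∑ g, slotImpact N p k e t (X.inj t g ω) :=
    funext fun ω => X.virtualLoad_eq p hT hk.2 hk.1 e ω
  have h2 : Measurable[X.sigmaOf (injections (window N p b))] (X.virtualLoad p k e) := by
    rw [h1]
    exact X.measurable_sum_inj p b _
  exact h2 measurableSet_Ioi

/-! ### The exponential moment of an overload -/

section Moments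

variable [IsProbabilityMeasure μ]

lemma finite_path (N : Network V E) : Finite N.Path := by
  have h : Finite {l : List E | l.length ≤ N.D} := (List.finite_length_le E N.D).to_subtype
  refine Finite.of_injective
    (fun P : N.Path => (⟨P.1.links, P.2.2⟩ : {l : List E | l.length ≤ N.D})) ?_
  rintro ⟨⟨a, l⟩, hP⟩ ⟨⟨a', l'⟩, hP'⟩ h
  have h' : a :: l = a' :: l' := congrArg Subtype.val h
  rw [List.cons.injEq] at h'
  obtain ⟨rfl, rfl⟩ := h'
  rfl

lemma integrable_inj (φ : Option N.Path → ℝ) (t : ℕ) (g : G) :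
    Integrable (fun ω => φ (X.inj t g ω)) μ := by
  have := finite_path N
  let _ : MeasurableSpace (Option N.Path) := ⊤
  have hm : Measurable (X.inj t g) := fun s _ =>
    FiberMeas.measurableSet (f := X.inj t g) (X.measurableSet_inj t g) (· ∈ s)
  exact (Integrable.of_finite (μ := μ.map (X.inj t g)) (f := φ)).comp_measurable hm

lemma integral_inj_eq (φ : Option N.Path → ℝ) (t t' : ℕ) (g : G) :
    ∫ ω, φ (X.inj t g ω) ∂μ = ∫ ω, φ (X.inj t' g ω) ∂μ := by
  let _ : MeasurableSpace (Option N.Path) := ⊤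
  have hm : ∀ t, Measurable (X.inj t g) := fun t s _ =>
    FiberMeas.measurableSet (f := X.inj t g) (X.measurableSet_inj t g) (· ∈ s)
  have hmap : μ.map (X.inj t g) = μ.map (X.inj t' g) := by
    refine Measure.ext_of_singleton fun a => ?_
    rw [Measure.map_apply (hm t) trivial, Measure.map_apply (hm t') trivial]
    exact X.inj_identDistrib t t' g a
  have hφ : ∀ ν : Measure (Option N.Path), AEStronglyMeasurable φ ν := fun ν =>
    (Measurable.of_discrete (f := φ)).aestronglyMeasurable
  rw [← integral_map (hm t).aemeasurable (hφ _), hmap,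
    integral_map (hm t').aemeasurable (hφ _)]

lemma iIndepFun_inj {M : Type*} [MeasurableSpace M] (F : ℕ × G → Option N.Path → M) :
    iIndepFun (fun (x : ℕ × G) ω => F x (X.inj x.1 x.2 ω)) μ := by
  have hinj : Function.Injective (fun x : ℕ × G => (Source.inject x.1 x.2 : Source G E)) := by
    rintro ⟨t, g⟩ ⟨t', g'⟩ h
    simpa using h
  refine iIndep_of_iIndep_of_le (X.indep.precomp hinj) fun x => ?_
  rintro _ ⟨s, -, rfl⟩
  exact ⟨F x ⁻¹' s, trivial, rfl⟩

/-- The exponential moment of a sum over independent injections. -/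
lemma lintegral_prod_inj_le (s : Finset ℕ) (F a : ℕ → Option N.Path → ℝ)
    (ha : ∀ t o, 0 ≤ a t o) (hF : ∀ t o, F t o ≤ 1 + a t o) :
    ∫⁻ ω, ∏ t ∈ s, ∏ g, ENNReal.ofReal (F t (X.inj t g ω)) ∂μ ≤
      ENNReal.ofReal (Real.exp (∑ g, ∫ ω, ∑ t ∈ s, a t (X.inj 0 g ω) ∂μ)) := by
  have hprod : ∀ ω, ∏ t ∈ s, ∏ g, ENNReal.ofReal (F t (X.inj t g ω)) =
      ∏ x ∈ s ×ˢ Finset.univ, ENNReal.ofReal (F x.1 (X.inj x.1 x.2 ω)) := fun ω =>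
    (Finset.prod_product s Finset.univ
      fun x : ℕ × G => ENNReal.ofReal (F x.1 (X.inj x.1 x.2 ω))).symm
  have hmeas : ∀ x : ℕ × G, Measurable fun ω => ENNReal.ofReal (F x.1 (X.inj x.1 x.2 ω)) :=
    fun x => FiberMeas.measurable (f := X.inj x.1 x.2) (X.measurableSet_inj x.1 x.2)
      fun o => ENNReal.ofReal (F x.1 o)
  rw [lintegral_congr hprod, lintegral_prod_eq_prod_lintegral_of_indepFun _ _
    (X.iIndepFun_inj fun x o => ENNReal.ofReal (F x.1 o)) hmeas]
  have hone : ∀ x : ℕ × G, ∫⁻ ω, ENNReal.ofReal (F x.1 (X.inj x.1 x.2 ω)) ∂μ ≤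
      ENNReal.ofReal (Real.exp (∫ ω, a x.1 (X.inj 0 x.2 ω) ∂μ)) := by
    intro x
    have hint := X.integrable_inj (fun o => 1 + a x.1 o) x.1 x.2
    calc ∫⁻ ω, ENNReal.ofReal (F x.1 (X.inj x.1 x.2 ω)) ∂μ
        ≤ ∫⁻ ω, ENNReal.ofReal (1 + a x.1 (X.inj x.1 x.2 ω)) ∂μ :=
          lintegral_mono fun ω => ENNReal.ofReal_le_ofReal (hF _ _)
      _ = ENNReal.ofReal (∫ ω, 1 + a x.1 (X.inj x.1 x.2 ω) ∂μ) := by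
          rw [ofReal_integral_eq_lintegral_ofReal hint]
          exact Filter.Eventually.of_forall fun ω => add_nonneg zero_le_one (ha _ _)
      _ ≤ _ := by
          refine ENNReal.ofReal_le_ofReal ?_
          rw [integral_add (integrable_const _) (X.integrable_inj (a x.1) x.1 x.2),
            X.integral_inj_eq (a x.1) x.1 0 x.2]
          simp only [integral_const, probReal_univ, smul_eq_mul, mul_one]
          rw [add_comm]
          exact Real.add_one_le_exp _
  refine (Finset.prod_le_prod' fun x _ => hone x).trans (le_of_eq ?_)
  rw [← ENNReal.ofReal_prod_of_nonneg fun x _ => (Real.exp_pos _).le, ← Real.exp_sum,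
    Finset.sum_product, Finset.sum_comm]
  congr 2
  refine Finset.sum_congr rfl fun g _ => ?_
  rw [integral_finsetSum _ fun t _ => X.integrable_inj (a t) 0 g]

lemma load_eq (t : ℕ) (e : E) : X.load t e = ∑ g, ∫ ω, countOf e (X.inj t g ω) ∂μ := rfl

lemma countOf_nonneg (e : E) (o : Option N.Path) : 0 ≤ countOf e o := by
  cases o with
  | none => exact le_rfl
  | some P => exact Nat.cast_nonneg _

lemma load_nonneg (t : ℕ) (e : E) : 0 ≤ X.load t e := by
  rw [load_eq]
  exact Finset.sum_nonneg fun g _ => integral_nonneg fun ω => countOf_nonneg e _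

lemma load_le {lam : ℝ} (hX : X.RateAtMost lam) (t : ℕ) (e : E) : X.load t e ≤ lam := by
  refine le_trans ?_ (hX t e)
  refine le_trans ?_ (Finset.single_le_sum (f := fun e' => N.W e e' * X.load t e')
    (fun e' _ => mul_nonneg (N.W_nonneg _ _) (X.load_nonneg t e')) (Finset.mem_univ e))
  simp [N.W_diag]

lemma sum_slotImpact_le (k : ℕ) (e : E) (s : Finset ℕ) (hT : 0 < p.T) (o : Option N.Path) :
    ∑ t ∈ s, slotImpact N p k e t o ≤ p.T * ∑ e', N.W e e' * countOf e' o := by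
  have h1 : ∑ t ∈ s, slotImpact N p k e t o ≤
      ∑ t ∈ Finset.range (k * p.T), slotImpact N p k e t o := by
    have h2 : ∑ t ∈ s ∩ Finset.range (k * p.T), slotImpact N p k e t o =
        ∑ t ∈ s, slotImpact N p k e t o := by
      refine Finset.sum_subset Finset.inter_subset_left fun t ht ht' => ?_
      have : ¬ t < k * p.T := fun h => ht' (Finset.mem_inter.2 ⟨ht, Finset.mem_range.2 h⟩)
      simp [slotImpact, this]
    rw [← h2]
    exact Finset.sum_le_sum_of_subset_of_nonneg Finset.inter_subset_right
      fun t _ _ => slotImpact_nonneg p k e t o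
  have h3 : ∑ t ∈ Finset.range (k * p.T), slotImpact N p k e t o =
      p.T * ∑ j ∈ Finset.range k, impactOf j e o := by
    have h4 := sum_Ico_mul (fun t => slotImpact N p k e t o) p.T (Nat.zero_le k)
    rw [zero_mul, ← Finset.range_eq_Ico, ← Finset.range_eq_Ico] at h4
    rw [← h4, ← Finset.sum_range_reflect (fun j => impactOf j e o), Finset.mul_sum]
    refine Finset.sum_congr rfl fun j hj => ?_
    rw [Finset.mem_range] at hj
    have h5 : ∀ i ∈ Finset.range p.T, slotImpact N p k e (j * p.T + i) o =
        impactOf (k - 1 - j) e o := by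
      intro i hi
      rw [Finset.mem_range] at hi
      have h6 : j * p.T + i < k * p.T := by
        calc j * p.T + i < (j + 1) * p.T := by
              rw [Nat.succ_mul]
              omega
          _ ≤ k * p.T := Nat.mul_le_mul_right _ hj
      rw [slotImpact, if_pos h6, mul_comm, Nat.mul_add_div hT, Nat.div_eq_of_lt hi, add_zero]
    rw [Finset.sum_congr rfl h5]
    simp
  rw [h3] at h1
  refine h1.trans ?_
  gcongr
  exact sum_impactOf_le e o k

lemma card_window_le (b : ℕ) : (window N p b).card ≤ 2 * N.m * p.T := by
  rw [window, Nat.card_Ico, ← Nat.sub_mul, ← Nat.sub_mul]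
  gcongr
  omega

/-- The expected total impact on `e` and the expected number of hops of what is injected in the
window of a block. -/
lemma sum_integral_le {lam : ℝ} (hX : X.RateAtMost lam) (hlam : 0 ≤ lam) (hT : 0 < p.T)
    (b k : ℕ) (e : E) {c₁ c₂ : ℝ} (hc₁ : 0 ≤ c₁) (hc₂ : 0 ≤ c₂) :
    ∑ g, ∫ ω, ∑ t ∈ window N p b, (c₁ * slotImpact N p k e t (X.inj 0 g ω) +
      c₂ * hopsOf (X.inj 0 g ω)) ∂μ ≤
      c₁ * (lam * p.T) + c₂ * (2 * (N.m : ℝ) ^ 2 * (lam * p.T)) := by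
  have hle : ∀ g, ∫ ω, ∑ t ∈ window N p b, (c₁ * slotImpact N p k e t (X.inj 0 g ω) +
      c₂ * hopsOf (X.inj 0 g ω)) ∂μ ≤
      ∫ ω, ∑ e', (c₁ * p.T * N.W e e' + c₂ * (2 * N.m * p.T)) * countOf e' (X.inj 0 g ω) ∂μ := by
    intro g
    refine integral_mono (X.integrable_inj (fun o => ∑ t ∈ window N p b,
      (c₁ * slotImpact N p k e t o + c₂ * hopsOf o)) 0 g)
      (X.integrable_inj (fun o => ∑ e', (c₁ * p.T * N.W e e' + c₂ * (2 * N.m * p.T)) *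
        countOf e' o) 0 g) fun ω => ?_
    simp only
    set o := X.inj 0 g ω
    have h1 := sum_slotImpact_le p k e (window N p b) hT o
    have h2 : ((window N p b).card : ℝ) ≤ 2 * N.m * p.T := by exact_mod_cast card_window_le p b
    rw [Finset.sum_add_distrib, ← Finset.mul_sum, Finset.sum_const, nsmul_eq_mul]
    simp only [add_mul]
    rw [Finset.sum_add_distrib, ← Finset.mul_sum, sum_countOf]
    have h3 : ∑ e', c₁ * p.T * N.W e e' * countOf e' o =
        c₁ * (p.T * ∑ e', N.W e e' * countOf e' o) := by
      rw [← mul_assoc, Finset.mul_sum]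
      refine Finset.sum_congr rfl fun e' _ => ?_
      ring
    rw [h3]
    have h4 : ((window N p b).card : ℝ) * (c₂ * hopsOf o) ≤ 2 * N.m * p.T * (c₂ * hopsOf o) := by
      gcongr
    have h5 : c₁ * ∑ t ∈ window N p b, slotImpact N p k e t o ≤
        c₁ * (p.T * ∑ e', N.W e e' * countOf e' o) := by gcongr
    linarith
  refine (Finset.sum_le_sum fun g _ => hle g).trans ?_
  have h6 : ∑ g, ∫ ω, ∑ e', (c₁ * p.T * N.W e e' + c₂ * (2 * N.m * p.T)) *
      countOf e' (X.inj 0 g ω) ∂μ =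
      ∑ e', (c₁ * p.T * N.W e e' + c₂ * (2 * N.m * p.T)) * X.load 0 e' := by
    simp only [load_eq, Finset.mul_sum]
    rw [Finset.sum_comm]
    refine Finset.sum_congr rfl fun g _ => ?_
    rw [integral_finsetSum _ fun e' _ => (X.integrable_inj (countOf e') 0 g).const_mul _]
    exact Finset.sum_congr rfl fun e' _ => integral_const_mul _ _
  rw [h6]
  simp only [add_mul]
  rw [Finset.sum_add_distrib]
  have h7 : ∑ e', c₁ * p.T * N.W e e' * X.load 0 e' = c₁ * p.T * (N.W *ᵥ X.load 0) e := by
    simp only [Matrix.mulVec, dotProduct, Finset.mul_sum]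
    exact Finset.sum_congr rfl fun e' _ => mul_assoc _ _ _
  have h8 : ∑ e', c₂ * (2 * N.m * p.T) * X.load 0 e' ≤ c₂ * (2 * N.m * p.T) * (N.m * lam) := by
    rw [← Finset.mul_sum]
    gcongr
    calc ∑ e', X.load 0 e' ≤ ∑ _e' : E, lam := Finset.sum_le_sum fun e' _ => X.load_le hX 0 e'
      _ = Fintype.card E * lam := by simp
      _ ≤ N.m * lam := by
        gcongr
        exact_mod_cast N.card_le_m
  have h9 : c₁ * p.T * (N.W *ᵥ X.load 0) e ≤ c₁ * p.T * lam := by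
    gcongr
    exact hX 0 e
  rw [h7]
  nlinarith

variable [Nonempty E]

/-- The exponential moment of the hops in the window of a block on the event that link `e` is
overloaded in frame `k` of the block; this is a Chernoff bound. -/
lemma lintegral_linkOverload_le (hX : X.RateAtMost (p.rate N.m)) (hJ : 600 ≤ p.J N.m)
    (hrate : 0 ≤ p.rate N.m) (hT : 0 < p.T) (hε : 0 < p.ε) (hε' : p.ε ≤ 1 / 2) {b k : ℕ}
    (hk : k ∈ Finset.Ico (b * N.m) ((b + 1) * N.m)) (e : E) :
    ∫⁻ ω in {ω | p.J N.m < X.virtualLoad p k e ω},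
      ENNReal.ofReal (growth N.m (p.J N.m) ^ (2 * X.windowHops p b ω)) ∂μ ≤
      ENNReal.ofReal (Real.exp 6 *
        Real.exp (-(2 / 5 * (p.ε ^ 2 * (p.rate N.m * p.T))))) := by
  have hm : (1 : ℝ) ≤ N.m := by exact_mod_cast N.one_le_m
  set J := p.J N.m with hJdef
  set β := growth N.m J with hβdef
  have hβ : 1 ≤ β := one_le_growth N.one_le_m hJ
  rw [Finset.mem_Ico] at hk
  have h1ε : 1 ≤ 1 + p.ε := by linarith
  set F : ℕ → Option N.Path → ℝ := fun t o =>
    β ^ (2 * hopsOf o) * (1 + p.ε) ^ slotImpact N p k e t o with hF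
  set δ := 3 / ((N.m : ℝ) ^ 2 * J) with hδ
  have hδ0 : 0 ≤ δ := by positivity
  have hprod : ∀ ω, ∏ t ∈ window N p b, ∏ g, ENNReal.ofReal (F t (X.inj t g ω)) =
      ENNReal.ofReal (β ^ (2 * X.windowHops p b ω) * (1 + p.ε) ^ X.virtualLoad p k e ω) := by
    intro ω
    rw [X.virtualLoad_eq p hT hk.2 hk.1, windowHops, Finset.mul_sum, Finset.prod_congr rfl
      fun t _ => (ENNReal.ofReal_prod_of_nonneg fun g _ => by positivity).symm,
      ← ENNReal.ofReal_prod_of_nonneg fun t _ => by positivity]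
    congr 1
    simp only [hF, Finset.prod_mul_distrib]
    rw [← Finset.prod_pow_eq_pow_sum, Real.rpow_sum_of_pos (by linarith)]
    congr 1
    · refine Finset.prod_congr rfl fun t _ => ?_
      rw [Finset.mul_sum, Finset.prod_pow_eq_pow_sum]
    · refine Finset.prod_congr rfl fun t _ => ?_
      rw [Real.rpow_sum_of_pos (by linarith)]
  have hmom := X.lintegral_prod_inj_le (window N p b) F
    (fun t o => p.ε * slotImpact N p k e t o + (1 + p.ε) * δ * hopsOf o)
    (fun t o => by
      have := slotImpact_nonneg p k e t o
      positivity)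
    (fun t o => by
      have h0 := slotImpact_nonneg p k e t o
      have h1 := slotImpact_le_one p k e t o
      have h2 := growth_pow_two_mul_le N.one_le_m hJ (hopsOf o) (hopsOf_le o)
      have h3 := rpow_one_add_le_one_add_mul_self (by linarith : -1 ≤ p.ε) h0 h1
      calc F t o ≤ (1 + δ * hopsOf o) * (1 + slotImpact N p k e t o * p.ε) := by
            refine mul_le_mul h2 h3 (by positivity) (by positivity)
        _ = 1 + p.ε * slotImpact N p k e t o + (1 + p.ε * slotImpact N p k e t o) *
            (δ * hopsOf o) := by ring
        _ ≤ 1 + p.ε * slotImpact N p k e t o + (1 + p.ε * 1) * (δ * hopsOf o) := by gcongr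
        _ = _ := by ring)
  have hsum := X.sum_integral_le p hX hrate hT b k e hε.le
    (by positivity : 0 ≤ (1 + p.ε) * δ)
  have hJy : J = (1 + p.ε) * (p.rate N.m * p.T) := by
    rw [hJdef, FrameParams.J, mul_assoc]
  set y := p.rate N.m * p.T with hy
  have hy0 : 0 ≤ y := by positivity
  have hδJ : (1 + p.ε) * δ * (2 * (N.m : ℝ) ^ 2 * y) = 6 := by
    have hy1 : y ≠ 0 := by
      rintro h
      rw [h] at hJy
      linarith
    rw [hδ, hJy]
    field_simp
    norm_num
  rw [hδJ] at hsum
  have hpos : 0 < 1 + p.ε := by linarith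
  have hset : MeasurableSet {ω | J < X.virtualLoad p k e ω} := by
    have h2 : Measurable[X.sigmaOf (injections (window N p b))] (X.virtualLoad p k e) := by
      rw [show X.virtualLoad p k e = _ from
        funext fun ω => X.virtualLoad_eq p hT hk.2 hk.1 e ω]
      exact X.measurable_sum_inj p b _
    exact X.sigmaOf_le _ _ (h2 measurableSet_Ioi)
  calc ∫⁻ ω in {ω | J < X.virtualLoad p k e ω}, ENNReal.ofReal (β ^ (2 * X.windowHops p b ω)) ∂μ
      ≤ ∫⁻ ω in {ω | J < X.virtualLoad p k e ω}, ENNReal.ofReal ((1 + p.ε) ^ (-J)) *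
          ENNReal.ofReal (β ^ (2 * X.windowHops p b ω) *
            (1 + p.ε) ^ X.virtualLoad p k e ω) ∂μ := by
        refine setLIntegral_mono' hset fun ω hω => ?_
        rw [← ENNReal.ofReal_mul (by positivity)]
        refine ENNReal.ofReal_le_ofReal ?_
        have h4 : 1 ≤ (1 + p.ε) ^ (-J) * (1 + p.ε) ^ X.virtualLoad p k e ω := by
          rw [← Real.rpow_add hpos]
          refine Real.one_le_rpow h1ε ?_
          have : J < X.virtualLoad p k e ω := hω
          linarith
        calc β ^ (2 * X.windowHops p b ω) = β ^ (2 * X.windowHops p b ω) * 1 := (mul_one _).symm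
          _ ≤ β ^ (2 * X.windowHops p b ω) *
              ((1 + p.ε) ^ (-J) * (1 + p.ε) ^ X.virtualLoad p k e ω) := by gcongr
          _ = _ := by ring
    _ ≤ ∫⁻ ω, ENNReal.ofReal ((1 + p.ε) ^ (-J)) *
          ENNReal.ofReal (β ^ (2 * X.windowHops p b ω) *
            (1 + p.ε) ^ X.virtualLoad p k e ω) ∂μ := setLIntegral_le_lintegral _ _
    _ = ENNReal.ofReal ((1 + p.ε) ^ (-J)) *
          ∫⁻ ω, ∏ t ∈ window N p b, ∏ g, ENNReal.ofReal (F t (X.inj t g ω)) ∂μ := by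
        rw [lintegral_const_mul' _ _ ENNReal.ofReal_ne_top]
        simp only [hprod]
    _ ≤ ENNReal.ofReal ((1 + p.ε) ^ (-J)) * ENNReal.ofReal (Real.exp (p.ε * y + 6)) := by
        gcongr
        exact hmom.trans (ENNReal.ofReal_le_ofReal (Real.exp_le_exp.2 hsum))
    _ ≤ _ := by
        rw [← ENNReal.ofReal_mul (by positivity), Real.rpow_def_of_pos hpos, ← Real.exp_add,
          ← Real.exp_add]
        refine ENNReal.ofReal_le_ofReal (Real.exp_le_exp.2 ?_)
        have := chernoff_exponent hε hε' hy0
        rw [hJy]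
        linarith

/-- The exponential moment of the hops in the window of a block on the event that the block is
overloaded. -/
lemma lintegral_overload_le (hX : X.RateAtMost (p.rate N.m)) (hJ : 600 ≤ p.J N.m)
    (hrate : 0 ≤ p.rate N.m) (hT : 0 < p.T) (hε : 0 < p.ε) (hε' : p.ε ≤ 1 / 2) (b : ℕ) :
    ∫⁻ ω in X.Overload p b,
      ENNReal.ofReal (growth N.m (p.J N.m) ^ (2 * X.windowHops p b ω)) ∂μ ≤
      ENNReal.ofReal ((N.m : ℝ) ^ 2 * (Real.exp 6 *
        Real.exp (-(2 / 5 * (p.ε ^ 2 * (p.rate N.m * p.T)))))) := by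
  set F : Ω → ℝ≥0∞ := fun ω =>
    ENNReal.ofReal (growth N.m (p.J N.m) ^ (2 * X.windowHops p b ω)) with hF
  set I := Finset.Ico (b * N.m) ((b + 1) * N.m) ×ˢ (Finset.univ : Finset E) with hI
  have hsub : X.Overload p b = ⋃ x ∈ I, {ω | p.J N.m < X.virtualLoad p x.1 x.2 ω} := by
    ext ω
    simp only [Overload, Set.mem_ofPred_eq, Set.mem_iUnion, Prod.exists, hI, Finset.mem_product,
      Finset.mem_univ, and_true, exists_prop]
    constructor
    · rintro ⟨k, hk, e, h⟩
      exact ⟨k, e, hk, h⟩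
    · rintro ⟨k, e, hk, h⟩
      exact ⟨k, hk, e, h⟩
  have hcard : (I.card : ℝ) ≤ (N.m : ℝ) ^ 2 := by
    have : I.card ≤ N.m * N.m := by
      rw [hI, Finset.card_product, Nat.card_Ico, Finset.card_univ, ← Nat.sub_mul,
        Nat.add_sub_cancel_left, one_mul]
      exact Nat.mul_le_mul_left _ N.card_le_m
    rw [sq]
    exact_mod_cast this
  rw [hsub]
  refine (lintegral_finset_biUnion_le I _ F).trans ?_
  refine (Finset.sum_le_sum fun x hx => X.lintegral_linkOverload_le p hX hJ hrate hT hε hε'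
    (Finset.mem_product.1 hx).1 x.2).trans ?_
  rw [Finset.sum_const, nsmul_eq_mul, ← ENNReal.ofReal_natCast, ← ENNReal.ofReal_mul
    (Nat.cast_nonneg _)]
  refine ENNReal.ofReal_le_ofReal ?_
  gcongr

end Moments

end ProtocolInput

/-! ### Blocks of frames -/

lemma ENNReal.two_mul_mul_le_sq_add_sq (a b : ℝ≥0∞) : 2 * (a * b) ≤ a ^ 2 + b ^ 2 := by
  have key : ∀ x y : ℝ≥0∞, x ≤ y → 2 * (x * y) ≤ x ^ 2 + y ^ 2 := by
    intro x y h
    obtain ⟨c, rfl⟩ := exists_add_of_le h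
    calc 2 * (x * (x + c)) = x ^ 2 + (x ^ 2 + 2 * x * c) := by ring
      _ ≤ x ^ 2 + (x ^ 2 + 2 * x * c + c ^ 2) := add_le_add le_rfl le_self_add
      _ = _ := by ring
  rcases le_total a b with h | h
  · exact key a b h
  · rw [mul_comm a b, add_comm]
    exact key b a h

lemma prod_range_parity {M : Type*} [CommMonoid M] (f : ℕ → M) (n : ℕ) :
    ∏ l ∈ Finset.range (n + 1), f l =
      (∏ l ∈ Finset.range (n / 2 + 1), f (2 * l)) *
        ∏ l ∈ Finset.range ((n + 1) / 2), f (2 * l + 1) := by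
  have heven : ∀ q, ∏ l ∈ Finset.range (2 * q), f l =
      (∏ l ∈ Finset.range q, f (2 * l)) * ∏ l ∈ Finset.range q, f (2 * l + 1) := by
    intro q
    induction q with
    | zero => simp
    | succ q ih =>
      rw [Nat.mul_succ, Finset.prod_range_succ, Finset.prod_range_succ, ih,
        Finset.prod_range_succ, Finset.prod_range_succ, mul_assoc, mul_mul_mul_comm]
  rcases Nat.even_or_odd' n with ⟨q, rfl | rfl⟩
  · have h1 : 2 * q / 2 = q := by omega
    have h2 : (2 * q + 1) / 2 = q := by omega
    rw [Finset.prod_range_succ, heven, h1, h2, Finset.prod_range_succ _ q, mul_right_comm]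
  · have h1 : (2 * q + 1) / 2 + 1 = q + 1 := by omega
    have h2 : (2 * q + 1 + 1) / 2 = q + 1 := by omega
    rw [h1, h2, ← heven]
    rfl

lemma sum_pow_half_le {z : ℝ} (h0 : 0 ≤ z) (h1 : z < 1) (n : ℕ) :
    ∑ l ∈ Finset.range n, z ^ (l / 2) ≤ 2 / (1 - z) := by
  have heven : ∀ q, ∑ l ∈ Finset.range (2 * q), z ^ (l / 2) =
      2 * ∑ l ∈ Finset.range q, z ^ l := by
    intro q
    induction q with
    | zero => simp
    | succ q ih =>
      have h2 : 2 * q / 2 = q := by omega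
      have h3 : (2 * q + 1) / 2 = q := by omega
      rw [Nat.mul_succ, Finset.sum_range_succ, Finset.sum_range_succ, ih,
        Finset.sum_range_succ _ q, h2, h3]
      ring
  calc ∑ l ∈ Finset.range n, z ^ (l / 2) ≤ ∑ l ∈ Finset.range (2 * n), z ^ (l / 2) :=
        Finset.sum_le_sum_of_subset_of_nonneg (Finset.range_mono (by omega))
          fun _ _ _ => pow_nonneg h0 _
    _ = 2 * ∑ l ∈ Finset.range n, z ^ l := heven n
    _ ≤ 2 / (1 - z) := by
        rw [le_div_iff₀ (by linarith), mul_assoc, mul_comm (∑ l ∈ Finset.range n, z ^ l),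
          mul_neg_geom_sum]
        have := pow_nonneg h0 n
        linarith

namespace ProtocolInput

variable {V E : Type*} [Fintype E] [DecidableEq E] {N : Network V E} {A : StaticAlgorithm E}
  {G : Type*} [Fintype G] {Ω : Type*} [mΩ : MeasurableSpace Ω] {μ : Measure Ω}
  (X : ProtocolInput N A G μ) (p : FrameParams)

/-- What the analysis of the protocol needs to know about the parameters and the injections; the
bound on the injection rate enters through the weight of the overloaded blocks. -/
structure Standing : Prop where
  schedule : A.HasScheduleLength N p.f p.g
  J_ge : 600 ≤ p.J N.m
  fit : ⌊p.normalLength N.m⌋₊ + ⌊p.cleanupLength N.m⌋₊ ≤ p.T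
  T_pos : 0 < p.T
  overload : ∀ b, ∫⁻ ω in X.Overload p b,
    ENNReal.ofReal (growth N.m (p.J N.m) ^ (2 * X.windowHops p b ω)) ∂μ ≤
      ENNReal.ofReal ((drift N.m (p.J N.m) * N.m / 80) ^ 2)

/-- The Lyapunov function at the beginning of frame `k`. -/
noncomputable def level (k : ℕ) (ω : Ω) : ℝ≥0∞ :=
  lyapunov (growth N.m (p.J N.m)) (hopSum (X.frameStart p k ω).failed)

/-- `β` to the number of hops in the window of block `b` if the block is overloaded, and the
constant `c` otherwise. With different `c`, this bounds the factor by which the block changes the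
Lyapunov function, and what the block adds to it. -/
noncomputable def blockWeight (b : ℕ) (c : ℝ) (ω : Ω) : ℝ≥0∞ :=
  (X.Overload p b).indicator
      (fun ω => ENNReal.ofReal (growth N.m (p.J N.m) ^ X.windowHops p b ω)) ω +
    (X.Overload p b)ᶜ.indicator (fun _ => ENNReal.ofReal c) ω

variable {X p}

lemma blockWeight_of_mem {b : ℕ} {c : ℝ} {ω : Ω} (h : ω ∈ X.Overload p b) :
    X.blockWeight p b c ω = ENNReal.ofReal (growth N.m (p.J N.m) ^ X.windowHops p b ω) := by
  rw [blockWeight, Set.indicator_of_mem h, Set.indicator_of_notMem (by simpa using h), add_zero]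

lemma blockWeight_of_notMem {b : ℕ} {c : ℝ} {ω : Ω} (h : ω ∉ X.Overload p b) :
    X.blockWeight p b c ω = ENNReal.ofReal c := by
  rw [blockWeight, Set.indicator_of_notMem h, Set.indicator_of_mem (by simpa using h), zero_add]

lemma measurable_blockWeight (hT : 0 < p.T) (b : ℕ) (c : ℝ) :
    Measurable[X.sigmaOf (injections (window N p b))] (X.blockWeight p b c) := by
  have hO := X.measurableSet_overload p hT b
  have hH : Measurable[X.sigmaOf (injections (window N p b))]
      fun ω => ENNReal.ofReal (growth N.m (p.J N.m) ^ X.windowHops p b ω) :=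
    (Measurable.of_discrete (f := fun n : ℕ =>
      ENNReal.ofReal (growth N.m (p.J N.m) ^ n))).comp (X.measurable_windowHops p b)
  exact (hH.indicator hO).add (measurable_const.indicator hO.compl)

lemma injections_mono {S S' : Set ℕ} (h : S ⊆ S') :
    (injections S : Set (Source G E)) ⊆ injections S' := by
  rintro _ ⟨t, ht, g, rfl⟩
  exact ⟨t, h ht, g, rfl⟩

lemma disjoint_injections {S S' : Set ℕ} (h : Disjoint S S') :
    Disjoint (injections S : Set (Source G E)) (injections S') := by
  rw [Set.disjoint_left]
  rintro _ ⟨t, ht, g, rfl⟩ ⟨t', ht', g', h'⟩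
  obtain ⟨rfl, rfl⟩ : t = t' ∧ g = g' := by simpa using h'
  exact Set.disjoint_left.1 h ht ht'

variable [Nonempty E] [IsProbabilityMeasure μ]

lemma Standing.lintegral_blockWeight_sq_le (hX : X.Standing p) (b : ℕ) {c : ℝ} (hc : 0 ≤ c) :
    ∫⁻ ω, X.blockWeight p b c ω ^ 2 ∂μ ≤
      ENNReal.ofReal (c ^ 2 + (drift N.m (p.J N.m) * N.m / 80) ^ 2) := by
  have hO : MeasurableSet (X.Overload p b) :=
    X.sigmaOf_le _ _ (X.measurableSet_overload p hX.T_pos b)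
  have hβ := one_le_growth N.one_le_m hX.J_ge
  have hpt : ∀ ω, X.blockWeight p b c ω ^ 2 ≤ ENNReal.ofReal (c ^ 2) +
      (X.Overload p b).indicator
        (fun ω => ENNReal.ofReal (growth N.m (p.J N.m) ^ (2 * X.windowHops p b ω))) ω := by
    intro ω
    by_cases hω : ω ∈ X.Overload p b
    · rw [blockWeight_of_mem hω, Set.indicator_of_mem hω, ← ENNReal.ofReal_pow (by positivity),
        ← pow_mul, mul_comm]
      exact le_add_self
    · rw [blockWeight_of_notMem hω, Set.indicator_of_notMem hω, ← ENNReal.ofReal_pow hc]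
      exact le_self_add
  refine (lintegral_mono hpt).trans ?_
  rw [lintegral_add_left measurable_const, lintegral_const, measure_univ, mul_one,
    lintegral_indicator hO, ENNReal.ofReal_add (by positivity) (by positivity)]
  gcongr
  exact hX.overload b

variable {w : Ω → ℝ≥0∞}

/-- The drift over `n` frames of a block; `w` vanishes if the block is overloaded. -/
lemma Standing.lintegral_level_le (hX : X.Standing p) (b : ℕ)
    (hw : Measurable[X.sigmaOf (injections Set.univ)] w)
    (hgood : ∀ ω ∈ X.Overload p b, w ω = 0) (n : ℕ) (hn : n ≤ N.m) :
    ∫⁻ ω, w ω * X.level p (b * N.m + n) ω ∂μ ≤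
      ENNReal.ofReal ((1 - drift N.m (p.J N.m) / 2) ^ n) *
        ∫⁻ ω, w ω * X.level p (b * N.m) ω ∂μ +
      ENNReal.ofReal (n * (3 * failProb N.m (p.J N.m))) * ∫⁻ ω, w ω ∂μ := by
  have hm : (1 : ℝ) ≤ N.m := by exact_mod_cast N.one_le_m
  have hp := failProb_pos N.one_le_m hX.J_ge
  have hd := drift_pos N.one_le_m hX.J_ge
  have hdm := drift_mul_le N.one_le_m hX.J_ge
  have hd0 : 0 ≤ 1 - drift N.m (p.J N.m) / 2 := by nlinarith
  induction n with
  | zero => simp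
  | succ n ih =>
    have hfit := hX.fit
    have hk : b * N.m + n ∈ Finset.Ico (b * N.m) ((b + 1) * N.m) := by
      rw [Finset.mem_Ico, Nat.succ_mul]
      omega
    have hstep := X.lintegral_frame_le p hX.schedule hX.J_ge hX.fit (b * N.m + n) hw fun ω hω =>
      X.notOverloaded_of_notMem p (by omega) (by linarith [hX.J_ge]) hk
        fun hmem => hω (hgood ω hmem)
    refine hstep.trans ?_
    refine (add_le_add (mul_le_mul_right (ih (by omega)) _) le_rfl).trans ?_
    rw [mul_add, ← mul_assoc, ← mul_assoc, ← ENNReal.ofReal_mul hd0, ← ENNReal.ofReal_mul hd0,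
      add_assoc, ← add_mul, ← ENNReal.ofReal_add (by positivity) (by positivity), ← pow_succ']
    gcongr
    push_cast
    have : (1 - drift N.m (p.J N.m) / 2) * (n * (3 * failProb N.m (p.J N.m))) ≤
        1 * (n * (3 * failProb N.m (p.J N.m))) := by
      gcongr
      linarith
    linarith

lemma measurable_indicator_compl_overload (hT : 0 < p.T) (b : ℕ)
    (hw : Measurable[X.sigmaOf (injections Set.univ)] w) :
    Measurable[X.sigmaOf (injections Set.univ)] ((X.Overload p b)ᶜ.indicator w) :=
  hw.indicator (X.sigmaOf_mono (injections_mono (Set.subset_univ _)) _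
    (X.measurableSet_overload p hT b)).compl

/-- The recursion of the Lyapunov function over a block. -/
lemma Standing.lintegral_block_le (hX : X.Standing p) (b : ℕ)
    (hw : Measurable[X.sigmaOf (injections Set.univ)] w) :
    ∫⁻ ω, w ω * X.level p ((b + 1) * N.m) ω ∂μ ≤
      ∫⁻ ω, w ω * X.blockWeight p b (decay N.m (p.J N.m)) ω * X.level p (b * N.m) ω ∂μ +
        ∫⁻ ω, w ω * X.blockWeight p b (N.m * (3 * failProb N.m (p.J N.m))) ω ∂μ := by
  have hβ := one_le_growth N.one_le_m hX.J_ge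
  have hO : MeasurableSet (X.Overload p b) :=
    X.sigmaOf_le _ _ (X.measurableSet_overload p hX.T_pos b)
  have hwm : Measurable w := hw.mono (X.sigmaOf_le _) le_rfl
  have hZm : ∀ c, Measurable (X.blockWeight p b c) := fun c =>
    (measurable_blockWeight hX.T_pos b c).mono (X.sigmaOf_le _) le_rfl
  have hb : (b + 1) * N.m = b * N.m + N.m := Nat.succ_mul _ _
  have hgood : ∫⁻ ω in (X.Overload p b)ᶜ, w ω * X.level p ((b + 1) * N.m) ω ∂μ ≤
      ∫⁻ ω in (X.Overload p b)ᶜ,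
        w ω * X.blockWeight p b (decay N.m (p.J N.m)) ω * X.level p (b * N.m) ω ∂μ +
        ∫⁻ ω in (X.Overload p b)ᶜ,
          w ω * X.blockWeight p b (N.m * (3 * failProb N.m (p.J N.m))) ω ∂μ := by
    have h := hX.lintegral_level_le b (measurable_indicator_compl_overload hX.T_pos b hw)
      (fun ω hω => Set.indicator_of_notMem (by simpa using hω) _) N.m le_rfl
    simp only [← Set.indicator_mul_left] at h
    rw [lintegral_indicator hO.compl, lintegral_indicator hO.compl,
      lintegral_indicator hO.compl, ← hb] at h
    refine h.trans (le_of_eq ?_)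
    rw [← lintegral_const_mul' _ _ ENNReal.ofReal_ne_top,
      ← lintegral_const_mul' _ _ ENNReal.ofReal_ne_top]
    congr 1
    · refine setLIntegral_congr_fun hO.compl fun ω hω => ?_
      simp only [blockWeight_of_notMem hω, decay]
      ring
    · refine setLIntegral_congr_fun hO.compl fun ω hω => ?_
      simp only [blockWeight_of_notMem hω]
      ring
  have hbad : ∫⁻ ω in X.Overload p b, w ω * X.level p ((b + 1) * N.m) ω ∂μ ≤
      ∫⁻ ω in X.Overload p b,
        w ω * X.blockWeight p b (decay N.m (p.J N.m)) ω * X.level p (b * N.m) ω ∂μ +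
        ∫⁻ ω in X.Overload p b,
          w ω * X.blockWeight p b (N.m * (3 * failProb N.m (p.J N.m))) ω ∂μ := by
    have hwZ : Measurable fun ω =>
        w ω * X.blockWeight p b (N.m * (3 * failProb N.m (p.J N.m))) ω := hwm.mul (hZm _)
    rw [← lintegral_add_right _ hwZ]
    refine setLIntegral_mono' hO fun ω hω => ?_
    rw [blockWeight_of_mem hω, blockWeight_of_mem hω, mul_assoc, ← mul_add]
    gcongr
    have h1 := X.hopSum_le_add_windowHops p hX.fit (b := b) (by omega) le_rfl ω
    have h2 := (lyapunov_mono hβ ((Nat.le_add_right _ _).trans h1)).trans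
      (lyapunov_add_le hβ _ _)
    rwa [mul_add, mul_one] at h2
  rw [← lintegral_add_compl _ hO, ← lintegral_add_compl
    (fun ω => w ω * X.blockWeight p b (decay N.m (p.J N.m)) ω * X.level p (b * N.m) ω) hO,
    ← lintegral_add_compl
    (fun ω => w ω * X.blockWeight p b (N.m * (3 * failProb N.m (p.J N.m))) ω) hO,
    add_add_add_comm]
  exact add_le_add hbad hgood

/-- The recursion over blocks, unrolled. -/
lemma Standing.lintegral_level_le_sum (hX : X.Standing p) (b : ℕ)
    (hw : Measurable[X.sigmaOf (injections Set.univ)] w) :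
    ∫⁻ ω, w ω * X.level p (b * N.m) ω ∂μ ≤ ∑ j ∈ Finset.range b,
      ∫⁻ ω, X.blockWeight p j (N.m * (3 * failProb N.m (p.J N.m))) ω *
        (∏ i ∈ Finset.Ico (j + 1) b, X.blockWeight p i (decay N.m (p.J N.m)) ω) * w ω ∂μ := by
  induction b generalizing w with
  | zero =>
    have : ∀ ω, X.level p 0 ω = 0 := fun ω => lyapunov_zero
    simp [this]
  | succ b ih =>
    have hZ : Measurable[X.sigmaOf (injections Set.univ)]
        (X.blockWeight p b (decay N.m (p.J N.m))) :=
      (measurable_blockWeight hX.T_pos b _).mono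
        (X.sigmaOf_mono (injections_mono (Set.subset_univ _))) le_rfl
    refine (hX.lintegral_block_le b hw).trans ?_
    rw [Finset.sum_range_succ]
    refine add_le_add ((ih (hw.mul hZ)).trans (le_of_eq ?_)) (le_of_eq ?_)
    · refine Finset.sum_congr rfl fun j hj => lintegral_congr fun ω => ?_
      rw [Finset.prod_Ico_succ_top (Finset.mem_range.1 hj)]
      simp only [Pi.mul_apply]
      ring
    · refine lintegral_congr fun ω => ?_
      simp [mul_comm]

/-- Every other block weight is independent of the earlier ones. -/
lemma lintegral_prod_alternate_le (j r : ℕ) (U : ℕ → Ω → ℝ≥0∞) (c : ℕ → ℝ≥0∞)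
    (hU : ∀ l, Measurable[X.sigmaOf (injections (window N p (j + l)))] (U l))
    (hc : ∀ l, ∫⁻ ω, U l ω ^ 2 ∂μ ≤ c l) (n : ℕ) :
    ∫⁻ ω, (∏ l ∈ Finset.range n, U (2 * l + r) ω) ^ 2 ∂μ ≤
      ∏ l ∈ Finset.range n, c (2 * l + r) := by
  induction n with
  | zero => simp
  | succ n ih =>
    simp only [Finset.prod_range_succ, mul_pow]
    set t₀ := (j + (2 * n + r) - 1) * N.m * p.T with ht₀
    have h1 : Measurable[X.sigmaOf (injections {t | t < t₀})]
        fun ω => (∏ l ∈ Finset.range n, U (2 * l + r) ω) ^ 2 := by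
      refine Measurable.pow_const (Finset.measurable_fun_prod _ fun l hl => ?_) 2
      refine (hU (2 * l + r)).mono (X.sigmaOf_mono (injections_mono fun t ht => ?_)) le_rfl
      have h2 : t < (j + (2 * l + r) + 1) * N.m * p.T := (Finset.mem_Ico.1 ht).2
      refine h2.trans_le (Nat.mul_le_mul_right _ (Nat.mul_le_mul_right _ ?_))
      rw [Finset.mem_range] at hl
      omega
    have h3 : Measurable[X.sigmaOf (injections {t | t₀ ≤ t})]
        fun ω => U (2 * n + r) ω ^ 2 := by
      refine Measurable.pow_const ((hU (2 * n + r)).mono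
        (X.sigmaOf_mono (injections_mono fun t ht => ?_)) le_rfl) 2
      exact (Finset.mem_Ico.1 ht).1
    have hdis : Disjoint {t : ℕ | t < t₀} {t | t₀ ≤ t} :=
      Set.disjoint_left.2 fun t (h : t < t₀) (h' : t₀ ≤ t) => absurd h (not_lt.2 h')
    rw [lintegral_mul_eq_lintegral_mul_lintegral_of_independent_measurableSpace (X.sigmaOf_le _)
      (X.sigmaOf_le _) (X.indep_sigmaOf (disjoint_injections hdis)) h1 h3]
    exact mul_le_mul' ih (hc _)

/-- The product of the weights of consecutive blocks: the weights of neighbouring blocks are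
dependent, and are separated by `2 a b ≤ a² + b²`. -/
lemma Standing.lintegral_prod_blockWeight_le (hX : X.Standing p) (j n : ℕ) :
    ∫⁻ ω, X.blockWeight p j (N.m * (3 * failProb N.m (p.J N.m))) ω *
      (∏ i ∈ Finset.Ico (j + 1) (j + 1 + n), X.blockWeight p i (decay N.m (p.J N.m)) ω) ∂μ ≤
      ENNReal.ofReal (addend N.m (p.J N.m) * contraction N.m (p.J N.m) ^ (n / 2)) := by
  have hM := N.one_le_m
  have hJ := hX.J_ge
  have hm : (1 : ℝ) ≤ N.m := by exact_mod_cast hM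
  have hd := drift_pos hM hJ
  have hdm := drift_mul_le hM hJ
  have hp := failProb_pos hM hJ
  set z := contraction N.m (p.J N.m) with hz
  set y := addend N.m (p.J N.m) with hy
  have hy0 : 0 < y := by
    rw [hy, addend]
    positivity
  have hz0 : 0 ≤ z := by
    rw [hz, contraction]
    linarith
  have hz1 : z ≤ 1 := by
    have : 0 < drift N.m (p.J N.m) * N.m := by positivity
    rw [hz, contraction]
    linarith
  set U : ℕ → Ω → ℝ≥0∞ := fun l => if l = 0 then
    X.blockWeight p j (N.m * (3 * failProb N.m (p.J N.m))) else
    X.blockWeight p (j + l) (decay N.m (p.J N.m)) with hU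
  set c : ℕ → ℝ≥0∞ := fun l => if l = 0 then ENNReal.ofReal (y ^ 2) else ENNReal.ofReal z with hc
  have hUm : ∀ l, Measurable[X.sigmaOf (injections (window N p (j + l)))] (U l) := by
    intro l
    by_cases h : l = 0
    · subst h
      exact measurable_blockWeight hX.T_pos j _
    · simp only [hU, if_neg h]
      exact measurable_blockWeight hX.T_pos (j + l) _
  have hUc : ∀ l, ∫⁻ ω, U l ω ^ 2 ∂μ ≤ c l := by
    intro l
    by_cases h : l = 0
    · subst h
      exact (hX.lintegral_blockWeight_sq_le j (by positivity)).trans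
        (ENNReal.ofReal_le_ofReal (addend_sq_ge hM hJ le_rfl))
    · simp only [hU, hc, if_neg h]
      exact (hX.lintegral_blockWeight_sq_le (j + l) (decay_nonneg hM hJ)).trans
        (ENNReal.ofReal_le_ofReal (decay_sq_add_le hM hJ le_rfl))
  have hprod : ∀ ω, X.blockWeight p j (N.m * (3 * failProb N.m (p.J N.m))) ω *
      (∏ i ∈ Finset.Ico (j + 1) (j + 1 + n), X.blockWeight p i (decay N.m (p.J N.m)) ω) =
      (∏ l ∈ Finset.range (n / 2 + 1), U (2 * l + 0) ω) *
        ∏ l ∈ Finset.range ((n + 1) / 2), U (2 * l + 1) ω := by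
    intro ω
    simp only [add_zero]
    rw [← prod_range_parity (fun l => U l ω), Finset.prod_range_succ', mul_comm]
    congr 1
    rw [Finset.prod_Ico_eq_prod_range, Nat.add_sub_cancel_left]
    refine Finset.prod_congr rfl fun l _ => ?_
    simp only [hU, if_neg (Nat.succ_ne_zero l)]
    congr 1
    omega
  set Q₁ : Ω → ℝ≥0∞ := fun ω => ∏ l ∈ Finset.range (n / 2 + 1), U (2 * l + 0) ω with hQ₁
  set Q₂ : Ω → ℝ≥0∞ := fun ω => ∏ l ∈ Finset.range ((n + 1) / 2), U (2 * l + 1) ω with hQ₂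
  have hUm' : ∀ l, Measurable (U l) := fun l => (hUm l).mono (X.sigmaOf_le _) le_rfl
  have hQ₁m : Measurable Q₁ := Finset.measurable_fun_prod _ fun l _ => hUm' _
  have h1 : ∫⁻ ω, Q₁ ω ^ 2 ∂μ ≤ ENNReal.ofReal (y ^ 2 * z ^ (n / 2)) := by
    refine (lintegral_prod_alternate_le j 0 U c hUm hUc _).trans (le_of_eq ?_)
    rw [Finset.prod_range_succ', ENNReal.ofReal_mul (by positivity), mul_comm]
    simp [hc, ENNReal.ofReal_pow hz0]
  have h2 : ∫⁻ ω, Q₂ ω ^ 2 ∂μ ≤ ENNReal.ofReal (z ^ (n / 2)) := by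
    refine (lintegral_prod_alternate_le j 1 U c hUm hUc _).trans ?_
    simp only [hc, Nat.add_eq_zero_iff, one_ne_zero, and_false, if_false, Finset.prod_const,
      Finset.card_range]
    rw [← ENNReal.ofReal_pow hz0]
    exact ENNReal.ofReal_le_ofReal (pow_le_pow_of_le_one hz0 hz1 (by omega))
  set y' := ENNReal.ofReal y with hy'
  have hy'0 : 2 * y' ≠ 0 := by
    simpa [hy'] using hy0
  have hy't : 2 * y' ≠ ⊤ := by finiteness
  have key : 2 * y' * ∫⁻ ω, Q₁ ω * Q₂ ω ∂μ ≤
      2 * y' * ENNReal.ofReal (y * z ^ (n / 2)) := by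
    calc 2 * y' * ∫⁻ ω, Q₁ ω * Q₂ ω ∂μ = ∫⁻ ω, 2 * (Q₁ ω * (y' * Q₂ ω)) ∂μ := by
          rw [← lintegral_const_mul' _ _ hy't]
          refine lintegral_congr fun ω => ?_
          ring
      _ ≤ ∫⁻ ω, Q₁ ω ^ 2 + (y' * Q₂ ω) ^ 2 ∂μ :=
          lintegral_mono fun ω => ENNReal.two_mul_mul_le_sq_add_sq _ _
      _ = ∫⁻ ω, Q₁ ω ^ 2 ∂μ + y' ^ 2 * ∫⁻ ω, Q₂ ω ^ 2 ∂μ := by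
          rw [lintegral_add_left (hQ₁m.pow_const 2), ← lintegral_const_mul' _ _ (by finiteness)]
          simp only [mul_pow]
      _ ≤ ENNReal.ofReal (y ^ 2 * z ^ (n / 2)) + y' ^ 2 * ENNReal.ofReal (z ^ (n / 2)) := by
          gcongr
      _ = 2 * y' * ENNReal.ofReal (y * z ^ (n / 2)) := by
          rw [hy', ENNReal.ofReal_mul (by positivity), ENNReal.ofReal_mul hy0.le,
            ENNReal.ofReal_pow hy0.le]
          ring
  rw [lintegral_congr hprod]
  exact (ENNReal.mul_le_mul_iff_right hy'0 hy't).1 key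

/-- At each time, the expected value of the Lyapunov function is at most `1`. -/
lemma Standing.lintegral_buffer_le_one (hX : X.Standing p) (k : ℕ) :
    ∫⁻ ω, lyapunov (growth N.m (p.J N.m)) (hopSum (X.buffer p k ω)) ∂μ ≤ 1 := by
  have hM := N.one_le_m
  have hJ := hX.J_ge
  have hm : (1 : ℝ) ≤ N.m := by exact_mod_cast hM
  have hd := drift_pos hM hJ
  have hdm := drift_mul_le hM hJ
  have hp := failProb_pos hM hJ
  have hp1 := failProb_le hM hJ
  have hβ := one_le_growth hM hJ
  have hM0 : 0 < N.m := hM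
  set β := growth N.m (p.J N.m) with hβdef
  set b := k / N.m with hb
  set n := k % N.m with hn
  have hnlt : n < N.m := Nat.mod_lt _ hM0
  have hk : k = b * N.m + n := by rw [hb, hn, mul_comm, Nat.div_add_mod]
  have hk1 : b * N.m ≤ k := by omega
  have hk2 : k < (b + 1) * N.m := by rw [Nat.succ_mul]; omega
  have hO : MeasurableSet (X.Overload p b) :=
    X.sigmaOf_le _ _ (X.measurableSet_overload p hX.T_pos b)
  set Z := X.blockWeight p b (decay N.m (p.J N.m)) with hZ
  set Y := X.blockWeight p b (N.m * (3 * failProb N.m (p.J N.m))) with hY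
  set ℓ := X.level p (b * N.m) with hℓ
  have hYm : Measurable Y := (measurable_blockWeight hX.T_pos b _).mono (X.sigmaOf_le _) le_rfl
  have hone : Measurable[X.sigmaOf (injections Set.univ)] (fun _ : Ω => (1 : ℝ≥0∞)) :=
    measurable_const
  have hgood : ∫⁻ ω in (X.Overload p b)ᶜ, lyapunov β (hopSum (X.buffer p k ω)) ∂μ ≤
      2 * ∫⁻ ω, ℓ ω ∂μ + 2 * ∫⁻ ω in (X.Overload p b)ᶜ, Y ω ∂μ := by
    set v := (X.Overload p b)ᶜ.indicator (fun _ : Ω => (1 : ℝ≥0∞)) with hv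
    have hvm := measurable_indicator_compl_overload (X := X) hX.T_pos b hone
    have hv0 : ∀ ω ∈ X.Overload p b, v ω = 0 := fun ω hω =>
      Set.indicator_of_notMem (by simpa using hω) _
    have hfit := hX.fit
    have h1 := X.lintegral_buffer_le p hX.schedule hJ k hvm fun ω hω =>
      X.notOverloaded_of_notMem p (by omega) (by linarith) (Finset.mem_Ico.2 ⟨hk1, hk2⟩)
        fun hmem => hω (hv0 ω hmem)
    have h2 := hX.lintegral_level_le b hvm hv0 n hnlt.le
    rw [← hk] at h2
    have hvint : ∀ F : Ω → ℝ≥0∞, ∫⁻ ω, v ω * F ω ∂μ = ∫⁻ ω in (X.Overload p b)ᶜ, F ω ∂μ := by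
      intro F
      rw [← lintegral_indicator hO.compl]
      refine lintegral_congr fun ω => ?_
      rw [hv, ← Set.indicator_mul_left]
      simp
    have hvint1 : ∫⁻ ω, v ω ∂μ = ∫⁻ _ω in (X.Overload p b)ᶜ, 1 ∂μ := by
      rw [← hvint]
      simp
    have hYint : ∫⁻ ω in (X.Overload p b)ᶜ, Y ω ∂μ =
        ENNReal.ofReal (N.m * (3 * failProb N.m (p.J N.m))) * ∫⁻ ω, v ω ∂μ := by
      rw [hvint1, ← lintegral_const_mul' _ _ ENNReal.ofReal_ne_top]
      refine setLIntegral_congr_fun hO.compl fun ω hω => ?_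
      rw [hY]
      simp only [blockWeight_of_notMem hω, mul_one]
    have h3 : ∫⁻ ω, v ω * X.level p k ω ∂μ ≤ ∫⁻ ω, ℓ ω ∂μ +
        ENNReal.ofReal (n * (3 * failProb N.m (p.J N.m))) * ∫⁻ ω, v ω ∂μ := by
      refine h2.trans (add_le_add ?_ le_rfl)
      have h4 : ENNReal.ofReal ((1 - drift N.m (p.J N.m) / 2) ^ n) ≤ 1 := by
        rw [ENNReal.ofReal_le_one]
        exact pow_le_one₀ (by nlinarith) (by linarith)
      rw [hvint]
      calc _ ≤ 1 * ∫⁻ ω in (X.Overload p b)ᶜ, ℓ ω ∂μ := by gcongr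
        _ ≤ ∫⁻ ω, ℓ ω ∂μ := by
          rw [one_mul]
          exact setLIntegral_le_lintegral _ _
    have h5 : ENNReal.ofReal (1 + 3 * failProb N.m (p.J N.m)) ≤ 2 := by
      rw [← ENNReal.ofReal_ofNat 2]
      exact ENNReal.ofReal_le_ofReal (by linarith)
    rw [← hvint]
    refine h1.trans ?_
    calc ENNReal.ofReal (1 + 3 * failProb N.m (p.J N.m)) * ∫⁻ ω, v ω * X.level p k ω ∂μ +
          ENNReal.ofReal (3 * failProb N.m (p.J N.m)) * ∫⁻ ω, v ω ∂μ
        ≤ 2 * (∫⁻ ω, ℓ ω ∂μ + ENNReal.ofReal (n * (3 * failProb N.m (p.J N.m))) *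
            ∫⁻ ω, v ω ∂μ) + 2 * (ENNReal.ofReal (3 * failProb N.m (p.J N.m)) *
            ∫⁻ ω, v ω ∂μ) := by
          refine add_le_add (mul_le_mul' h5 h3) ?_
          exact le_mul_of_one_le_left' (by norm_num)
      _ = 2 * ∫⁻ ω, ℓ ω ∂μ + 2 * ((ENNReal.ofReal (n * (3 * failProb N.m (p.J N.m))) +
            ENNReal.ofReal (3 * failProb N.m (p.J N.m))) * ∫⁻ ω, v ω ∂μ) := by ring
      _ ≤ _ := by
          rw [hYint, ← ENNReal.ofReal_add (by positivity) (by positivity)]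
          gcongr
          have : (n : ℝ) + 1 ≤ N.m := by exact_mod_cast hnlt
          nlinarith
  have hbad : ∫⁻ ω in X.Overload p b, lyapunov β (hopSum (X.buffer p k ω)) ∂μ ≤
      2 * ∫⁻ ω, Z ω * ℓ ω ∂μ + 2 * ∫⁻ ω in X.Overload p b, Y ω ∂μ := by
    calc ∫⁻ ω in X.Overload p b, lyapunov β (hopSum (X.buffer p k ω)) ∂μ
        ≤ ∫⁻ ω in X.Overload p b, Z ω * ℓ ω + Y ω ∂μ := by
          refine setLIntegral_mono' hO fun ω hω => ?_
          rw [hZ, hY, blockWeight_of_mem hω, blockWeight_of_mem hω]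
          have h1 := X.hopSum_buffer_le_add_windowHops p hX.fit hk1 hk2.le ω
          have h2 := (lyapunov_mono hβ h1).trans (lyapunov_add_le hβ _ _)
          rwa [mul_add, mul_one] at h2
      _ = ∫⁻ ω in X.Overload p b, Z ω * ℓ ω ∂μ + ∫⁻ ω in X.Overload p b, Y ω ∂μ :=
          lintegral_add_right _ hYm
      _ ≤ ∫⁻ ω, Z ω * ℓ ω ∂μ + ∫⁻ ω in X.Overload p b, Y ω ∂μ :=
          add_le_add (setLIntegral_le_lintegral _ _) le_rfl
      _ ≤ _ := add_le_add (le_mul_of_one_le_left' (by norm_num))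
          (le_mul_of_one_le_left' (by norm_num))
  set y := addend N.m (p.J N.m) with hy
  set z := contraction N.m (p.J N.m) with hz
  have hy0 : 0 < y := by
    rw [hy, addend]
    positivity
  have hs0 : 0 < drift N.m (p.J N.m) * N.m := by positivity
  have hz0 : 0 ≤ z := by
    rw [hz, contraction]
    linarith
  have hz1 : z < 1 := by
    rw [hz, contraction]
    linarith
  -- `a n` bounds the contribution to the Lyapunov function of what was added `n` blocks ago.
  set a : ℕ → ℝ := fun n => y * z ^ (n / 2) with ha
  have ha0 : ∀ n, 0 ≤ a n := fun n => by positivity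
  have hsum : ∀ c : ℕ, ∑ j ∈ Finset.range c, ENNReal.ofReal (a (c - 1 - j)) ≤
      ENNReal.ofReal (1 / 5) := by
    intro c
    rw [← ENNReal.ofReal_sum_of_nonneg fun j _ => ha0 _, Finset.sum_range_reflect a c]
    refine ENNReal.ofReal_le_ofReal ?_
    rw [ha, ← Finset.mul_sum]
    calc y * ∑ l ∈ Finset.range c, z ^ (l / 2) ≤ y * (2 / (1 - z)) := by
          gcongr
          exact sum_pow_half_le hz0 hz1 c
      _ = 1 / 5 := by
          have : 1 - z = drift N.m (p.J N.m) * N.m / 4 := by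
            rw [hz, contraction]
            ring
          rw [this, hy, addend]
          field_simp
          norm_num
  have hA1 : ∫⁻ ω, ℓ ω ∂μ ≤ ENNReal.ofReal (1 / 5) := by
    have h := hX.lintegral_level_le_sum b hone
    simp only [one_mul, mul_one] at h
    refine h.trans ((Finset.sum_le_sum fun j hj => ?_).trans (hsum b))
    have hj' : b = j + 1 + (b - 1 - j) := by
      rw [Finset.mem_range] at hj
      omega
    have h' := hX.lintegral_prod_blockWeight_le j (b - 1 - j)
    rwa [← hj'] at h'
  have hA2 : ∫⁻ ω, Z ω * ℓ ω ∂μ + ∫⁻ ω, Y ω ∂μ ≤ ENNReal.ofReal (1 / 5) := by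
    have hZm : Measurable[X.sigmaOf (injections Set.univ)] Z :=
      (measurable_blockWeight hX.T_pos b _).mono
        (X.sigmaOf_mono (injections_mono (Set.subset_univ _))) le_rfl
    have h := hX.lintegral_level_le_sum b hZm
    refine le_trans ?_ (hsum (b + 1))
    rw [Finset.sum_range_succ]
    refine add_le_add (h.trans (Finset.sum_le_sum fun j hj => ?_)) ?_
    · rw [Finset.mem_range] at hj
      have hj' : b + 1 = j + 1 + (b + 1 - 1 - j) := by omega
      have h' := hX.lintegral_prod_blockWeight_le j (b + 1 - 1 - j)
      rw [← hj'] at h'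
      refine le_trans (le_of_eq (lintegral_congr fun ω => ?_)) h'
      rw [Finset.prod_Ico_succ_top hj, mul_assoc]
    · have h' := hX.lintegral_prod_blockWeight_le b 0
      simpa [ha, hY, hy] using h'
  calc ∫⁻ ω, lyapunov β (hopSum (X.buffer p k ω)) ∂μ
      = ∫⁻ ω in X.Overload p b, lyapunov β (hopSum (X.buffer p k ω)) ∂μ +
          ∫⁻ ω in (X.Overload p b)ᶜ, lyapunov β (hopSum (X.buffer p k ω)) ∂μ :=
        (lintegral_add_compl _ hO).symm
    _ ≤ (2 * ∫⁻ ω, Z ω * ℓ ω ∂μ + 2 * ∫⁻ ω in X.Overload p b, Y ω ∂μ) +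
          (2 * ∫⁻ ω, ℓ ω ∂μ + 2 * ∫⁻ ω in (X.Overload p b)ᶜ, Y ω ∂μ) := add_le_add hbad hgood
    _ = 2 * (∫⁻ ω, ℓ ω ∂μ) + 2 * (∫⁻ ω, Z ω * ℓ ω ∂μ + ∫⁻ ω, Y ω ∂μ) := by
        rw [← lintegral_add_compl (μ := μ) Y hO]
        ring
    _ ≤ 2 * ENNReal.ofReal (1 / 5) + 2 * ENNReal.ofReal (1 / 5) := by gcongr
    _ ≤ 1 := by
        rw [← ENNReal.ofReal_ofNat 2, ← ENNReal.ofReal_mul (by norm_num),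
          ← ENNReal.ofReal_add (by norm_num) (by norm_num), ENNReal.ofReal_le_one]
        norm_num

end ProtocolInput

/-! ### Stability of the protocol -/

namespace ProtocolInput

variable {V E : Type*} [Fintype E] [DecidableEq E] {N : Network V E} {A : StaticAlgorithm E}
  {G : Type*} [Fintype G] {Ω : Type*} [mΩ : MeasurableSpace Ω] {μ : Measure Ω}
  {X : ProtocolInput N A G μ} {p : FrameParams}

lemma length_injected_le (t₀ s : ℕ) (ω : Ω) :
    (X.injected t₀ s ω).length ≤ s * Fintype.card G := by
  have h := X.sum_map_injected (fun _ => 1) t₀ s ω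
  simp only [List.map_const', List.sum_replicate, smul_eq_mul, mul_one] at h
  rw [h]
  refine (Finset.sum_le_card_nsmul _ _ (Fintype.card G) fun i _ => ?_).trans (by simp)
  refine (Finset.sum_le_card_nsmul _ _ 1 fun g _ => ?_).trans (by simp)
  cases X.inj (t₀ + i) g ω <;> simp

lemma hopSum_injected_le (t₀ s : ℕ) (ω : Ω) :
    hopSum (X.injected t₀ s ω) ≤ s * Fintype.card G * N.m := by
  refine (hopSum_le_length_mul fun r hr => ?_).trans
    (Nat.mul_le_mul_right _ (length_injected_le t₀ s ω))
  simp only [injected, List.mem_flatMap, List.mem_filterMap] at hr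
  obtain ⟨i, -, g, -, h⟩ := hr
  obtain ⟨P, -, rfl⟩ := Option.map_eq_some_iff.1 h
  exact N.hops_le_m P

/-- The number of packets that have not failed is bounded, as they leave the network after at most
`m` frames. -/
lemma length_unfailed_le (hfit : ⌊p.normalLength N.m⌋₊ ≤ p.T) (t : ℕ) (ω : Ω) :
    (X.stateAt p t ω).unfailed.length ≤ N.m * (p.T * Fintype.card G * N.m) := by
  rw [stateAt, within_unfailed]
  refine (length_unfailedAfter_le _ _ _ _).trans ((length_le_hopSum _).trans ?_)
  refine (X.unfailed_sublist p hfit _ ω).hopSum_le.trans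
    ((X.hopSum_virtualPackets_le p _ ω).trans ?_)
  refine (Finset.sum_le_card_nsmul _ _ _ fun j _ => hopSum_injected_le _ _ ω).trans ?_
  rw [Nat.card_Ico, smul_eq_mul]
  exact Nat.mul_le_mul_right _ (by omega)

variable [Nonempty E] [IsProbabilityMeasure μ]

lemma floor_fit (hA : A.HasScheduleLength N p.f p.g) (hJ : 600 ≤ p.J N.m) (hf : 1 ≤ p.f N.m)
    (hfit : p.normalLength N.m + p.cleanupLength N.m ≤ p.T) (X : ProtocolInput N A G μ) :
    ⌊p.normalLength N.m⌋₊ + ⌊p.cleanupLength N.m⌋₊ ≤ p.T := by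
  obtain ⟨e⟩ := ‹Nonempty E›
  have hm : (1 : ℝ) ≤ N.m := by exact_mod_cast N.one_le_m
  have h1 := X.cleanupEvent_ge p hA hJ 0 e
  have h2 : 0 < 1 / (3 * (N.m : ℝ)) := by positivity
  have h3 : (X.cleanupEvent p 0 e).Nonempty := by
    by_contra hcon
    rw [Set.not_nonempty_iff_eq_empty.1 hcon, measureReal_empty] at h1
    linarith
  obtain ⟨ω, -, a, ha, -⟩ := h3
  have hc : 0 ≤ p.cleanupLength N.m := by
    by_contra hcon
    rw [Nat.floor_of_nonpos (not_le.1 hcon).le] at ha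
    omega
  have hn : 0 ≤ p.normalLength N.m := by
    rw [FrameParams.cleanupLength] at hc
    rw [FrameParams.normalLength]
    nlinarith
  have h4 := Nat.floor_le hc
  have h5 := Nat.floor_le hn
  have h6 : ((⌊p.normalLength N.m⌋₊ + ⌊p.cleanupLength N.m⌋₊ : ℕ) : ℝ) ≤ p.T := by
    push_cast
    linarith
  exact_mod_cast h6

lemma standing_of_admissible (hA : A.HasScheduleLength N p.f p.g)
    (hg : MonotoneOn (p.g N.m) (Set.Ici 1)) (hf : 1 ≤ p.f N.m) (hε : 0 < p.ε)
    (hε' : p.ε ≤ 1 / 2) (hp : p.Admissible N.m) (hX : X.RateAtMost (p.rate N.m)) :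
    X.Standing p := by
  have hJ := J_ge hf hε hε' hp
  have hT := T_pos hf hε hp
  have hrate : 0 ≤ p.rate N.m := div_nonneg (by linarith) (by linarith)
  refine ⟨hA, hJ, floor_fit hA hJ hf (phases_fit hg hf hε hε' hp) X, hT, fun b => ?_⟩
  refine (X.lintegral_overload_le p hX hJ hrate hT hε hε' b).trans (ENNReal.ofReal_le_ofReal ?_)
  refine overload_small N.one_le_m hε hε' ?_ ?_ hJ
  · have h1 := div_f_ge hf hp
    have h2 : p.ε ^ 2 * (p.rate N.m * p.T) = p.ε ^ 2 * (1 - p.ε) * (p.T / p.f N.m) := by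
      rw [FrameParams.rate]
      ring
    have hL : 0 ≤ Real.log N.m := Real.log_natCast_nonneg _
    rw [h2]
    calc 50 / p.ε + 24 * Real.log N.m
        = p.ε ^ 2 * (1 / 2) * (100 / p.ε ^ 3 + 48 * Real.log N.m / p.ε ^ 2) := by
          field_simp
          ring
      _ ≤ p.ε ^ 2 * (1 - p.ε) * (p.T / p.f N.m) := by
          have h3 : 0 ≤ 1 - p.ε := by linarith
          gcongr
          linarith
  · rw [FrameParams.J]
    field_simp

lemma hopSum_stateAt_le (t : ℕ) (ω : Ω) :
    X.potential p t ω ≤ hopSum (X.buffer p (t / p.T) ω) :=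
  X.hopSum_within_failed_le p _ ω _

lemma fiberMeas_potential (t : ℕ) : FiberMeas mΩ (X.potential p t) :=
  (X.fiberMeas_stateAt p t).comp fun S => (S.failed.map Route.hops).sum

lemma Standing.lintegral_potential_le_one (hX : X.Standing p) (t : ℕ) :
    ∫⁻ ω, lyapunov (growth N.m (p.J N.m)) (X.potential p t ω) ∂μ ≤ 1 :=
  (lintegral_mono fun ω => lyapunov_mono (one_le_growth N.one_le_m hX.J_ge)
    (hopSum_stateAt_le t ω)).trans (hX.lintegral_buffer_le_one _)

/-- The geometric tail of the potential, by Markov's inequality for the Lyapunov function. -/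
lemma Standing.potential_tail (hX : X.Standing p) (t k : ℕ) :
    μ.real {ω | k ≤ X.potential p t ω} ≤ tailRatio N.m (p.J N.m) ^ k := by
  have hβ := one_le_growth N.one_le_m hX.J_ge
  have hq := tailRatio_pos N.one_le_m hX.J_ge
  rcases Nat.eq_zero_or_pos k with rfl | hk
  · simp
  have hm : Measurable fun ω => lyapunov (growth N.m (p.J N.m)) (X.potential p t ω) :=
    (fiberMeas_potential t).measurable _
  have h1 := mul_meas_ge_le_lintegral (μ := μ) hm
    (ENNReal.ofReal (growth N.m (p.J N.m) ^ k))
  have h2 : {ω | k ≤ X.potential p t ω} ⊆ {ω | ENNReal.ofReal (growth N.m (p.J N.m) ^ k) ≤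
      lyapunov (growth N.m (p.J N.m)) (X.potential p t ω)} := by
    intro ω hω
    have h3 := lyapunov_mono hβ (show k ≤ X.potential p t ω from hω)
    rwa [lyapunov, if_neg hk.ne'] at h3
  have h4 : ENNReal.ofReal (growth N.m (p.J N.m) ^ k) * μ {ω | k ≤ X.potential p t ω} ≤ 1 :=
    (mul_le_mul_right (measure_mono h2) _).trans (h1.trans (hX.lintegral_potential_le_one t))
  rw [← ofReal_measureReal, ← ENNReal.ofReal_mul (by positivity), ENNReal.ofReal_le_one, growth,
    inv_pow, inv_mul_le_iff₀ (by positivity), mul_one] at h4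
  exact h4

lemma le_lyapunov {β : ℝ} (hβ : 1 < β) (n : ℕ) :
    (n : ℝ≥0∞) ≤ ENNReal.ofReal (β - 1)⁻¹ * lyapunov β n := by
  rcases Nat.eq_zero_or_pos n with rfl | hn
  · simp
  rw [lyapunov, if_neg hn.ne', ← ENNReal.ofReal_mul (by simpa using hβ.le),
    ← ENNReal.ofReal_natCast]
  refine ENNReal.ofReal_le_ofReal ?_
  rw [le_inv_mul_iff₀ (by linarith)]
  have := one_add_mul_le_pow (by linarith : -2 ≤ β - 1) n
  rw [add_sub_cancel] at this
  linarith

lemma Standing.queueLength_bounded (hX : X.Standing p) :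
    ∃ C : ℝ, ∀ t : ℕ, Integrable (fun ω => (X.queueLength p t ω : ℝ)) μ ∧
      ∫ ω, (X.queueLength p t ω : ℝ) ∂μ ≤ C := by
  set β := growth N.m (p.J N.m) with hβdef
  have hβ : 1 < β := (one_lt_inv₀ (tailRatio_pos N.one_le_m hX.J_ge)).2
    (tailRatio_lt_one N.one_le_m hX.J_ge)
  set C₀ : ℕ := p.T * Fintype.card G + N.m * (p.T * Fintype.card G * N.m) with hC₀
  have hfit := hX.fit
  have hpt : ∀ t ω, (X.queueLength p t ω : ℝ≥0∞) ≤
      C₀ + ENNReal.ofReal (β - 1)⁻¹ * lyapunov β (X.potential p t ω) := by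
    intro t ω
    have h1 : X.queueLength p t ω ≤ C₀ + X.potential p t ω := by
      have h2 := length_injected_le (X := X) (t / p.T * p.T) (t % p.T) ω
      have h3 := length_unfailed_le (X := X) (p := p) (by omega) t ω
      have h4 : (X.stateAt p t ω).failed.length ≤ X.potential p t ω := length_le_hopSum _
      have h5 : t % p.T * Fintype.card G ≤ p.T * Fintype.card G :=
        Nat.mul_le_mul_right _ (Nat.mod_lt _ hX.T_pos).le
      rw [queueLength]
      omega
    calc (X.queueLength p t ω : ℝ≥0∞) ≤ ((C₀ + X.potential p t ω : ℕ) : ℝ≥0∞) := by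
          exact_mod_cast h1
      _ = C₀ + (X.potential p t ω : ℝ≥0∞) := by push_cast; rfl
      _ ≤ _ := add_le_add le_rfl (le_lyapunov hβ _)
  have hint : ∀ t, ∫⁻ ω, (X.queueLength p t ω : ℝ≥0∞) ∂μ ≤
      ENNReal.ofReal (C₀ + (β - 1)⁻¹) := by
    intro t
    refine (lintegral_mono (hpt t)).trans ?_
    rw [lintegral_add_left measurable_const, lintegral_const, measure_univ, mul_one,
      lintegral_const_mul' _ _ ENNReal.ofReal_ne_top,
      ENNReal.ofReal_add (Nat.cast_nonneg _) (by simpa using hβ.le), ENNReal.ofReal_natCast]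
    gcongr
    exact mul_le_of_le_one_right' (hX.lintegral_potential_le_one t)
  refine ⟨C₀ + (β - 1)⁻¹, fun t => ?_⟩
  have hmeas : Measurable fun ω => (X.queueLength p t ω : ℝ) :=
    (X.fiberMeas_queueLength p t).measurable _
  have hnn : ∀ ω, 0 ≤ (X.queueLength p t ω : ℝ) := fun ω => Nat.cast_nonneg _
  have hlint : ∫⁻ ω, ENNReal.ofReal (X.queueLength p t ω : ℝ) ∂μ ≤
      ENNReal.ofReal (C₀ + (β - 1)⁻¹) := by
    simp only [ENNReal.ofReal_natCast]
    exact hint t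
  have hI : Integrable (fun ω => (X.queueLength p t ω : ℝ)) μ := by
    refine ⟨hmeas.aestronglyMeasurable, ?_⟩
    rw [hasFiniteIntegral_iff_ofReal (Filter.Eventually.of_forall hnn)]
    exact hlint.trans_lt ENNReal.ofReal_lt_top
  refine ⟨hI, ?_⟩
  rw [← ofReal_integral_eq_lintegral_ofReal hI (Filter.Eventually.of_forall hnn)] at hlint
  refine (ENNReal.ofReal_le_ofReal_iff ?_).1 hlint
  have : 0 ≤ (β - 1)⁻¹ := by simpa using hβ.le
  positivity

end ProtocolInput

theorem mainTheorem2 {V E G Ω : Type*} [Fintype E] [DecidableEq E] [Nonempty E] [Fintype G]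
    [MeasurableSpace Ω] (μ : Measure Ω) [IsProbabilityMeasure μ]
    (N : Network V E) (A : StaticAlgorithm E) (f : ℕ → ℝ) (g : ℕ → ℝ → ℝ)
    (hg_mono : MonotoneOn (g N.m) (Set.Ici 1))
    (hg_sublinear : g N.m =o[atTop] (fun n : ℝ => n))
    (hA : A.HasScheduleLength N f g) (ε : ℝ) (hε_pos : 0 < ε) (hε_le : ε ≤ 1 / 2) :
    (∀ᶠ T : ℕ in atTop, (FrameParams.mk f g ε T).Admissible N.m) ∧
    ∀ (T : ℕ) (p : FrameParams), p = ⟨f, g, ε, T⟩ → p.Admissible N.m →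
      p.normalLength N.m + p.cleanupLength N.m ≤ T ∧
      ∀ X : ProtocolInput N A G μ, X.RateAtMost (p.rate N.m) →
        (∃ C : ℝ, ∀ t : ℕ, Integrable (fun ω => (X.queueLength p t ω : ℝ)) μ ∧
          ∫ ω, (X.queueLength p t ω : ℝ) ∂μ ≤ C) ∧
        ∀ t k : ℕ, μ.real {ω | k ≤ X.potential p t ω} ≤
          (1 - 1 / ((N.m : ℝ) ^ 2 * p.J N.m)) ^ k := by
  have hf := one_le_f hg_sublinear hA
  refine ⟨eventually_admissible hg_sublinear hf hε_pos, ?_⟩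
  rintro T p rfl hp
  refine ⟨phases_fit hg_mono hf hε_pos hε_le hp, fun X hX => ?_⟩
  have hS : X.Standing ⟨f, g, ε, T⟩ :=
    ProtocolInput.standing_of_admissible hA hg_mono hf hε_pos hε_le hp hX
  exact ⟨hS.queueLength_bounded, hS.potential_tail⟩
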